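/- **Trees.** A $\beta(1,0)$-tree is a rooted plane tree with labels such that every leaf other than the root has label $1$, the root's label is the sum of its children's labels (so the one-node tree $\bullet$ has root label $0$), and any other node has a positive integer label no greater than the sum of its children's labels. For $\beta(1,0)$-trees $u,v$, let $u\oplus v$ be obtained by identifying the two roots and adding their labels (subtrees of $u$ first). For $1\le i\le \mathrm{root}(t)$, where $\mathrm{root}(t)$ is the root label, let $\lambda_i(t)$ be obtained by joining a new root to the old root and giving both the label $i$; also $\lambda_1(\bullet)$ is the tree with one edge. Every $\beta(1,0)$-tree is uniquely of one of the forms: $\bullet$; $\lambda_i(t)$; or a sum under $\oplus$ of at least two trees of the form $\lambda_i(t)$. The mirror map $m$ recursively reverses the order of subtrees. Let $u\oslash v$ (for $u,v\ne\bullet$) be obtained by identifying the rightmost leaf of $u$ with the root of $v$ and giving that node the label $1$. Let $\gamma_i(t)$, for $i$ between $1$ and the number of edges of the path from the root to the rightmost leaf (the right path), be obtained by joining a new rightmost leaf with label $1$ to the $i$-th node of the right path (the root is the first) and adding $1$ to the labels of all other nodes of the new right path; $\gamma_1(\bullet)=\lambda_1(\bullet)$. Define $h$ by $h(\bullet)=\bullet$,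 $h(\lambda_i(t))=\gamma_i(h(t))$ and $h(u\oplus v)=h(v)\oslash h(u)$ for $u,v\neq\bullet$. **Avoiders.** An avoider of length $n$ is a permutation $a_1\dots a_n$ of $\{1,\dots,n\}$ that avoids 3-1-4-2 (there are no $i<j<k<l$ with $a_j<a_l<a_i<a_k$) and 2-41-3 (there are no $i<j$ and $k>j+1$ with $a_{j+1}<a_i<a_k<a_j$). Write $\alpha\prec\beta$ if every letter of the word $\alpha$ is smaller than every letter of $\beta$. Let $\sigma\oplus\tau=\sigma\tau'$, where $\tau'$ is $\tau$ with $|\sigma|$ added to each letter. For a permutation $\pi=\sigma n\tau$ of $\{1,\dots,n\}$ that is an avoider with $\sigma$ nonempty and $n-1$ in $\tau$, let $\sigma_1\prec\dots\prec\sigma_k$ be the maximal factors of $\sigma$ whose letters form a set of consecutive integers, with $\sigma_{k+1}$ empty; for $1\le i\le k$ let $w_i=u_i\hat 0_iv_i$, with $\hat 0_i=\min w_i$, be the subword of the letters $x$ of $\tau$ with $\sigma_i\prec x\prec\sigma_{i+1}$; let $m_i$ be the number of letters $x$ of $v_i$ with $x\prec u_i$, and let $L=\bigcup_{i=1}^k\{x+m_i+1:x\in\sigma_i\}$.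 Then $\psi(\pi)=\sigma'n\tau'$, where $\sigma'$ and $\tau'$ are the words with letter sets $L$ and $\{1,\dots,n-1\}\setminus L$ that are order-isomorphic to $\sigma$ and $\tau$. For an avoider $\pi$ of length $n-1$ with at least $i\geq 1$ left-to-right maxima let $\hat\pi$ be obtained by inserting $n$ immediately to the left of the $i$-th left-to-right maximum, and let $\phi_1(\pi)=\hat\pi$ and $\phi_i(\pi)=\psi(\hat\pi)$ for $i>1$; also $\phi_1(\varepsilon)=1$, where $\varepsilon$ is the empty permutation. Define $f$ on $\beta(1,0)$-trees by $f(\bullet)=\varepsilon$, $f(\lambda_i(t))=\phi_i(f(t))$ and $f(u\oplus v)=f(u)\oplus f(v)$. **Statistics.** For a permutation $\pi=a_1\dots a_n$, $\mathrm{asc}$ and $\mathrm{des}$ are the numbers of ascents and descents; $\mathrm{lmax}$ and $\mathrm{lmin}$ are the numbers of left-to-right maxima and minima; $\mathrm{ldr}$ is the largest $i$ with $a_1>\dots>a_i$; $\mathrm{comp}$ is the number of components, a component being a nonempty factor $\tau$ with $\pi=\sigma\tau\rho$, $\sigma\prec\tau\prec\rho$, that is not a product $\alpha\beta$ of nonempty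 words with $\alpha\prec\beta$. All of them vanish on $\varepsilon$. **Corollary.** For every $n\ge 0$, $f$ restricts to a bijection from the $\beta(1,0)$-trees on $n+1$ nodes to the avoiders of length $n$, and $m$ and $h$ map the set of $\beta(1,0)$-trees on $n+1$ nodes to itself. Let $g$ be the map on avoiders that applies, in this order, $f^{-1}$, $m$, $h$, $m$ and $f$. On the avoiders of length $n$, $g$ is an involution that sends $$(\mathrm{asc},\mathrm{lmax},\mathrm{lmin},\mathrm{comp},\mathrm{ldr})\quad\text{to}\quad(\mathrm{des},\mathrm{lmin},\mathrm{lmax},\mathrm{ldr},\mathrm{comp}),$$ that is, for every avoider $\pi$ of length $n$: $g(g(\pi))=\pi$, $\mathrm{asc}(\pi)=\mathrm{des}(g(\pi))$, $\mathrm{lmax}(\pi)=\mathrm{lmin}(g(\pi))$, $\mathrm{lmin}(\pi)=\mathrm{lmax}(g(\pi))$, $\mathrm{comp}(\pi)=\mathrm{ldr}(g(\pi))$ and $\mathrm{ldr}(\pi)=\mathrm{comp}(g(\pi))$. -/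

import Mathlib

/-! ### Labeled rooted plane trees -/

/-- Finite rooted plane trees with natural-number labels: `node r cs` has root label `r` and
the subtrees `cs`, listed from left to right. -/
inductive PTree : Type
  | node : ℕ → List PTree → PTree

namespace PTree

/-- The one-node tree. As a root, its label is the (empty) sum of its children's labels, `0`. -/
def leaf : PTree := node 0 []

instance : Inhabited PTree := ⟨leaf⟩

/-- The label of the root. -/
def label : PTree → ℕ
  | node r _ => r

/-- The subtrees hanging from the root, from left to right. -/
def children : PTree → List PTree
  | node _ cs => cs

mutual
/-- The number of nodes. -/
def nodes : PTree → ℕ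
  | node _ cs => 1 + nodesL cs
/-- The total number of nodes of a list of trees. -/
def nodesL : List PTree → ℕ
  | [] => 0
  | c :: cs => nodes c + nodesL cs
end

mutual
/-- The labeling conditions at and below a node that is not the root: leaves have label `1`;
any other node has a positive label no greater than the sum of its children's labels. -/
def IsProper : PTree → Prop
  | node r cs =>
      (cs = [] → r = 1) ∧ (cs ≠ [] → 1 ≤ r ∧ r ≤ (cs.map label).sum) ∧ AllProper cs
/-- All trees of the list satisfy `IsProper`. -/
def AllProper : List PTree → Prop
  | [] => True
  | c :: cs => IsProper c ∧ AllProper cs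
end

/-- `β(1,0)`-trees: the label of the root is the sum of its children's labels, and all other
nodes satisfy the conditions above. -/
def IsBeta : PTree → Prop
  | node r cs => r = (cs.map label).sum ∧ AllProper cs

/-- The set of `β(1,0)`-trees on `N` nodes. -/
def betaTrees (N : ℕ) : Set PTree := {t | t.IsBeta ∧ t.nodes = N}

/-- The sum `u ⊕ v` of trees: identify the roots and add their labels. -/
def oplus (u v : PTree) : PTree := node (u.label + v.label) (u.children ++ v.children)

/-- `λ(i, t)`: join a new root to the old root, and assign the label `i` to both. -/
def lam (i : ℕ) (t : PTree) : PTree := node i [node i t.children]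

mutual
/-- The mirror image: recursively reverse the order of subtrees. -/
def mirror : PTree → PTree
  | node r cs => node r (mirrorL cs)
/-- The reversed list of the mirror images. -/
def mirrorL : List PTree → List PTree
  | [] => []
  | c :: cs => mirrorL cs ++ [mirror c]
end

mutual
/-- Replace the rightmost leaf of a tree by `v`, whose root gets the label `1`. -/
def graft (v : PTree) : PTree → PTree
  | node r cs => if cs.isEmpty then node 1 v.children else node r (graftL v cs)
/-- Perform `graft` in the last tree of a list. -/
def graftL (v : PTree) : List PTree → List PTree
  | [] => []
  | c :: cs => if cs.isEmpty then [graft v c] else c :: graftL v cs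
end

/-- The sum `u ⦸ v`: the rightmost leaf of `u` is identified with the root of `v`, and that
node gets the label `1`. By convention the one-node tree is neutral on the left. -/
def obslash (u v : PTree) : PTree := if u.children.isEmpty then v else graft v u

mutual
/-- `γ(i, t)`: join a new leaf, as the rightmost leaf, to the `i`th node of the right path of
`t` (the root being the first), and add `1` to the labels of all nodes of the new right path,
other than the new leaf, which has label `1`. For `t` with at least one edge it is used with
`1 ≤ i ≤ k`, where `k` is the number of edges of the right path; also `γ(1, leaf)` is the tree
with one edge. -/
def gam (i : ℕ) : PTree → PTree
  | node r cs => node (r + 1) (gamL i cs)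
/-- The list of subtrees of `γ(i, t)`, from that of `t`. -/
def gamL (i : ℕ) : List PTree → List PTree
  | [] => [node 1 []]
  | c :: cs =>
      if cs.isEmpty then (if i ≤ 1 then [c, node 1 []] else [gam (i - 1) c])
      else c :: gamL i cs
end

mutual
/-- The map `h` on trees, given by `h leaf = leaf`, `h (λ(i, t)) = γ(i, h t)` and
`h (u ⊕ v) = h v ⦸ h u`; it does not depend on the label of the root. -/
def h : PTree → PTree
  | node _ cs => hL cs
/-- `h` of a tree with the given list of subtrees. A subtree `c` with label `i` stands for the
summand `λ(i, c)`. -/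
def hL : List PTree → PTree
  | [] => leaf
  | c :: cs => obslash (hL cs) (gam c.label (h c))
end

end PTree

/-! ### Permutations as words -/

namespace Avoider

/-- `α ≺ β`: all letters of `α` are smaller than all letters of `β`. -/
def Prec (α β : List ℕ) : Prop := ∀ a ∈ α, ∀ b ∈ β, a < b

instance (α β : List ℕ) : Decidable (Prec α β) := by unfold Prec; infer_instance

/-- `π` is (the one-line notation of) a permutation of `{1, …, n}`. -/
def IsPermWord (n : ℕ) (π : List ℕ) : Prop := π.Perm (List.range' 1 n)

/-- `π` contains the pattern 3-1-4-2. -/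
def Contains3142 (π : List ℕ) : Prop :=
  ∃ a b c d : ℕ, a < b ∧ b < c ∧ c < d ∧ [c, a, d, b].Sublist π

/-- `π` contains the dashed pattern 2-41-3: the letters playing the roles of `4` and `1` are
adjacent in `π`. -/
def Contains2413 (π : List ℕ) : Prop :=
  ∃ a b c d : ℕ, a < b ∧ b < c ∧ c < d ∧
    ∃ α β : List ℕ, π = α ++ d :: a :: β ∧ b ∈ α ∧ c ∈ β

/-- The avoiders of length `n`: permutations of `{1, …, n}` that avoid 3-1-4-2 and 2-41-3. -/
def avoiders (n : ℕ) : Set (List ℕ) :=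
  {π | IsPermWord n π ∧ ¬ Contains3142 π ∧ ¬ Contains2413 π}

/-- The number of ascents. -/
def asc (π : List ℕ) : ℕ :=
  ((Finset.range (π.length - 1)).filter (fun i => π.getD i 0 < π.getD (i + 1) 0)).card

/-- The number of descents. -/
def des (π : List ℕ) : ℕ :=
  ((Finset.range (π.length - 1)).filter (fun i => π.getD (i + 1) 0 < π.getD i 0)).card

/-- The number of left-to-right maxima. -/
def lmax (π : List ℕ) : ℕ :=
  ((Finset.range π.length).filter (fun i => ∀ j < i, π.getD j 0 < π.getD i 0)).card

/-- The number of left-to-right minima. -/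
def lmin (π : List ℕ) : ℕ :=
  ((Finset.range π.length).filter (fun i => ∀ j < i, π.getD i 0 < π.getD j 0)).card

/-- The length of the leftmost decreasing run. -/
def ldr (π : List ℕ) : ℕ :=
  Nat.findGreatest (fun i => (π.take i).Pairwise (fun a b => b < a)) π.length

/-- `τ` is a component of `π`. -/
def IsComponent (π τ : List ℕ) : Prop :=
  τ ≠ [] ∧ (∃ σ ρ : List ℕ, π = σ ++ τ ++ ρ ∧ Prec σ τ ∧ Prec τ ρ) ∧
    ∀ α β : List ℕ, τ = α ++ β → Prec α β → α = [] ∨ β = []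

/-- The number of components. -/
noncomputable def comp (π : List ℕ) : ℕ := {τ | IsComponent π τ}.ncard

/-- The sum `σ ⊕ τ` of permutations. -/
def oplus (σ τ : List ℕ) : List ℕ := σ ++ τ.map (· + σ.length)

/-- Standardization of a word with distinct letters. -/
def st (w : List ℕ) : List ℕ := w.map (fun x => w.countP (· ≤ x))

/-- Inverse standardization: replace `i` by the `i`th smallest element of `V`. -/
def unst (V : Finset ℕ) (w : List ℕ) : List ℕ :=
  w.map (fun i => (V.sort (· ≤ ·)).getD (i - 1) 0)

/-- The maximal intervals of `σ`, as factors of `σ` from left to right: two adjacent letters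
belong to the same one if all values between them are letters of `σ`. (If `σ` is the part of an
avoider to the left of its largest letter, these factors are intervals and increase in the order
`≺`.) -/
def intervals (σ : List ℕ) : List (List ℕ) :=
  σ.splitBy (fun a b => decide (∀ v ∈ Finset.Icc (min a b) (max a b), v ∈ σ))

/-- For `w = u 0̂ v` with `0̂ = min w`, the number of letters `x` of `v` with `x ≺ u`. -/
def mStat (w : List ℕ) : ℕ :=
  ((w.dropWhile (· ≠ w.min?.getD 0)).tail.filter
    (fun x => Prec [x] (w.takeWhile (· ≠ w.min?.getD 0)))).length

/-- For the list `σ₁, …, σₖ`, the letters of the sets `L₁, …, Lₖ`, where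
`Lᵢ = {x + mᵢ + 1 : x ∈ σᵢ}`, `mᵢ` is computed from the word `wᵢ` of those letters `x` of `τ`
with `σᵢ ≺ x ≺ σᵢ₊₁`, and `σₖ₊₁` is empty. -/
def leftLetters (τ : List ℕ) : List (List ℕ) → List ℕ
  | [] => []
  | s :: rest =>
      s.map (fun x => x +
          mStat (τ.filter (fun y => Prec s [y] ∧ Prec [y] (rest.headD []))) + 1) ++
        leftLetters τ rest

/-- `ψ(σ n τ)`, where `n` is larger than all letters of `σ` and `τ`. -/
def psiParts (n : ℕ) (σ τ : List ℕ) : List ℕ :=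
  let L : Finset ℕ := (leftLetters τ (intervals σ)).toFinset
  unst L (st σ) ++ n :: unst (Finset.Icc 1 (n - 1) \ L) (st τ)

/-- The map `ψ`, for a permutation `π` of `{1, …, n}`. -/
def psi (π : List ℕ) : List ℕ :=
  psiParts π.length (π.takeWhile (· ≠ π.length)) (π.dropWhile (· ≠ π.length)).tail

/-- Insert `N` immediately to the left of the `i`th left-to-right maximum exceeding `M`
(at the end if there is none). -/
def insertBefore (N : ℕ) : ℕ → ℕ → List ℕ → List ℕ
  | _, _, [] => [N]
  | i, M, a :: w =>
      if M < a then
        (if i ≤ 1 then N :: a :: w else a :: insertBefore N (i - 1) a w)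
      else a :: insertBefore N i M w

/-- `π̂`: insert `n = |π| + 1` immediately to the left of the `i`th left-to-right maximum. -/
def hat (i : ℕ) (π : List ℕ) : List ℕ := insertBefore (π.length + 1) i 0 π

/-- The map `φ(i, π)`, used with `1 ≤ i ≤ lmax π`; moreover `φ(1, ε) = 1`. -/
def phi (i : ℕ) (π : List ℕ) : List ℕ := if i ≤ 1 then hat i π else psi (hat i π)

mutual
/-- The map `f` from trees to permutations, given by `f leaf = ε`,
`f (λ(i, t)) = φ(i, f t)` and `f (u ⊕ v) = f u ⊕ f v`; it does not depend on the label of the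
root. -/
def f : PTree → List ℕ
  | .node _ cs => fL cs
/-- `f` of a tree with the given list of subtrees. A subtree `c` with label `i` stands for the
summand `λ(i, c)`. -/
def fL : List PTree → List ℕ
  | [] => []
  | c :: cs => oplus (phi c.label (f c)) (fL cs)
end

/-- The inverse of `f`, from permutations to `β(1,0)`-trees. -/
noncomputable def fInv : List ℕ → PTree := Function.invFunOn f {t | t.IsBeta}

/-- Apply the inverse of `f`, then the mirror map, `h`, the mirror map, and `f`. -/
noncomputable def involution (π : List ℕ) : List ℕ := f (fInv π).mirror.h.mirror

end Avoider

/-! ### The recursive equations of the maps -/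

namespace PTree

theorem mirror_leaf : mirror leaf = leaf := rfl

theorem mirror_lam (i : ℕ) (t : PTree) : mirror (lam i t) = lam i (mirror t) := by
  cases t; simp [lam, mirror, mirrorL, children]

theorem mirrorL_append (a b : List PTree) : mirrorL (a ++ b) = mirrorL b ++ mirrorL a := by
  induction a with
  | nil => simp [mirrorL]
  | cons c cs ih => simp [mirrorL, ih]

theorem mirror_oplus (u v : PTree) : mirror (oplus u v) = oplus (mirror v) (mirror u) := by
  cases u; cases v; simp [oplus, mirror, mirrorL_append, children, label, Nat.add_comm]

theorem graftL_isEmpty (v : PTree) (cs : List PTree) :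
    (graftL v cs).isEmpty = cs.isEmpty := by
  cases cs with
  | nil => simp [graftL]
  | cons c cs => rw [graftL]; split <;> simp

mutual
theorem graft_graft (v w : PTree) (hv : v.children.isEmpty = false) :
    ∀ u : PTree, graft w (graft v u) = graft (graft w v) u
  | node r cs => by
      cases hcs : cs.isEmpty
      · have ih := graftL_graftL v w hv cs
        simp [graft, hcs, graftL_isEmpty, ih]
      · cases v with
        | node s ds =>
          simp only [children] at hv
          simp [graft, hcs, hv, children]
theorem graftL_graftL (v w : PTree) (hv : v.children.isEmpty = false) :
    ∀ cs : List PTree, graftL w (graftL v cs) = graftL (graft w v) cs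
  | [] => by simp [graftL]
  | c :: cs => by
      cases hcs : cs.isEmpty
      · have ih := graftL_graftL v w hv cs
        simp [graftL, hcs, graftL_isEmpty, ih]
      · have ih := graft_graft v w hv c
        simp [graftL, hcs, ih]
end

theorem children_graft_isEmpty (v u : PTree) (hu : u.children.isEmpty = false) :
    (graft v u).children.isEmpty = false := by
  cases u with
  | node r cs =>
    simp only [children] at hu
    simp [graft, hu, children, graftL_isEmpty]

theorem obslash_assoc (u v w : PTree) (hv : v.children.isEmpty = false) :
    obslash (obslash u v) w = obslash u (obslash v w) := by
  cases hu : u.children.isEmpty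
  · simp [obslash, hu, hv, children_graft_isEmpty v u hu, graft_graft v w hv u]
  · simp [obslash, hu]

theorem children_gam_isEmpty (i : ℕ) (t : PTree) : (gam i t).children.isEmpty = false := by
  cases t with
  | node r cs =>
    cases cs with
    | nil => simp [gam, gamL, children]
    | cons c cs =>
      simp only [gam, gamL, children]
      split <;> [split; skip] <;> simp

theorem h_leaf : h leaf = leaf := rfl

theorem hL_eq_leaf_or (cs : List PTree) (hcs : cs ≠ []) : (hL cs).children.isEmpty = false := by
  cases cs with
  | nil => exact absurd rfl hcs
  | cons c cs =>
    rw [hL, obslash]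
    split
    · exact children_gam_isEmpty _ _
    · rename_i hu
      exact children_graft_isEmpty _ _ (by simpa using hu)

theorem h_lam (i : ℕ) (t : PTree) : h (lam i t) = gam i (h t) := by
  cases t; simp [lam, h, hL, children, label, obslash, leaf]

theorem hL_append (a b : List PTree) (ha : a ≠ []) : hL (a ++ b) = obslash (hL b) (hL a) := by
  induction a with
  | nil => exact absurd rfl ha
  | cons c cs ih =>
    by_cases hcs : cs = []
    · subst hcs
      simp [hL, obslash, leaf, children]
    · rw [List.cons_append, hL, ih hcs, hL, obslash_assoc _ _ _ (hL_eq_leaf_or cs hcs)]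

theorem h_oplus (u v : PTree) (hu : u.children ≠ []) :
    h (oplus u v) = obslash (h v) (h u) := by
  cases u; cases v; exact hL_append _ _ hu

end PTree

namespace Avoider

theorem f_leaf : f PTree.leaf = [] := rfl

theorem f_lam (i : ℕ) (t : PTree) : f (PTree.lam i t) = phi i (f t) := by
  cases t; simp [PTree.lam, f, fL, PTree.children, PTree.label, oplus]

theorem oplus_assoc (a b c : List ℕ) : oplus (oplus a b) c = oplus a (oplus b c) := by
  simp [oplus, Function.comp_def]; intro x _; omega

theorem fL_append (a b : List PTree) : fL (a ++ b) = oplus (fL a) (fL b) := by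
  induction a with
  | nil => simp [fL, oplus]
  | cons c cs ih => rw [List.cons_append, fL, ih, fL, oplus_assoc]

theorem f_oplus (u v : PTree) : f (PTree.oplus u v) = oplus (f u) (f v) := by
  cases u; cases v; exact fL_append _ _

end Avoider

-- The root label of a β(1,0)-tree is redundant, so a tree is handled through the forest of subtrees
-- of its root, and the statistics are translated twice.
--
-- Across `f`: the root label is lmax, the number of subtrees of the root is comp, the length of the
-- left path is lmin, the number of labels 1 on it (root excluded) is ldr, the number of leaves is
-- asc + 1 (for a nonempty word), and the number of internal nodes other than the root is des
-- (`fL_properties`). Across `h`: the root label becomes the length of the right path, the number of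
-- subtrees of the root becomes the number of ones on the right path, and the internal nodes, root
-- included, become the leaves (`hL_properties`, `leavesL_internalsL_hL`). Besides turning λ into γ
-- and ⊕ into ⦸, `h` turns γ into λ and ⦸ into ⊕ (`hL_gamL`, `hL_graftL`), so it is an involution
-- (`h_hL`). The mirror map exchanges left and right paths and keeps the root label and the numbers
-- of subtrees, leaves and internal nodes. Hence des, lmax, comp of a word are asc, lmin, ldr of its
-- image under g; since g is an involution, the other three equalities follow by applying these to
-- the image.
--
-- The hard point is that `f` is bijective. An avoider splits uniquely into a first indecomposable
-- summand and an avoider, so it must be shown that the pairs (i, π) correspond under φ to the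
-- nonempty indecomposable avoiders (`phi_injective`, `phi_surjective`). A permutation σ n τ is
-- encoded by the patterns s, t of σ, τ and by the heights e(j), the number of letters of τ below
-- the j-th smallest letter of σ. It is an avoider exactly when s and t avoid the patterns, the
-- heights agree on every inversion of s, and each height lies in a set depending on t alone, the
-- predicate `Height` (`IsMergeData.avoids_iff`). Both 0 and |t| belong to this set. The map ψ
-- replaces each height by the next larger element of the set (`mStat_eq_nextHeight`, `psi_merge`).
-- For σ nonempty, inserting n before a left-to-right maximum means that all heights are less than
-- |t|, and indecomposability means that all are positive; the shift by one place is a bijection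
-- between these two situations. Since ψ keeps s and t, most statistics are read off from s and t;
-- only lmin needs the heights, and exactly one left-to-right minimum of t lies between consecutive
-- heights (`lmin_filter_nextHeight`).

namespace PTree

-- Forests: additivity, induction principles and properness.

/-- The sum of the labels of the roots of a forest. -/
def lsum (cs : List PTree) : ℕ := (cs.map label).sum

@[simp] theorem lsum_nil : lsum [] = 0 := rfl
@[simp] theorem lsum_cons (c : PTree) (cs : List PTree) : lsum (c :: cs) = c.label + lsum cs := by
  simp [lsum]
@[simp] theorem lsum_append (a b : List PTree) : lsum (a ++ b) = lsum a + lsum b := by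
  simp [lsum]
@[simp] theorem label_node (r : ℕ) (cs : List PTree) : label (node r cs) = r := rfl
@[simp] theorem children_node (r : ℕ) (cs : List PTree) : children (node r cs) = cs := rfl

theorem nodesL_append (a b : List PTree) : nodesL (a ++ b) = nodesL a + nodesL b := by
  induction a with
  | nil => simp [nodesL]
  | cons c cs ih => simp [nodesL, ih, Nat.add_assoc]

theorem nodes_node (r : ℕ) (cs : List PTree) : nodes (node r cs) = nodesL cs + 1 := by
  rw [nodes, Nat.add_comm]

/-- A nonempty forest consists of a root label and two forests with fewer nodes. Splitting off the
first tree matches the recursions of `hL` and `fL`. -/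
theorem forest_cons_induction {P : List PTree → Prop} (nil : P [])
    (cons : ∀ j ws cs, P ws → P cs → P (node j ws :: cs)) : ∀ cs, P cs := by
  have key : ∀ N cs, nodesL cs ≤ N → P cs := by
    intro N
    induction N with
    | zero =>
      rintro (_ | ⟨⟨j, ws⟩, cs⟩) hN
      · exact nil
      · simp [nodesL, nodes] at hN
    | succ N ih =>
      rintro (_ | ⟨⟨j, ws⟩, cs⟩) hN
      · exact nil
      · simp only [nodesL, nodes] at hN
        exact cons _ _ _ (ih _ (by omega)) (ih _ (by omega))
  exact fun cs => key _ cs le_rfl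

/-- The version for operations on the right path: `gamL` and `graftL` act inside the last tree. -/
theorem forest_snoc_induction {P : List PTree → Prop} (nil : P [])
    (snoc : ∀ us j ws, P us → P ws → P (us ++ [node j ws])) : ∀ cs, P cs := by
  have key : ∀ N cs, nodesL cs ≤ N → P cs := by
    intro N
    induction N with
    | zero =>
      rintro (_ | ⟨⟨j, ws⟩, cs⟩) hN
      · exact nil
      · simp [nodesL, nodes] at hN
    | succ N ih =>
      intro cs hN
      rcases List.eq_nil_or_concat' cs with rfl | ⟨us, ⟨j, ws⟩, rfl⟩
      · exact nil
      · simp only [nodesL_append, nodesL, nodes] at hN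
        exact snoc _ _ _ (ih _ (by omega)) (ih _ (by omega))
  exact fun cs => key _ cs le_rfl

theorem allProper_append (a b : List PTree) :
    AllProper (a ++ b) ↔ AllProper a ∧ AllProper b := by
  induction a with
  | nil => simp [AllProper]
  | cons c cs ih => simp [AllProper, ih, and_assoc]

theorem isProper_node (r : ℕ) (cs : List PTree) :
    IsProper (node r cs) ↔
      (cs = [] → r = 1) ∧ (cs ≠ [] → 1 ≤ r ∧ r ≤ lsum cs) ∧ AllProper cs := by
  rw [IsProper]; rfl

theorem isBeta_node (r : ℕ) (cs : List PTree) :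
    IsBeta (node r cs) ↔ r = lsum cs ∧ AllProper cs := Iff.rfl

theorem IsProper.one_le_label {r : ℕ} {cs : List PTree} (hc : IsProper (node r cs)) : 1 ≤ r := by
  rw [isProper_node] at hc
  by_cases hcs : cs = []
  · exact (hc.1 hcs).ge
  · exact (hc.2.1 hcs).1

theorem AllProper.one_le_lsum {cs : List PTree} (hcs : AllProper cs) (hne : cs ≠ []) :
    1 ≤ lsum cs := by
  rcases cs with _ | ⟨⟨j, ws⟩, cs⟩
  · exact absurd rfl hne
  · have := IsProper.one_le_label hcs.1
    simp; omega

/-! ### Leaves, internal nodes and boundary paths -/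

mutual
/-- The number of leaves, a single node being a leaf. -/
def leaves : PTree → ℕ
  | node _ cs => if cs.isEmpty then 1 else leavesL cs
/-- The total number of leaves of a forest. -/
def leavesL : List PTree → ℕ
  | [] => 0
  | c :: cs => leaves c + leavesL cs
end

mutual
/-- The number of nodes that are not leaves. -/
def internals : PTree → ℕ
  | node _ cs => if cs.isEmpty then 0 else internalsL cs + 1
/-- The total number of nodes of a forest that are not leaves. -/
def internalsL : List PTree → ℕ
  | [] => 0
  | c :: cs => internals c + internalsL cs
end

mutual
/-- The number of edges of the path from the root to the leftmost leaf. -/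
def lpath : PTree → ℕ
  | node _ cs => lpathL cs
/-- The number of edges of the left path of the tree with the given subtrees. -/
def lpathL : List PTree → ℕ
  | [] => 0
  | c :: _ => lpath c + 1
end

mutual
/-- The number of labels `1` on the left path, the root excluded. -/
def lones : PTree → ℕ
  | node _ cs => lonesL cs
/-- The number of labels `1` on the left path of the tree with the given subtrees, the root
excluded. -/
def lonesL : List PTree → ℕ
  | [] => 0
  | c :: _ => lones c + if c.label = 1 then 1 else 0
end

theorem leavesL_append (a b : List PTree) : leavesL (a ++ b) = leavesL a + leavesL b := by
  induction a with
  | nil => simp [leavesL]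
  | cons c cs ih => simp [leavesL, ih, Nat.add_assoc]

theorem internalsL_append (a b : List PTree) :
    internalsL (a ++ b) = internalsL a + internalsL b := by
  induction a with
  | nil => simp [internalsL]
  | cons c cs ih => simp [internalsL, ih, Nat.add_assoc]

theorem mirrorL_snoc (us : List PTree) (c : PTree) :
    mirrorL (us ++ [c]) = mirror c :: mirrorL us := by
  simp [mirrorL_append, mirrorL]

/-- The number of edges of the right path of the tree with the given subtrees. -/
def rpathL (cs : List PTree) : ℕ := lpathL (mirrorL cs)

/-- The number of labels `1` on the right path of the tree with the given subtrees, the root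
excluded. -/
def ronesL (cs : List PTree) : ℕ := lonesL (mirrorL cs)

@[simp] theorem rpathL_nil : rpathL [] = 0 := by simp [rpathL, mirrorL, lpathL]
@[simp] theorem ronesL_nil : ronesL [] = 0 := by simp [ronesL, mirrorL, lonesL]
@[simp] theorem rpathL_snoc (us : List PTree) (j : ℕ) (ws : List PTree) :
    rpathL (us ++ [node j ws]) = rpathL ws + 1 := by
  simp [rpathL, mirrorL_snoc, lpathL, mirror, lpath]
@[simp] theorem ronesL_snoc (us : List PTree) (j : ℕ) (ws : List PTree) :
    ronesL (us ++ [node j ws]) = ronesL ws + if j = 1 then 1 else 0 := by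
  by_cases hj : j = 1 <;> simp [ronesL, mirrorL_snoc, lonesL, mirror, lones, hj]

/-! ### The mirror map -/

theorem mirrorL_mirrorL (cs : List PTree) : mirrorL (mirrorL cs) = cs := by
  induction cs using forest_cons_induction with
  | nil => simp [mirrorL]
  | cons j ws cs ih1 ih2 => simp [mirrorL, mirrorL_snoc, mirror, ih1, ih2]

theorem mirror_mirror (t : PTree) : mirror (mirror t) = t := by
  cases t; simp [mirror, mirrorL_mirrorL]

theorem mirrorL_eq_nil {cs : List PTree} : mirrorL cs = [] ↔ cs = [] := by
  cases cs <;> simp [mirrorL]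

theorem lsum_mirrorL (cs : List PTree) : lsum (mirrorL cs) = lsum cs := by
  induction cs with
  | nil => simp [mirrorL]
  | cons c cs ih => cases c; simp [mirrorL, ih, mirror, Nat.add_comm]

theorem length_mirrorL (cs : List PTree) : (mirrorL cs).length = cs.length := by
  induction cs with
  | nil => simp [mirrorL]
  | cons c cs ih => simp [mirrorL, ih]

theorem nodesL_mirrorL (cs : List PTree) : nodesL (mirrorL cs) = nodesL cs := by
  induction cs using forest_cons_induction with
  | nil => simp [mirrorL]
  | cons j ws cs ih1 ih2 =>
    simp only [mirrorL, nodesL_append, mirror, nodesL, nodes, ih1, ih2]; omega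

theorem leavesL_mirrorL (cs : List PTree) : leavesL (mirrorL cs) = leavesL cs := by
  induction cs using forest_cons_induction with
  | nil => simp [mirrorL]
  | cons j ws cs ih1 ih2 =>
    simp only [mirrorL, leavesL_append, mirror, leavesL, leaves, ih1, ih2, List.isEmpty_iff,
      mirrorL_eq_nil]
    omega

theorem internalsL_mirrorL (cs : List PTree) : internalsL (mirrorL cs) = internalsL cs := by
  induction cs using forest_cons_induction with
  | nil => simp [mirrorL]
  | cons j ws cs ih1 ih2 =>
    simp only [mirrorL, internalsL_append, mirror, internalsL, internals, ih1, ih2,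
      List.isEmpty_iff, mirrorL_eq_nil]
    omega

theorem allProper_mirrorL (cs : List PTree) : AllProper (mirrorL cs) ↔ AllProper cs := by
  induction cs using forest_cons_induction with
  | nil => simp [mirrorL]
  | cons j ws cs ih1 ih2 =>
    simp only [mirrorL, allProper_append, mirror, AllProper, isProper_node, mirrorL_eq_nil,
      lsum_mirrorL, ih1, ih2, ne_eq]
    tauto

theorem isBeta_mirror {t : PTree} (ht : t.IsBeta) : t.mirror.IsBeta := by
  cases t
  rw [mirror, isBeta_node, lsum_mirrorL, allProper_mirrorL]
  exact ht

theorem nodes_mirror (t : PTree) : t.mirror.nodes = t.nodes := by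
  cases t; simp [mirror, nodes, nodesL_mirrorL]

/-! ### The operations on forests -/

theorem gamL_snoc_of_le_one {i : ℕ} (hi : i ≤ 1) (cs : List PTree) :
    gamL i cs = cs ++ [node 1 []] := by
  induction cs with
  | nil => simp [gamL]
  | cons c cs ih =>
    rw [gamL]
    cases cs with
    | nil => simp [hi]
    | cons d cs => simp [ih]

theorem gamL_snoc {i : ℕ} (hi : 2 ≤ i) (us : List PTree) (j : ℕ) (ws : List PTree) :
    gamL i (us ++ [node j ws]) = us ++ [node (j + 1) (gamL (i - 1) ws)] := by
  induction us with
  | nil => simp [gamL, show ¬ i ≤ 1 by omega, gam]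
  | cons c cs ih =>
    rw [List.cons_append, gamL]
    simp [ih]

theorem gamL_ne_nil (i : ℕ) (cs : List PTree) : gamL i cs ≠ [] := by
  cases cs with
  | nil => simp [gamL]
  | cons c cs => rw [gamL]; split_ifs <;> simp

theorem gamL_append (i : ℕ) (a : List PTree) {b : List PTree} (hb : b ≠ []) :
    gamL i (a ++ b) = a ++ gamL i b := by
  induction a with
  | nil => rfl
  | cons c cs ih => simp [gamL, ih, hb]

theorem graftL_snoc (v : PTree) (us : List PTree) (c : PTree) :
    graftL v (us ++ [c]) = us ++ [graft v c] := by
  induction us with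
  | nil => simp [graftL]
  | cons c cs ih => rw [List.cons_append, graftL]; simp [ih]

theorem graftL_append (v : PTree) (a : List PTree) {b : List PTree} (hb : b ≠ []) :
    graftL v (a ++ b) = a ++ graftL v b := by
  induction a with
  | nil => rfl
  | cons c cs ih => simp [graftL, ih, hb]

theorem graftL_eq_nil {v : PTree} {cs : List PTree} : graftL v cs = [] ↔ cs = [] := by
  rw [← List.isEmpty_iff, graftL_isEmpty, List.isEmpty_iff]

/-- `γ(i, ·)` is meant to be applied to the tree with the subtrees `cs`. -/
def GamValid (i : ℕ) (cs : List PTree) : Prop := i = 1 ∨ 2 ≤ i ∧ i ≤ rpathL cs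

theorem GamValid.pred {i j : ℕ} {us ws : List PTree} (hi : GamValid i (us ++ [node j ws]))
    (h2 : 2 ≤ i) : GamValid (i - 1) ws := by
  rcases hi with hi | ⟨-, hi⟩
  · omega
  · rw [rpathL_snoc] at hi
    by_cases h3 : i = 2
    · left; omega
    · right; omega

theorem lsum_gamL (i : ℕ) (cs : List PTree) : lsum (gamL i cs) = lsum cs + 1 := by
  by_cases hi : i ≤ 1
  · simp [gamL_snoc_of_le_one hi]
  · rcases List.eq_nil_or_concat' cs with rfl | ⟨us, ⟨j, ws⟩, rfl⟩
    · simp [gamL]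
    · rw [gamL_snoc (by omega)]; simp; omega

theorem nodesL_gamL (i : ℕ) (cs : List PTree) : nodesL (gamL i cs) = nodesL cs + 1 := by
  induction cs using forest_snoc_induction generalizing i with
  | nil => simp [gamL, nodesL, nodes]
  | snoc us j ws _ ih =>
    by_cases hi : i ≤ 1
    · rw [gamL_snoc_of_le_one hi, nodesL_append]; simp [nodesL, nodes]
    · rw [gamL_snoc (by omega)]; simp [nodesL_append, nodesL, nodes, ih]; omega

theorem allProper_gamL {i : ℕ} {cs : List PTree} (hcs : AllProper cs) (hi : GamValid i cs) :
    AllProper (gamL i cs) := by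
  induction cs using forest_snoc_induction generalizing i with
  | nil => simp [gamL, AllProper, isProper_node]
  | snoc us j ws _ ih =>
    by_cases h1 : i ≤ 1
    · simp [gamL_snoc_of_le_one h1, allProper_append, AllProper, isProper_node] at hcs ⊢
      exact hcs
    · have h2 : 2 ≤ i := by omega
      rw [gamL_snoc h2]
      rw [allProper_append] at hcs ⊢
      refine ⟨hcs.1, ?_, trivial⟩
      have hc := hcs.2.1
      rw [isProper_node] at hc ⊢
      refine ⟨fun hh => absurd hh (gamL_ne_nil _ _), fun _ => ?_, ih hc.2.2 (hi.pred h2)⟩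
      rw [lsum_gamL]
      -- With i ≥ 2 the right path has at least two edges, so its second node is not a leaf and its
      -- label may grow along with the labels below it.
      have hne : ws ≠ [] := by
        rintro rfl
        rcases hi with hi | hi
        · omega
        · simp at hi; omega
      have := hc.2.1 hne
      omega

/-- The new right path consists of the first i nodes of the old one, followed by the new leaf. -/
theorem rpathL_gamL {i : ℕ} {cs : List PTree} (hi : GamValid i cs) :
    rpathL (gamL i cs) = i := by
  induction cs using forest_snoc_induction generalizing i with
  | nil =>
    rcases hi with rfl | hi
    · rw [gamL_snoc_of_le_one le_rfl, rpathL_snoc]; simp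
    · simp at hi; omega
  | snoc us j ws _ ih =>
    by_cases h1 : i ≤ 1
    · rw [gamL_snoc_of_le_one h1]
      have : i = 1 := by rcases hi with hi | hi <;> omega
      simp only [rpathL_snoc, rpathL_nil, this]
    · rw [gamL_snoc (by omega), rpathL_snoc, ih (hi.pred (by omega))]; omega

/-- The old labels on the path are positive and are raised to at least 2, so the new leaf carries
the only 1. -/
theorem ronesL_gamL {i : ℕ} {cs : List PTree} (hcs : AllProper cs) (hi : GamValid i cs) :
    ronesL (gamL i cs) = 1 := by
  induction cs using forest_snoc_induction generalizing i with
  | nil =>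
    rw [gamL, ← List.nil_append [node 1 []], ronesL_snoc]; simp
  | snoc us j ws _ ih =>
    by_cases h1 : i ≤ 1
    · rw [gamL_snoc_of_le_one h1, ronesL_snoc]; simp
    · rw [allProper_append] at hcs
      have hj := IsProper.one_le_label hcs.2.1
      have hc := hcs.2.1
      rw [isProper_node] at hc
      rw [gamL_snoc (by omega), ronesL_snoc, ih hc.2.2 (hi.pred (by omega))]
      simp; omega

theorem leavesL_gamL {i : ℕ} {cs : List PTree} (hi : GamValid i cs) :
    leavesL (gamL i cs) = leavesL cs + 1 := by
  induction cs using forest_snoc_induction generalizing i with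
  | nil => simp [gamL, leavesL, leaves]
  | snoc us j ws _ ih =>
    by_cases h1 : i ≤ 1
    · rw [gamL_snoc_of_le_one h1, leavesL_append]; simp [leavesL, leaves]
    · have hne : ws ≠ [] := by
        rintro rfl
        rcases hi with hi | hi
        · omega
        · simp at hi; omega
      rw [gamL_snoc (by omega), leavesL_append, leavesL_append]
      simp [leavesL, leaves, hne, gamL_ne_nil, ih (hi.pred (by omega))]
      omega

/-- The only label reassigned is that of the rightmost leaf, which is 1 in a proper forest and stays
1. For the same reason the ones on right paths simply add up in `ronesL_graftL`. -/
theorem lsum_graftL {v : PTree} {us : List PTree} (hus : AllProper us) :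
    lsum (graftL v us) = lsum us := by
  rcases List.eq_nil_or_concat' us with rfl | ⟨us, ⟨j, ws⟩, rfl⟩
  · simp [graftL]
  · rw [allProper_append] at hus
    have := hus.2.1
    rw [isProper_node] at this
    rw [graftL_snoc, graft]
    by_cases hws : ws = []
    · simp [hws, this.1 hws]
    · simp [hws]

theorem nodesL_graftL {v : PTree} {us : List PTree} (hus : us ≠ []) :
    nodesL (graftL v us) = nodesL us + nodesL v.children := by
  induction us using forest_snoc_induction with
  | nil => exact absurd rfl hus
  | snoc us j ws _ ih =>
    rw [graftL_snoc, graft]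
    by_cases hws : ws = []
    · simp [hws, nodesL_append, nodesL, nodes]; omega
    · simp [hws, nodesL_append, nodesL, nodes, ih hws]; omega

theorem allProper_graftL {v : PTree} {us : List PTree} (hus : AllProper us)
    (hv : AllProper v.children) (hne : v.children ≠ []) : AllProper (graftL v us) := by
  induction us using forest_snoc_induction with
  | nil => simpa [graftL]
  | snoc us j ws _ ih =>
    rw [allProper_append] at hus
    rw [graftL_snoc, graft, allProper_append]
    have hc := hus.2.1
    rw [isProper_node] at hc
    refine ⟨hus.1, ?_, trivial⟩
    by_cases hws : ws = []
    · simp [hws, isProper_node, hne, hv, hv.one_le_lsum hne]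
    · simp only [List.isEmpty_iff, hws, if_false, isProper_node, ne_eq, graftL_eq_nil,
        lsum_graftL hc.2.2, ih hc.2.2]
      exact ⟨False.elim, fun _ => hc.2.1 hws, trivial⟩

theorem rpathL_graftL {v : PTree} {us : List PTree} (hus : us ≠ []) :
    rpathL (graftL v us) = rpathL us + rpathL v.children := by
  induction us using forest_snoc_induction with
  | nil => exact absurd rfl hus
  | snoc us j ws _ ih =>
    rw [graftL_snoc, graft]
    by_cases hws : ws = []
    · simp [hws]; omega
    · simp [hws, ih hws]; omega

theorem ronesL_graftL {v : PTree} {us : List PTree} (hus : us ≠ []) (hp : AllProper us) :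
    ronesL (graftL v us) = ronesL us + ronesL v.children := by
  induction us using forest_snoc_induction with
  | nil => exact absurd rfl hus
  | snoc us j ws _ ih =>
    rw [allProper_append] at hp
    have hc := hp.2.1
    rw [isProper_node] at hc
    rw [graftL_snoc, graft]
    by_cases hws : ws = []
    · simp [hws, hc.1 hws]; omega
    · simp [hws, ih hws hc.2.2]; omega

/-- One leaf is lost: the one that becomes the root of the grafted tree. -/
theorem leavesL_graftL {v : PTree} {us : List PTree} (hus : us ≠ []) (hne : v.children ≠ []) :
    leavesL (graftL v us) + 1 = leavesL us + leavesL v.children := by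
  induction us using forest_snoc_induction with
  | nil => exact absurd rfl hus
  | snoc us j ws _ ih =>
    rw [graftL_snoc, graft]
    by_cases hws : ws = []
    · simp [hws, leavesL_append, leavesL, leaves, hne]; omega
    · have := ih hws
      simp [hws, leavesL_append, leavesL, leaves, graftL_eq_nil]; omega

/-! ### The map `h` -/

theorem hL_singleton (c : PTree) : hL [c] = gam c.label (h c) := by
  simp [hL, obslash, leaf]

theorem children_hL_ne_nil {cs : List PTree} (hcs : cs ≠ []) : (hL cs).children ≠ [] := by
  simpa using hL_eq_leaf_or cs hcs

theorem hL_cons {c : PTree} {cs : List PTree} (hcs : cs ≠ []) :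
    hL (c :: cs) = node (hL cs).label (graftL (gam c.label (h c)) (hL cs).children) := by
  have hne := children_hL_ne_nil hcs
  rw [hL, obslash]
  cases hh : hL cs with
  | node r us =>
    rw [hh] at hne
    simp only [children_node] at hne
    simp [graft, hne]

theorem children_gam (i : ℕ) (t : PTree) : (gam i t).children = gamL i t.children := by
  cases t; simp [gam]

theorem gam_node (i r : ℕ) (cs : List PTree) : gam i (node r cs) = node (r + 1) (gamL i cs) := by
  simp [gam]

theorem h_node (r : ℕ) (cs : List PTree) : h (node r cs) = hL cs := by simp [h]

/-- The bound on the label of a node is precisely the domain of γ on the image of its subtrees,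
because `h` turns the sum of their labels into the length of the right path. -/
theorem gamValid_of_isProper {j : ℕ} {ws : List PTree} (hc : IsProper (node j ws))
    {us : List PTree} (hus : rpathL us = lsum ws) : GamValid j us := by
  have h1 := hc.one_le_label
  rw [isProper_node] at hc
  by_cases hws : ws = []
  · exact Or.inl (hc.1 hws)
  · have := hc.2.1 hws
    by_cases hj : j = 1
    · exact Or.inl hj
    · right; omega

/-- One joint induction is needed: applying γ at the first tree is legitimate only by the induction
hypothesis on right paths. Each γ creates a right path with as many edges as its index and with a
single label 1, and ⦸ concatenates right paths. -/
theorem hL_properties {cs : List PTree} (hcs : AllProper cs) :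
    (hL cs).IsBeta ∧ rpathL (hL cs).children = lsum cs ∧
      ronesL (hL cs).children = cs.length ∧ nodesL (hL cs).children = nodesL cs := by
  induction cs using forest_cons_induction with
  | nil => simp [hL, leaf, IsBeta, AllProper, nodesL]
  | cons j ws cs ih1 ih2 =>
    have hc := hcs.1
    have hg := hc
    rw [isProper_node] at hc
    obtain ⟨hb, hr, ho, hn⟩ := ih1 hc.2.2
    have hv := gamValid_of_isProper hg hr
    cases hh : hL ws with
    | node r us =>
    rw [hh] at hb hr ho hn hv
    simp only [children_node] at hr ho hn hv
    rw [isBeta_node] at hb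
    by_cases he : cs = []
    · subst he
      rw [hL_singleton, h_node, hh, gam_node, isBeta_node]
      simp [lsum_gamL, hb.1, allProper_gamL hb.2 hv, rpathL_gamL hv, ronesL_gamL hb.2 hv,
        nodesL_gamL, nodesL, nodes, hn]; omega
    · obtain ⟨hb', hr', ho', hn'⟩ := ih2 hcs.2
      have hne := children_hL_ne_nil he
      rw [hL_cons he, h_node, hh, gam_node]
      cases hh' : hL cs with
      | node r' us' =>
      rw [hh'] at hb' hr' ho' hn' hne
      simp only [children_node] at hr' ho' hn' hne
      rw [isBeta_node] at hb'
      simp only [isBeta_node, label_node, children_node, lsum_graftL hb'.2, hb'.1]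
      have hp := allProper_gamL hb.2 hv
      refine ⟨⟨trivial, allProper_graftL hb'.2 hp (gamL_ne_nil _ _)⟩, ?_, ?_, ?_⟩
      · simp [rpathL_graftL hne, rpathL_gamL hv, hr']; omega
      · simp [ronesL_graftL hne hb'.2, ronesL_gamL hb.2 hv, ho']
      · simp [nodesL_graftL hne, nodesL_gamL, hn', hn, nodesL, nodes]; omega

theorem leavesL_internalsL_hL {cs : List PTree} (hcs : AllProper cs) (hne : cs ≠ []) :
    leavesL (hL cs).children = internalsL cs + 1 := by
  induction cs using forest_cons_induction with
  | nil => exact absurd rfl hne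
  | cons j ws cs ih1 ih2 =>
    have hc := hcs.1
    have hg := hc
    rw [isProper_node] at hc
    have hv := gamValid_of_isProper hg (hL_properties hc.2.2).2.1
    -- The case of a leaf also fits: `leavesL []` is 0, so the single leaf of γ(1, •) matches no
    -- internal node plus one.
    have hw : leavesL (gamL j (hL ws).children) = internals (node j ws) + 1 := by
      rw [leavesL_gamL hv]
      by_cases hws : ws = []
      · simp [hws, hL, leaf, leavesL, internals]
      · simp [ih1 hc.2.2 hws, internals, hws]
    by_cases he : cs = []
    · subst he
      rw [hL_singleton, children_gam, h_node, label_node, hw]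
      simp [internalsL]
    · have hg2 := leavesL_graftL (v := gam j (hL ws)) (children_hL_ne_nil he)
        (by rw [children_gam]; exact gamL_ne_nil _ _)
      rw [children_gam, hw, ih2 hcs.2 he] at hg2
      rw [hL_cons he, children_node, h_node, label_node, internalsL]
      omega

/-! ### The map `h` is an involution -/

theorem oplus_node (a b : ℕ) (us vs : List PTree) :
    oplus (node a us) (node b vs) = node (a + b) (us ++ vs) := rfl

theorem gam_one (t : PTree) : gam 1 t = oplus t (gam 1 leaf) := by
  cases t
  simp [gam, gamL_snoc_of_le_one, oplus, leaf]

theorem gam_oplus (i : ℕ) (a : PTree) {b : PTree} (hb : b.children ≠ []) :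
    gam i (oplus a b) = oplus a (gam i b) := by
  cases a; cases b
  simp only [children_node] at hb
  simp [gam, oplus, gamL_append _ _ hb, Nat.add_assoc]

theorem obslash_oplus (a c : PTree) {b : PTree} (hb : b.children ≠ []) :
    obslash (oplus a b) c = oplus a (obslash b c) := by
  cases a; cases b
  simp only [children_node] at hb
  simp [obslash, oplus, graft, graftL_append _ _ hb, hb]

theorem obslash_lam (i : ℕ) {t c : PTree} (ht : t.children ≠ []) :
    obslash (lam i t) c = lam i (obslash t c) := by
  cases t
  simp only [children_node] at ht
  simp [obslash, lam, graft, graftL, ht]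

theorem gam_leaf (i : ℕ) : gam i leaf = lam 1 leaf := by
  simp [gam, gamL, leaf, lam]

theorem obslash_lam_leaf (c : PTree) : obslash (lam 1 leaf) c = lam 1 c := by
  simp [obslash, lam, graft, graftL, leaf]

theorem hL_snoc (us : List PTree) (c : PTree) :
    hL (us ++ [c]) = if us = [] then gam c.label (h c)
      else obslash (gam c.label (h c)) (hL us) := by
  split_ifs with hu
  · rw [hu, List.nil_append, hL_singleton]
  · rw [hL_append _ _ hu, hL_singleton]

theorem children_gam_ne_nil (i : ℕ) (t : PTree) : (gam i t).children ≠ [] := by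
  rw [children_gam]; exact gamL_ne_nil _ _

/-- For i = 1, γ adds the summand λ(1, •) on the right, which `h` turns into grafting below a single
edge, that is, into λ(1, ·). For i ≥ 2, γ acts inside the last summand, and the index is lowered by
one while descending. -/
theorem hL_gamL {i : ℕ} {cs : List PTree} (hcs : AllProper cs) (hi : GamValid i cs) :
    hL (gamL i cs) = lam i (hL cs) := by
  induction cs using forest_snoc_induction generalizing i with
  | nil =>
    rcases hi with rfl | hi
    · rw [gamL, hL_singleton, label_node, h_node, hL, gam_leaf]
    · simp at hi; omega
  | snoc us j ws _ ih =>
    by_cases h1 : i ≤ 1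
    · have : i = 1 := by rcases hi with hi | hi <;> omega
      subst this
      rw [gamL_snoc_of_le_one h1, hL_snoc, if_neg (by simp), label_node, h_node, hL, gam_leaf,
        obslash_lam_leaf]
    · have h2 : 2 ≤ i := by omega
      rw [allProper_append] at hcs
      have hc := hcs.2.1
      have hj := hc.one_le_label
      rw [isProper_node] at hc
      -- γ(j+1, λ(i−1, w)) = λ(i, γ(j, w)): the edge added by λ puts one more node on top of the
      -- right path, so the place of the new leaf has index j + 1, and γ raises both labels i − 1 to
      -- i.
      have key : gam (j + 1) (hL (gamL (i - 1) ws)) = lam i (gam j (hL ws)) := by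
        rw [ih hc.2.2 (hi.pred h2)]
        cases hL ws with
        | node r us =>
        rw [lam, gam_node, ← List.nil_append [node (i - 1) _], gamL_snoc (by omega), lam, gam_node]
        simp
        omega
      rw [gamL_snoc h2, hL_snoc, hL_snoc]
      simp only [label_node, h_node, key]
      split_ifs
      · rfl
      · rw [obslash_lam _ (children_gam_ne_nil _ _)]

/-- Descending the right path, the summand `h v` is created at the rightmost leaf, where γ(1, `h v`)
= `h v` ⊕ γ(1, •). It is then carried up as a left summand, which neither γ nor ⦸ touches since both
act at the right end. -/
theorem hL_graftL {v : PTree} (hv : v.children ≠ []) {us : List PTree} (hus : us ≠ [])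
    (hp : AllProper us) : hL (graftL v us) = oplus (h v) (hL us) := by
  induction us using forest_snoc_induction with
  | nil => exact absurd rfl hus
  | snoc us j ws _ ih =>
    rw [allProper_append] at hp
    have hc := hp.2.1
    rw [isProper_node] at hc
    have key : gam (graft v (node j ws)).label (h (graft v (node j ws))) =
        oplus (h v) (gam j (hL ws)) := by
      by_cases hws : ws = []
      · subst hws
        cases v
        simp only [graft, List.isEmpty_nil, if_true, label_node, h_node, children_node]
        rw [gam_one, hL, hc.1 rfl]
      · simp only [graft, List.isEmpty_iff, hws, if_false, label_node, h_node]
        rw [ih hws hc.2.2, gam_oplus _ _ (children_hL_ne_nil hws)]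
    rw [graftL_snoc, hL_snoc, hL_snoc, key, label_node, h_node]
    split_ifs
    · rfl
    · rw [obslash_oplus _ _ (children_gam_ne_nil _ _)]

/-- The outer `h` undoes each γ by `hL_gamL` and each ⦸ by `hL_graftL`, the latter restoring the
order of the summands. -/
theorem h_hL {cs : List PTree} (hcs : AllProper cs) : h (hL cs) = node (lsum cs) cs := by
  induction cs using forest_cons_induction with
  | nil => simp [hL, leaf, h]
  | cons j ws cs ih1 ih2 =>
    have hc := hcs.1
    have hg := hc
    rw [isProper_node] at hc
    obtain ⟨hb, hr, -, -⟩ := hL_properties hc.2.2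
    have hv := gamValid_of_isProper hg hr
    have key : h (gam j (hL ws)) = node j [node j ws] := by
      have hi := ih1 hc.2.2
      cases hh : hL ws with
      | node r us =>
      rw [hh] at hv hb hi
      rw [gam_node, h_node, hL_gamL hb.2 hv, ← h_node r, hi]
      simp [lam]
    by_cases he : cs = []
    · subst he
      rw [hL_singleton, label_node, h_node, key]
      simp
    · rw [hL_cons he, h_node, label_node, h_node, hL_graftL (children_gam_ne_nil _ _)
        (children_hL_ne_nil he), key]
      · have hi := ih2 hcs.2
        cases hh : hL cs with
        | node r us =>
        rw [hh, h_node] at hi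
        simp [hi, oplus_node]
      · have := (hL_properties hcs.2).1
        cases hh : hL cs with
        | node r us =>
        rw [hh] at this
        exact this.2

theorem IsBeta.eq_node {t : PTree} (ht : t.IsBeta) : t = node (lsum t.children) t.children := by
  cases t; rw [isBeta_node] at ht; rw [ht.1]; rfl

theorem IsBeta.allProper {t : PTree} (ht : t.IsBeta) : AllProper t.children := by
  cases t; exact ht.2

theorem h_eq_hL (t : PTree) : h t = hL t.children := by cases t; simp [h]

theorem isBeta_h {t : PTree} (ht : t.IsBeta) : (h t).IsBeta := by
  rw [h_eq_hL]; exact (hL_properties ht.allProper).1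

theorem nodes_h {t : PTree} (ht : t.IsBeta) : (h t).nodes = t.nodes := by
  have hp := (hL_properties ht.allProper).2.2.2
  rw [← h_eq_hL] at hp
  cases hh : h t; cases t
  simpa [hh, nodes] using hp

theorem h_h {t : PTree} (ht : t.IsBeta) : h (h t) = t := by
  rw [h_eq_hL t, h_hL ht.allProper, ← ht.eq_node]

end PTree

namespace Avoider

/-! ### Statistics of words -/

/-- Two words of the same length with the same relative order of letters. -/
def SameOrder (u v : List ℕ) : Prop :=
  u.length = v.length ∧ ∀ i < u.length, ∀ j < u.length,
    (u.getD i 0 < u.getD j 0 ↔ v.getD i 0 < v.getD j 0)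

theorem sameOrder_map {w : List ℕ} {F : ℕ → ℕ} (hF : StrictMonoOn F {x | x ∈ w}) :
    SameOrder w (w.map F) := by
  refine ⟨by simp, fun i hi j hj => ?_⟩
  have hi' : i < (w.map F).length := by simpa using hi
  have hj' : j < (w.map F).length := by simpa using hj
  rw [List.getD_eq_getElem _ _ hi, List.getD_eq_getElem _ _ hj, List.getD_eq_getElem _ _ hi',
    List.getD_eq_getElem _ _ hj', List.getElem_map, List.getElem_map,
    hF.lt_iff_lt (List.getElem_mem hi) (List.getElem_mem hj)]

theorem SameOrder.asc_eq {u v : List ℕ} (h : SameOrder u v) : asc u = asc v := by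
  rw [asc, asc, ← h.1]
  congr 1
  apply Finset.filter_congr
  intro i hi
  rw [Finset.mem_range] at hi
  exact h.2 _ (by omega) _ (by omega)

theorem SameOrder.des_eq {u v : List ℕ} (h : SameOrder u v) : des u = des v := by
  rw [des, des, ← h.1]
  congr 1
  apply Finset.filter_congr
  intro i hi
  rw [Finset.mem_range] at hi
  exact h.2 _ (by omega) _ (by omega)

theorem SameOrder.lmax_eq {u v : List ℕ} (h : SameOrder u v) : lmax u = lmax v := by
  rw [lmax, lmax, ← h.1]
  congr 1
  apply Finset.filter_congr
  intro i hi
  rw [Finset.mem_range] at hi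
  exact forall₂_congr fun j hj => h.2 _ (by omega) _ (by omega)

theorem SameOrder.lmin_eq {u v : List ℕ} (h : SameOrder u v) : lmin u = lmin v := by
  rw [lmin, lmin, ← h.1]
  congr 1
  apply Finset.filter_congr
  intro i hi
  rw [Finset.mem_range] at hi
  exact forall₂_congr fun j hj => h.2 _ (by omega) _ (by omega)

theorem pairwise_take_iff (u : List ℕ) (k : ℕ) :
    (u.take k).Pairwise (fun a b => b < a) ↔
      ∀ i j, i < j → j < k → j < u.length → u.getD j 0 < u.getD i 0 := by
  rw [List.pairwise_iff_getElem]
  constructor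
  · intro h i j hij hjk hj
    have := h i j (by simp; omega) (by simp; omega) hij
    rw [List.getElem_take, List.getElem_take] at this
    rwa [List.getD_eq_getElem _ _ hj, List.getD_eq_getElem _ _ (by omega)]
  · intro h i j hi hj hij
    simp only [List.length_take, lt_min_iff] at hi hj
    have := h i j hij hj.1 hj.2
    rw [List.getElem_take, List.getElem_take]
    rwa [List.getD_eq_getElem _ _ hj.2, List.getD_eq_getElem _ _ (by omega)] at this

theorem SameOrder.ldr_eq {u v : List ℕ} (h : SameOrder u v) : ldr u = ldr v := by
  rw [ldr, ldr, ← h.1]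
  congr 1
  funext k
  rw [pairwise_take_iff, pairwise_take_iff, ← h.1]
  apply propext
  refine forall₂_congr fun i j => forall₃_congr fun h1 h2 h3 => h.2 _ h3 _ (by omega)

theorem asc_cons_cons (a b : ℕ) (w : List ℕ) :
    asc (a :: b :: w) = (if a < b then 1 else 0) + asc (b :: w) := by
  simp only [asc, List.length_cons, Nat.add_sub_cancel, Finset.card_filter]
  rw [Finset.sum_range_succ', Nat.add_comm]
  simp

theorem des_cons_cons (a b : ℕ) (w : List ℕ) :
    des (a :: b :: w) = (if b < a then 1 else 0) + des (b :: w) := by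
  simp only [des, List.length_cons, Nat.add_sub_cancel, Finset.card_filter]
  rw [Finset.sum_range_succ', Nat.add_comm]
  simp

@[simp] theorem asc_nil : asc [] = 0 := by simp [asc]
@[simp] theorem des_nil : des [] = 0 := by simp [des]
@[simp] theorem asc_singleton (a : ℕ) : asc [a] = 0 := by simp [asc]
@[simp] theorem des_singleton (a : ℕ) : des [a] = 0 := by simp [des]
@[simp] theorem lmax_nil : lmax [] = 0 := rfl
@[simp] theorem lmin_nil : lmin [] = 0 := rfl
@[simp] theorem ldr_nil : ldr [] = 0 := by simp [ldr]

theorem asc_append (u : List ℕ) (y x : ℕ) (v : List ℕ) :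
    asc (u ++ y :: x :: v) = asc (u ++ [y]) + asc (x :: v) + if y < x then 1 else 0 := by
  induction u with
  | nil => simp [asc_cons_cons]; omega
  | cons a u ih =>
    cases u with
    | nil => simp [asc_cons_cons] at ih ⊢; omega
    | cons b u => simp only [List.cons_append, asc_cons_cons] at ih ⊢; omega

theorem des_append (u : List ℕ) (y x : ℕ) (v : List ℕ) :
    des (u ++ y :: x :: v) = des (u ++ [y]) + des (x :: v) + if x < y then 1 else 0 := by
  induction u with
  | nil => simp [des_cons_cons]; omega
  | cons a u ih =>
    cases u with
    | nil => simp [des_cons_cons] at ih ⊢; omega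
    | cons b u => simp only [List.cons_append, des_cons_cons] at ih ⊢; omega

theorem asc_append_prec {u v : List ℕ} (h : Prec u v) (hu : u ≠ []) (hv : v ≠ []) :
    asc (u ++ v) = asc u + asc v + 1 := by
  rcases List.eq_nil_or_concat' u with rfl | ⟨u, y, rfl⟩
  · exact absurd rfl hu
  rcases v with _ | ⟨x, v⟩
  · exact absurd rfl hv
  rw [List.append_assoc, List.singleton_append, asc_append, if_pos (h y (by simp) x (by simp))]

theorem des_append_prec {u v : List ℕ} (h : Prec u v) :
    des (u ++ v) = des u + des v := by
  rcases List.eq_nil_or_concat' u with rfl | ⟨u, y, rfl⟩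
  · simp
  rcases v with _ | ⟨x, v⟩
  · simp
  have := h y (by simp) x (by simp)
  rw [List.append_assoc, List.singleton_append, des_append, if_neg (by omega), Nat.add_zero]

theorem getD_append_left {u v : List ℕ} {i : ℕ} (hi : i < u.length) :
    (u ++ v).getD i 0 = u.getD i 0 := by
  rw [List.getD_append _ _ _ _ hi]

theorem forall_lt_length_getD {w : List ℕ} {P : ℕ → Prop} :
    (∀ j < w.length, P (w.getD j 0)) ↔ ∀ x ∈ w, P x := by
  rw [List.forall_mem_iff_getElem]
  exact forall₂_congr fun j hj => by rw [List.getD_eq_getElem _ _ hj]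

theorem lmax_concat (w : List ℕ) (a : ℕ) :
    lmax (w ++ [a]) = lmax w + if ∀ x ∈ w, x < a then 1 else 0 := by
  have ha : (w ++ [a]).getD w.length 0 = a := by simp
  simp only [lmax, Finset.card_filter, List.length_append, List.length_singleton]
  rw [Finset.sum_range_succ]
  congr 1
  · apply Finset.sum_congr rfl
    intro i hi
    rw [Finset.mem_range] at hi
    refine if_congr (forall₂_congr fun j hj => ?_) rfl rfl
    rw [getD_append_left hi, getD_append_left (by omega)]
  · refine if_congr ?_ rfl rfl
    rw [← forall_lt_length_getD (P := fun x => x < a)]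
    refine forall₂_congr fun j hj => ?_
    rw [ha, getD_append_left (by omega)]

theorem lmin_concat (w : List ℕ) (a : ℕ) :
    lmin (w ++ [a]) = lmin w + if ∀ x ∈ w, a < x then 1 else 0 := by
  have ha : (w ++ [a]).getD w.length 0 = a := by simp
  simp only [lmin, Finset.card_filter, List.length_append, List.length_singleton]
  rw [Finset.sum_range_succ]
  congr 1
  · apply Finset.sum_congr rfl
    intro i hi
    rw [Finset.mem_range] at hi
    refine if_congr (forall₂_congr fun j hj => ?_) rfl rfl
    rw [getD_append_left hi, getD_append_left (by omega)]
  · refine if_congr ?_ rfl rfl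
    rw [← forall_lt_length_getD (P := fun x => a < x)]
    refine forall₂_congr fun j hj => ?_
    rw [ha, getD_append_left (by omega)]

theorem lmax_append_prec {u v : List ℕ} (h : Prec u v) : lmax (u ++ v) = lmax u + lmax v := by
  induction v using List.reverseRecOn with
  | nil => simp
  | append_singleton v a ih =>
    have h1 : Prec u v := fun x hx y hy => h x hx y (by simp [hy])
    rw [← List.append_assoc, lmax_concat, lmax_concat, ih h1, Nat.add_assoc]
    congr 3
    apply propext
    constructor
    · exact fun hh x hx => hh x (by simp [hx])
    · intro hh x hx
      rcases List.mem_append.1 hx with hx | hx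
      · exact h x hx a (by simp)
      · exact hh x hx

theorem lmax_append_top {u v : List ℕ} {N : ℕ} (hu : ∀ x ∈ u, x < N) (hv : ∀ x ∈ v, x < N) :
    lmax (u ++ N :: v) = lmax u + 1 := by
  induction v using List.reverseRecOn with
  | nil => rw [lmax_concat, if_pos hu]
  | append_singleton v a ih =>
    have h1 : ∀ x ∈ v, x < N := fun x hx => hv x (by simp [hx])
    rw [← List.cons_append, ← List.append_assoc, lmax_concat, ih h1, if_neg]
    intro hh
    have := hh N (by simp)
    have := hv a (by simp)
    omega

/-- The left-to-right minima of `uv` are those of `u`, and those of the subword of the letters of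
`v` that are smaller than all letters of `u`. -/
theorem lmin_append (u v : List ℕ) :
    lmin (u ++ v) = lmin u + lmin (v.filter (fun x => Prec [x] u)) := by
  induction v using List.reverseRecOn with
  | nil => simp
  | append_singleton v a ih =>
    rw [← List.append_assoc, lmin_concat, ih, List.filter_append]
    by_cases ha : Prec [a] u
    · have : List.filter (fun x => decide (Prec [x] u)) [a] = [a] := by simp [ha]
      rw [this, lmin_concat, Nat.add_assoc]
      congr 3
      apply propext
      constructor
      · exact fun hh x hx => hh x (by simp only [List.mem_filter] at hx; simp [hx.1])
      · intro hh x hx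
        rcases List.mem_append.1 hx with hx | hx
        · exact ha a (by simp) x hx
        · by_cases hxu : Prec [x] u
          · exact hh x (by simp [hx, hxu])
          · simp only [Prec, List.mem_singleton, forall_eq, not_forall] at hxu
            obtain ⟨y, hy, hxy⟩ := hxu
            have := ha a (by simp) y hy
            omega
    · have : List.filter (fun x => decide (Prec [x] u)) [a] = [] := by simp [ha]
      rw [this, List.append_nil, if_neg, Nat.add_zero]
      intro hh
      apply ha
      simp only [Prec, List.mem_singleton, forall_eq]
      exact fun y hy => hh y (by simp [hy])

theorem lmin_singleton (a : ℕ) : lmin [a] = 1 := by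
  rw [← List.nil_append [a], lmin_concat]; simp

theorem lmin_append_prec {u v : List ℕ} (h : Prec u v) (hu : u ≠ []) :
    lmin (u ++ v) = lmin u := by
  have : v.filter (fun x => Prec [x] u) = [] := by
    rw [List.filter_eq_nil_iff]
    intro x hx hxu
    obtain ⟨y, hy⟩ := List.exists_mem_of_ne_nil u hu
    simp only [Prec, List.mem_singleton, forall_eq, decide_eq_true_eq] at hxu
    have := hxu y hy
    have := h y hy x hx
    omega
  rw [lmin_append, this, lmin_nil, Nat.add_zero]

theorem lmin_cons_top {w : List ℕ} {N : ℕ} (hw : ∀ x ∈ w, x < N) :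
    lmin (N :: w) = lmin w + 1 := by
  have : w.filter (fun x => Prec [x] [N]) = w := by
    rw [List.filter_eq_self]
    intro x hx
    simpa [Prec] using hw x hx
  rw [← List.singleton_append, lmin_append, this, lmin_singleton, Nat.add_comm]

theorem lmin_append_top {u v : List ℕ} {N : ℕ} (hu : ∀ x ∈ u, x < N) (hne : u ≠ []) :
    lmin (u ++ N :: v) = lmin (u ++ v) := by
  have h1 : ¬ Prec [N] u := by
    obtain ⟨y, hy⟩ := List.exists_mem_of_ne_nil u hne
    intro hh
    have := hh N (by simp) y hy
    have := hu y hy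
    omega
  rw [lmin_append, lmin_append, List.filter_cons_of_neg (by simpa using h1)]

theorem ldr_eq_iff {w : List ℕ} {k : ℕ} :
    ldr w = k ↔ k ≤ w.length ∧ (w.take k).Pairwise (fun a b => b < a) ∧
      ∀ n, k < n → n ≤ w.length → ¬ (w.take n).Pairwise (fun a b => b < a) := by
  rw [ldr, Nat.findGreatest_eq_iff]
  refine and_congr_right fun _ => ?_
  refine and_congr ⟨fun h => ?_, fun h _ => h⟩ ?_
  · by_cases hk : k = 0
    · subst hk; simp
    · exact h hk
  · exact ⟨fun h n => h (n := n), fun h n => h n⟩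

theorem ldr_spec (w : List ℕ) : ldr w ≤ w.length ∧
    (w.take (ldr w)).Pairwise (fun a b => b < a) ∧
      ∀ n, ldr w < n → n ≤ w.length → ¬ (w.take n).Pairwise (fun a b => b < a) :=
  ldr_eq_iff.1 rfl

theorem ldr_append_of_lt {u v : List ℕ} {x y : ℕ} (h : y < x) :
    ldr (u ++ y :: x :: v) = ldr (u ++ [y]) := by
  obtain ⟨h1, h2, h3⟩ := ldr_spec (u ++ [y])
  have he : u ++ y :: x :: v = (u ++ [y]) ++ x :: v := by simp
  rw [he, ldr_eq_iff]
  refine ⟨by rw [List.length_append]; omega, by rwa [List.take_append_of_le_length h1], ?_⟩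
  intro n hn hn' hp
  by_cases hl : n ≤ (u ++ [y]).length
  · rw [List.take_append_of_le_length hl] at hp
    exact h3 n hn hl hp
  · obtain ⟨k, rfl⟩ : ∃ k, n = (u ++ [y]).length + (k + 1) := ⟨n - (u ++ [y]).length - 1, by omega⟩
    rw [List.take_length_add_append, List.take_succ_cons, List.pairwise_append] at hp
    have := hp.2.2 y (by simp) x (by simp)
    omega

theorem ldr_append_prec {u v : List ℕ} (h : Prec u v) (hu : u ≠ []) : ldr (u ++ v) = ldr u := by
  rcases List.eq_nil_or_concat' u with rfl | ⟨u, y, rfl⟩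
  · exact absurd rfl hu
  rcases v with _ | ⟨x, v⟩
  · simp
  rw [List.append_assoc, List.singleton_append, ldr_append_of_lt (h y (by simp) x (by simp))]

theorem ldr_cons_top {w : List ℕ} {N : ℕ} (hw : ∀ x ∈ w, x < N) :
    ldr (N :: w) = ldr w + 1 := by
  obtain ⟨h1, h2, h3⟩ := ldr_spec w
  rw [ldr_eq_iff]
  refine ⟨by simpa using h1, ?_, ?_⟩
  · rw [List.take_succ_cons, List.pairwise_cons]
    exact ⟨fun x hx => hw x (List.mem_of_mem_take hx), h2⟩
  · rintro (_ | n) hn hn' hp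
    · omega
    · rw [List.take_succ_cons, List.pairwise_cons] at hp
      exact h3 n (by omega) (by simpa using hn') hp.2

/-! ### Components -/

/-- A word that is not a product of two nonempty words `α ≺ β`. -/
def Indecomposable (τ : List ℕ) : Prop :=
  ∀ α β : List ℕ, τ = α ++ β → Prec α β → α = [] ∨ β = []

/-- If τ begins inside a, the letters before τ are below all others, so indecomposability of a makes
τ a prefix. If it then ends inside a, indecomposability of a gives equality; if it reaches into b,
that of τ does. -/
theorem isComponent_append {a b τ : List ℕ} (h : Prec a b) (ha : a ≠ []) (hi : Indecomposable a) :
    IsComponent (a ++ b) τ ↔ τ = a ∨ IsComponent b τ := by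
  constructor
  · rintro ⟨hne, ⟨σ, ρ, he, h1, h2⟩, h3⟩
    rw [List.append_assoc, List.append_eq_append_iff] at he
    have hσρ : Prec σ ρ := by
      obtain ⟨z, hz⟩ := List.exists_mem_of_ne_nil τ hne
      exact fun x hx y hy => (h1 x hx z hz).trans (h2 z hz y hy)
    rcases he with ⟨c, rfl, rfl⟩ | ⟨c, rfl, he⟩
    · exact Or.inr ⟨hne, ⟨c, ρ, by simp, fun x hx => h1 x (by simp [hx]), h2⟩, h3⟩
    · have hc : Prec σ c := by
        intro x hx y hy
        have : y ∈ τ ++ ρ := by rw [he]; simp [hy]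
        rcases List.mem_append.1 this with hy | hy
        · exact h1 x hx y hy
        · exact hσρ x hx y hy
      rcases hi σ c rfl hc with rfl | rfl
      · rw [List.nil_append] at h hi ha
        rw [List.append_eq_append_iff] at he
        rcases he with ⟨d, rfl, rfl⟩ | ⟨d, rfl, rfl⟩
        · rcases hi τ d rfl (fun x hx y hy => h2 x hx y (by simp [hy])) with hh | rfl
          · exact absurd hh hne
          · left; simp
        · rcases h3 c d rfl (fun x hx y hy => h x hx y (by simp [hy])) with hh | rfl
          · exact absurd hh ha
          · left; simp
      · rw [List.nil_append] at he
        exact Or.inr ⟨hne, ⟨[], ρ, by simp [he], by simp [Prec], h2⟩, h3⟩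
  · rintro (rfl | ⟨hne, ⟨σ, ρ, rfl, h1, h2⟩, h3⟩)
    · exact ⟨ha, ⟨[], b, by simp, by simp [Prec], h⟩, hi⟩
    · refine ⟨hne, ⟨a ++ σ, ρ, by simp, ?_, h2⟩, h3⟩
      intro x hx y hy
      rcases List.mem_append.1 hx with hx | hx
      · exact h x hx y (by simp [hy])
      · exact h1 x hx y hy

theorem finite_isComponent (π : List ℕ) : {τ | IsComponent π τ}.Finite := by
  refine (List.finite_toSet π.sublists).subset ?_
  rintro τ ⟨-, ⟨σ, ρ, rfl, -⟩, -⟩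
  simp only [Set.mem_ofPred_eq, List.mem_sublists]
  exact (List.sublist_append_right σ τ).trans (List.sublist_append_left _ _)

theorem comp_append {a b : List ℕ} (h : Prec a b) (ha : a ≠ []) (hi : Indecomposable a) :
    comp (a ++ b) = comp b + 1 := by
  have he : {τ | IsComponent (a ++ b) τ} = insert a {τ | IsComponent b τ} := by
    ext τ
    simp [isComponent_append h ha hi]
  rw [comp, he, Set.ncard_insert_of_notMem _ (finite_isComponent b), comp]
  rintro ⟨-, ⟨σ, ρ, rfl, -⟩, -⟩
  obtain ⟨z, hz⟩ := List.exists_mem_of_ne_nil a ha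
  have := h z hz z (by simp [hz])
  omega

@[simp] theorem comp_nil : comp [] = 0 := by
  have : {τ | IsComponent [] τ} = ∅ := by
    ext τ
    simp only [Set.mem_ofPred_eq, Set.mem_empty_iff_false, iff_false]
    rintro ⟨hne, ⟨σ, ρ, he, -⟩, -⟩
    simp at he
    exact hne he.2.1
  rw [comp, this, Set.ncard_empty]

theorem prec_map {F : ℕ → ℕ} (hF : StrictMono F) {u v : List ℕ} :
    Prec (u.map F) (v.map F) ↔ Prec u v := by
  simp [Prec, hF.lt_iff_lt]

theorem isComponent_map {F : ℕ → ℕ} (hF : StrictMono F) {w τ : List ℕ} :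
    IsComponent (w.map F) τ ↔ ∃ τ', IsComponent w τ' ∧ τ'.map F = τ := by
  constructor
  · rintro ⟨hne, ⟨σ, ρ, he, h1, h2⟩, h3⟩
    rw [List.map_eq_append_iff] at he
    obtain ⟨x, ρ', rfl, hx, rfl⟩ := he
    rw [List.map_eq_append_iff] at hx
    obtain ⟨σ', τ', rfl, rfl, rfl⟩ := hx
    refine ⟨τ', ⟨by simpa using hne, ⟨σ', ρ', rfl, (prec_map hF).1 h1, (prec_map hF).1 h2⟩,
      ?_⟩, rfl⟩
    rintro α β rfl hp
    simpa using h3 (α.map F) (β.map F) (by simp) ((prec_map hF).2 hp)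
  · rintro ⟨τ', ⟨hne, ⟨σ, ρ, rfl, h1, h2⟩, h3⟩, rfl⟩
    refine ⟨by simpa using hne, ⟨σ.map F, ρ.map F, by simp, (prec_map hF).2 h1,
      (prec_map hF).2 h2⟩, ?_⟩
    intro α β he hp
    rw [List.map_eq_append_iff] at he
    obtain ⟨α', β', rfl, rfl, rfl⟩ := he
    simpa using h3 α' β' rfl ((prec_map hF).1 hp)

theorem comp_map {F : ℕ → ℕ} (hF : StrictMono F) (w : List ℕ) : comp (w.map F) = comp w := by
  have : {τ | IsComponent (w.map F) τ} = List.map F '' {τ | IsComponent w τ} := by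
    ext τ
    simp [isComponent_map hF]
  rw [comp, this, Set.ncard_image_of_injective _ (List.map_injective_iff.2 hF.injective), comp]

end Avoider

namespace Avoider

/-! ### Permutations and standardization -/

theorem isPermWord_iff {n : ℕ} {w : List ℕ} :
    IsPermWord n w ↔ w.Nodup ∧ w.length = n ∧ ∀ x ∈ w, 1 ≤ x ∧ x ≤ n := by
  constructor
  · intro h
    refine ⟨h.nodup_iff.2 List.nodup_range', by simpa using h.length_eq, fun x hx => ?_⟩
    have := h.mem_iff.1 hx
    rw [List.mem_range'_1] at this
    omega
  · rintro ⟨h1, h2, h3⟩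
    refine (List.Nodup.subperm h1 ?_).perm_of_length_le (by simp [h2])
    intro x hx
    have := h3 x hx
    rw [List.mem_range'_1]
    omega

theorem IsPermWord.mem_iff {n x : ℕ} {w : List ℕ} (h : IsPermWord n w) :
    x ∈ w ↔ 1 ≤ x ∧ x ≤ n := by
  rw [List.Perm.mem_iff h, List.mem_range'_1]; omega

theorem IsPermWord.nodup {n : ℕ} {w : List ℕ} (h : IsPermWord n w) : w.Nodup :=
  (isPermWord_iff.1 h).1

theorem IsPermWord.length {n : ℕ} {w : List ℕ} (h : IsPermWord n w) : w.length = n :=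
  (isPermWord_iff.1 h).2.1

theorem countP_le_range' (n k : ℕ) : (List.range' 1 n).countP (· ≤ k) = min n k := by
  induction n with
  | zero => simp
  | succ n ih =>
    rw [List.range'_concat, List.countP_append, ih]
    simp only [List.countP_cons, List.countP_nil, decide_eq_true_eq]
    split_ifs <;> omega

theorem IsPermWord.countP_le {n k : ℕ} {w : List ℕ} (h : IsPermWord n w) (hk : k ≤ n) :
    w.countP (· ≤ k) = k := by
  rw [List.Perm.countP_eq _ h, countP_le_range', min_eq_right hk]

theorem st_map {n : ℕ} {w : List ℕ} {F : ℕ → ℕ} (hw : IsPermWord n w)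
    (hF : StrictMonoOn F {x | x ∈ w}) : st (w.map F) = w := by
  rw [st, List.map_map]
  conv_rhs => rw [← List.map_id w]
  apply List.map_congr_left
  intro x hx
  simp only [Function.comp, List.countP_map, id]
  conv_rhs => rw [← hw.countP_le (hw.mem_iff.1 hx).2]
  apply List.countP_congr
  intro y hy
  have := hF.le_iff_le hy hx
  simpa using this

/-- The sorted letters are F(1) < … < F(n). Thus a word with distinct letters is determined by its
pattern and its set of letters, which is how equalities of words are obtained below. -/
theorem unst_map {n : ℕ} {w : List ℕ} {F : ℕ → ℕ} (hw : IsPermWord n w)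
    (hF : StrictMonoOn F {x | x ∈ w}) : unst (w.map F).toFinset w = w.map F := by
  have h1 : (w.map F).toFinset = ((List.range' 1 n).map F).toFinset :=
    List.toFinset_eq_of_perm _ _ (List.Perm.map F hw)
  have hmem : ∀ x, x ∈ List.range' 1 n ↔ x ∈ w := fun x => (List.Perm.mem_iff hw).symm
  have hp : ((List.range' 1 n).map F).Pairwise (· < ·) := by
    rw [List.pairwise_map]
    refine List.Pairwise.imp_of_mem ?_ List.pairwise_lt_range'
    intro a b ha hb hab
    exact hF ((hmem a).1 ha) ((hmem b).1 hb) hab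
  have h2 : (w.map F).toFinset.sort (· ≤ ·) = (List.range' 1 n).map F := by
    rw [h1, List.toFinset_sort _ (hp.imp (fun h => h.ne))]
    exact hp.imp (fun h => h.le)
  rw [unst, h2]
  apply List.map_congr_left
  intro x hx
  have := hw.mem_iff.1 hx
  rw [List.getD_eq_getElem _ _ (by simp; omega)]
  simp only [List.getElem_map, List.getElem_range']
  congr 1
  omega

theorem countP_le_lt {w : List ℕ} (hw : w.Nodup) {x y : ℕ} (hy : y ∈ w) (h : x < y) :
    w.countP (· ≤ x) < w.countP (· ≤ y) := by
  have key : ∀ z, w.countP (· ≤ z) = (w.toFinset.filter (· ≤ z)).card := by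
    intro z
    rw [List.countP_eq_length_filter, ← List.toFinset_card_of_nodup (hw.filter _),
      List.toFinset_filter]
    simp
  rw [key, key]
  apply Finset.card_lt_card
  rw [Finset.ssubset_iff_of_subset]
  · exact ⟨y, by simp [hy], by simp; omega⟩
  · intro z hz
    simp only [Finset.mem_filter] at hz ⊢
    exact ⟨hz.1, by omega⟩

theorem exists_eq_map_st {w : List ℕ} (hw : w.Nodup) :
    ∃ F : ℕ → ℕ, IsPermWord w.length (st w) ∧ StrictMonoOn F {x | x ∈ st w} ∧
      w = (st w).map F := by
  set c : ℕ → ℕ := fun x => w.countP (· ≤ x) with hc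
  have hmono : StrictMonoOn c {x | x ∈ w} := fun x _ y hy hxy => countP_le_lt hw hy hxy
  have hinv : ∀ x ∈ w, Function.invFunOn c {x | x ∈ w} (c x) = x := fun x hx =>
    hmono.injOn.leftInvOn_invFunOn hx
  have hst : st w = w.map c := rfl
  refine ⟨Function.invFunOn c {x | x ∈ w}, ?_, ?_, ?_⟩
  · rw [hst, isPermWord_iff]
    refine ⟨hw.map_on (fun x hx y hy h => hmono.injOn hx hy h), by simp, ?_⟩
    intro x hx
    obtain ⟨y, hy, rfl⟩ := List.mem_map.1 hx
    refine ⟨?_, List.countP_le_length⟩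
    exact List.countP_pos_iff.2 ⟨y, hy, by simp⟩
  · intro x hx y hy hxy
    rw [Set.mem_ofPred_eq, hst] at hx hy
    obtain ⟨x, hx', rfl⟩ := List.mem_map.1 hx
    obtain ⟨y, hy', rfl⟩ := List.mem_map.1 hy
    rw [hinv x hx', hinv y hy']
    exact (hmono.lt_iff_lt hx' hy').1 hxy
  · rw [hst, List.map_map]
    conv_lhs => rw [← List.map_id w]
    apply List.map_congr_left
    intro x hx
    exact (hinv x hx).symm

/-! ### Avoidance -/

/-- The word avoids 3-1-4-2 and 2-41-3. -/
def Avoids (w : List ℕ) : Prop := ¬ Contains3142 w ∧ ¬ Contains2413 w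

theorem contains3142_map {w : List ℕ} {F : ℕ → ℕ} (hF : StrictMonoOn F {x | x ∈ w}) :
    Contains3142 (w.map F) ↔ Contains3142 w := by
  constructor
  · rintro ⟨a, b, c, d, hab, hbc, hcd, hs⟩
    rw [List.sublist_map_iff] at hs
    obtain ⟨l, hl, he⟩ := hs
    obtain ⟨c, l, rfl, rfl, he1⟩ := List.map_eq_cons_iff.1 he.symm
    obtain ⟨a, l, rfl, rfl, he2⟩ := List.map_eq_cons_iff.1 he1
    obtain ⟨d, l, rfl, rfl, he3⟩ := List.map_eq_cons_iff.1 he2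
    obtain ⟨b, l, rfl, rfl, he4⟩ := List.map_eq_cons_iff.1 he3
    obtain rfl := List.map_eq_nil_iff.1 he4
    have hm : ∀ x ∈ [c, a, d, b], x ∈ w := fun x hx => hl.subset hx
    simp only [List.mem_cons, List.not_mem_nil, or_false, forall_eq_or_imp, forall_eq] at hm
    obtain ⟨hc, ha, hd, hb⟩ := hm
    exact ⟨a, b, c, d, (hF.lt_iff_lt ha hb).1 hab, (hF.lt_iff_lt hb hc).1 hbc,
      (hF.lt_iff_lt hc hd).1 hcd, hl⟩
  · rintro ⟨a, b, c, d, hab, hbc, hcd, hl⟩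
    have hm : ∀ x ∈ [c, a, d, b], x ∈ w := fun x hx => hl.subset hx
    simp only [List.mem_cons, List.not_mem_nil, or_false, forall_eq_or_imp, forall_eq] at hm
    obtain ⟨hc, ha, hd, hb⟩ := hm
    exact ⟨F a, F b, F c, F d, hF ha hb hab, hF hb hc hbc, hF hc hd hcd, hl.map F⟩

theorem contains2413_map {w : List ℕ} {F : ℕ → ℕ} (hF : StrictMonoOn F {x | x ∈ w}) :
    Contains2413 (w.map F) ↔ Contains2413 w := by
  constructor
  · rintro ⟨a, b, c, d, hab, hbc, hcd, α, β, he, hb, hc⟩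
    obtain ⟨α, r, rfl, rfl, he1⟩ := List.map_eq_append_iff.1 he
    obtain ⟨d, r, rfl, rfl, he2⟩ := List.map_eq_cons_iff.1 he1
    obtain ⟨a, β, rfl, rfl, rfl⟩ := List.map_eq_cons_iff.1 he2
    obtain ⟨b, hb1, rfl⟩ := List.mem_map.1 hb
    obtain ⟨c, hc1, rfl⟩ := List.mem_map.1 hc
    have hb' : b ∈ α ++ d :: a :: β := by simp [hb1]
    have hc' : c ∈ α ++ d :: a :: β := by simp [hc1]
    have ha' : a ∈ α ++ d :: a :: β := by simp
    have hd' : d ∈ α ++ d :: a :: β := by simp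
    exact ⟨a, b, c, d, (hF.lt_iff_lt ha' hb').1 hab, (hF.lt_iff_lt hb' hc').1 hbc,
      (hF.lt_iff_lt hc' hd').1 hcd, α, β, rfl, hb1, hc1⟩
  · rintro ⟨a, b, c, d, hab, hbc, hcd, α, β, rfl, hb, hc⟩
    have hb' : b ∈ α ++ d :: a :: β := by simp [hb]
    have hc' : c ∈ α ++ d :: a :: β := by simp [hc]
    have ha' : a ∈ α ++ d :: a :: β := by simp
    have hd' : d ∈ α ++ d :: a :: β := by simp
    exact ⟨F a, F b, F c, F d, hF ha' hb' hab, hF hb' hc' hbc, hF hc' hd' hcd, α.map F, β.map F,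
      by simp, List.mem_map_of_mem hb, List.mem_map_of_mem hc⟩

theorem avoids_map {w : List ℕ} {F : ℕ → ℕ} (hF : StrictMonoOn F {x | x ∈ w}) :
    Avoids (w.map F) ↔ Avoids w := by
  rw [Avoids, Avoids, contains3142_map hF, contains2413_map hF]

theorem avoids_nil : Avoids [] := by
  constructor
  · rintro ⟨a, b, c, d, -, -, -, h⟩
    simp at h
  · rintro ⟨a, b, c, d, -, -, -, α, β, h, -⟩
    simp at h

theorem Avoids.left {u v : List ℕ} (h : Avoids (u ++ v)) : Avoids u := by
  constructor
  · rintro ⟨a, b, c, d, h1, h2, h3, hs⟩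
    exact h.1 ⟨a, b, c, d, h1, h2, h3, hs.trans (List.sublist_append_left u v)⟩
  · rintro ⟨a, b, c, d, h1, h2, h3, α, β, rfl, hb, hc⟩
    exact h.2 ⟨a, b, c, d, h1, h2, h3, α, β ++ v, by simp, hb, by simp [hc]⟩

theorem Avoids.right {u v : List ℕ} (h : Avoids (u ++ v)) : Avoids v := by
  constructor
  · rintro ⟨a, b, c, d, h1, h2, h3, hs⟩
    exact h.1 ⟨a, b, c, d, h1, h2, h3, hs.trans (List.sublist_append_right u v)⟩
  · rintro ⟨a, b, c, d, h1, h2, h3, α, β, rfl, hb, hc⟩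
    exact h.2 ⟨a, b, c, d, h1, h2, h3, u ++ α, β, by simp, by simp [hb], hc⟩

/-- A factor `d a` of a product `uv` lies in `u` or in `v`, or consists of the last letter of `u`
and the first one of `v`. -/
theorem adjacent_append {u v α β : List ℕ} {d a : ℕ} (h : u ++ v = α ++ d :: a :: β) :
    (∃ γ, u = α ++ d :: a :: γ ∧ β = γ ++ v) ∨ (u = α ++ [d] ∧ v = a :: β) ∨
      ∃ γ, α = u ++ γ ∧ v = γ ++ d :: a :: β := by
  rw [List.append_eq_append_iff] at h
  rcases h with ⟨γ, rfl, rfl⟩ | ⟨γ, rfl, h⟩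
  · exact Or.inr (Or.inr ⟨γ, rfl, rfl⟩)
  · rcases γ with _ | ⟨x, _ | ⟨y, γ⟩⟩
    · exact Or.inr (Or.inr ⟨[], by simp, by simpa using h.symm⟩)
    · simp only [List.cons_append, List.nil_append, List.cons.injEq] at h
      exact Or.inr (Or.inl ⟨by rw [h.1], h.2.symm⟩)
    · simp only [List.cons_append, List.cons.injEq] at h
      exact Or.inl ⟨γ, by rw [h.1, h.2.1], h.2.2⟩

theorem sublist_four_append {u v : List ℕ} {c a d b : ℕ} (h : [c, a, d, b].Sublist (u ++ v)) :
    [c, a, d, b].Sublist v ∨ (c ∈ u ∧ [a, d, b].Sublist v) ∨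
      ([c, a].Sublist u ∧ [d, b].Sublist v) ∨ ([c, a, d].Sublist u ∧ b ∈ v) ∨
        [c, a, d, b].Sublist u := by
  rw [List.sublist_append_iff] at h
  obtain ⟨l1, l2, he, h1, h2⟩ := h
  rcases l1 with _ | ⟨_, _ | ⟨_, _ | ⟨_, _ | ⟨_, l1⟩⟩⟩⟩ <;>
    simp only [List.nil_append, List.cons_append, List.cons.injEq] at he
  · subst he; exact Or.inl h2
  · obtain ⟨rfl, rfl⟩ := he; exact Or.inr (Or.inl ⟨by simpa using h1, h2⟩)
  · obtain ⟨rfl, rfl, rfl⟩ := he; exact Or.inr (Or.inr (Or.inl ⟨h1, h2⟩))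
  · obtain ⟨rfl, rfl, rfl, rfl⟩ := he
    exact Or.inr (Or.inr (Or.inr (Or.inl ⟨h1, by simpa using h2⟩)))
  · obtain ⟨rfl, rfl, rfl, rfl, he⟩ := he
    have : l1 = [] := by simpa using (List.append_eq_nil_iff.1 he.symm).1
    subst this
    exact Or.inr (Or.inr (Or.inr (Or.inr h1)))

theorem avoids_append_prec {u v : List ℕ} (h : Prec u v) :
    Avoids (u ++ v) ↔ Avoids u ∧ Avoids v := by
  refine ⟨fun hh => ⟨hh.left, hh.right⟩, fun ⟨hu, hv⟩ => ⟨?_, ?_⟩⟩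
  · rintro ⟨a, b, c, d, h1, h2, h3, hs⟩
    rcases sublist_four_append hs with hs | ⟨hs, hs'⟩ | ⟨hs, hs'⟩ | ⟨hs, hs'⟩ | hs
    · exact hv.1 ⟨a, b, c, d, h1, h2, h3, hs⟩
    · have := h c hs b (hs'.subset (by simp)); omega
    · have := h c (hs.subset (by simp)) b (hs'.subset (by simp)); omega
    · have := h c (hs.subset (by simp)) b hs'; omega
    · exact hu.1 ⟨a, b, c, d, h1, h2, h3, hs⟩
  · rintro ⟨a, b, c, d, h1, h2, h3, α, β, he, hb, hc⟩
    rcases adjacent_append he with ⟨γ, rfl, rfl⟩ | ⟨rfl, rfl⟩ | ⟨γ, rfl, rfl⟩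
    · rcases List.mem_append.1 hc with hc | hc
      · exact hu.2 ⟨a, b, c, d, h1, h2, h3, α, γ, rfl, hb, hc⟩
      · have := h d (by simp) c hc; omega
    · have := h d (by simp) a (by simp); omega
    · rcases List.mem_append.1 hb with hb | hb
      · have := h b hb a (by simp); omega
      · exact hv.2 ⟨a, b, c, d, h1, h2, h3, γ, β, rfl, hb, hc⟩

/-- The numbers `x` such that the value of a letter preceding `n` in a word `σ n τ` may lie
just above `x`, as far as the subword formed by this letter and `n τ` is concerned. -/
structure Height (τ : List ℕ) (x : ℕ) : Prop where
  no132 : ∀ a d b, [a, d, b].Sublist τ → a < b → b ≤ x → x < d → False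
  no312 : ∀ p d a q c, τ = p ++ d :: a :: q → c ∈ q → a ≤ x → x < c → c < d → False
  head : ∀ a q, τ = a :: q → a ≤ x → ∀ c ∈ q, c ≤ x

/-- Being a height depends only on the pattern of the word and on which letters lie below the
threshold. -/
theorem height_map {τ : List ℕ} {F : ℕ → ℕ} (hF : StrictMonoOn F {x | x ∈ τ}) {x y : ℕ}
    (h : ∀ z ∈ τ, F z ≤ x ↔ z ≤ y) : Height (τ.map F) x ↔ Height τ y := by
  have h' : ∀ z ∈ τ, x < F z ↔ y < z := fun z hz => by
    rw [← not_le, h z hz, not_le]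
  constructor
  · intro hh
    constructor
    · intro a d b hs h1 h2 h3
      have ha := hs.subset (show a ∈ [a, d, b] by simp)
      have hd := hs.subset (show d ∈ [a, d, b] by simp)
      have hb := hs.subset (show b ∈ [a, d, b] by simp)
      exact hh.no132 _ _ _ (hs.map F) (hF ha hb h1) ((h b hb).2 h2) ((h' d hd).2 h3)
    · rintro p d a q c rfl hc h1 h2 h3
      have hc' : c ∈ p ++ d :: a :: q := by simp [hc]
      refine hh.no312 (p.map F) (F d) (F a) (q.map F) (F c) (by simp) (List.mem_map_of_mem hc)
        ((h a (by simp)).2 h1) ((h' c hc').2 h2) (hF hc' (by simp) h3)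
    · rintro a q rfl h1 c hc
      have hc' : c ∈ a :: q := by simp [hc]
      exact (h c hc').1 (hh.head (F a) (q.map F) (by simp) ((h a (by simp)).2 h1) _
        (List.mem_map_of_mem hc))
  · intro hh
    constructor
    · intro a d b hs h1 h2 h3
      rw [List.sublist_map_iff] at hs
      obtain ⟨l, hl, he⟩ := hs
      obtain ⟨a, l, rfl, rfl, he1⟩ := List.map_eq_cons_iff.1 he.symm
      obtain ⟨d, l, rfl, rfl, he2⟩ := List.map_eq_cons_iff.1 he1
      obtain ⟨b, l, rfl, rfl, he3⟩ := List.map_eq_cons_iff.1 he2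
      obtain rfl := List.map_eq_nil_iff.1 he3
      have ha := hl.subset (show a ∈ [a, d, b] by simp)
      have hd := hl.subset (show d ∈ [a, d, b] by simp)
      have hb := hl.subset (show b ∈ [a, d, b] by simp)
      exact hh.no132 _ _ _ hl ((hF.lt_iff_lt ha hb).1 h1) ((h b hb).1 h2) ((h' d hd).1 h3)
    · intro p d a q c he hc h1 h2 h3
      obtain ⟨α, r, rfl, rfl, he1⟩ := List.map_eq_append_iff.1 he
      obtain ⟨d, r, rfl, rfl, he2⟩ := List.map_eq_cons_iff.1 he1
      obtain ⟨a, β, rfl, rfl, rfl⟩ := List.map_eq_cons_iff.1 he2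
      obtain ⟨c, hc1, rfl⟩ := List.mem_map.1 hc
      have hc' : c ∈ α ++ d :: a :: β := by simp [hc1]
      exact hh.no312 _ _ _ _ _ rfl hc1 ((h a (by simp)).1 h1) ((h' c hc').1 h2)
        ((hF.lt_iff_lt hc' (by simp)).1 h3)
    · intro a q he h1 c hc
      obtain ⟨a, q, rfl, rfl, rfl⟩ := List.map_eq_cons_iff.1 he
      obtain ⟨c, hc', rfl⟩ := List.mem_map.1 hc
      exact (h c (by simp [hc'])).2 (hh.head _ _ rfl ((h a (by simp)).1 h1) c hc')

/-- Avoidance in a word `u N v` with largest letter `N`. -/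
theorem avoids_append_top {u v : List ℕ} {N : ℕ} (hu : ∀ x ∈ u, x < N) (hv : ∀ x ∈ v, x < N)
    (huv : ∀ x ∈ u, x ∉ v) :
    Avoids (u ++ N :: v) ↔ Avoids u ∧ Avoids v ∧
      (∀ c a b, [c, a].Sublist u → b ∈ v → a < b → b < c → False) ∧ ∀ x ∈ u, Height v x := by
  constructor
  · intro hh
    have hvN := hh.right
    rw [← List.singleton_append] at hvN
    refine ⟨hh.left, hvN.right, ?_, ?_⟩
    · intro c a b hs hb h1 h2
      refine hh.1 ⟨a, b, c, N, h1, h2, hu c (hs.subset (by simp)), ?_⟩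
      exact hs.append ((List.singleton_sublist.2 hb).cons_cons N)
    · intro x hx
      constructor
      · intro a d b hs h1 h2 h3
        have hb := hs.subset (show b ∈ [a, d, b] by simp)
        have : b ≠ x := by rintro rfl; exact huv _ hx hb
        refine hh.1 ⟨a, b, x, d, h1, by omega, h3, ?_⟩
        exact (List.singleton_sublist.2 hx).append (hs.cons N)
      · rintro p d a q c rfl hc h1 h2 h3
        have : a ≠ x := by rintro rfl; exact huv _ hx (by simp)
        exact hh.2 ⟨a, x, c, d, by omega, h2, h3, u ++ N :: p, q, by simp, by simp [hx], hc⟩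
      · rintro a q rfl h1 c hc
        have : a ≠ x := by rintro rfl; exact huv _ hx (by simp)
        by_contra h2
        exact hh.2 ⟨a, x, c, N, by omega, by omega, hv c (by simp [hc]), u, q, by simp, hx, hc⟩
  · rintro ⟨h1, h2, h3, h4⟩
    constructor
    · rintro ⟨a, b, c, d, hab, hbc, hcd, hs⟩
      have hNv : ∀ l : List ℕ, l.Sublist (N :: v) → l.Sublist v ∨ ∃ r, l = N :: r ∧ r.Sublist v := by
        intro l hl
        rcases List.sublist_cons_iff.1 hl with h | h
        · exact Or.inl h
        · exact Or.inr h
      have hbN : b ≠ N := by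
        rintro rfl
        have : ∀ x ∈ u ++ b :: v, x ≤ b := by
          intro x hx
          simp only [List.mem_append, List.mem_cons] at hx
          rcases hx with hx | hx | hx
          · exact (hu x hx).le
          · exact hx.le
          · exact (hv x hx).le
        have := this d (hs.subset (by simp))
        omega
      rcases sublist_four_append hs with hs | ⟨hs, hs'⟩ | ⟨hs, hs'⟩ | ⟨hs, hs'⟩ | hs
      · rcases hNv _ hs with hs | ⟨r, he, hs⟩
        · exact h2.1 ⟨a, b, c, d, hab, hbc, hcd, hs⟩
        · simp only [List.cons.injEq] at he
          obtain ⟨rfl, rfl⟩ := he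
          have := hv d (hs.subset (by simp))
          omega
      · rcases hNv _ hs' with hs' | ⟨r, he, hs'⟩
        · exact (h4 c hs).no132 a d b hs' hab hbc.le hcd
        · simp only [List.cons.injEq] at he
          obtain ⟨rfl, rfl⟩ := he
          have := hv d (hs'.subset (by simp))
          omega
      · have : b ∈ N :: v := hs'.subset (by simp)
        exact h3 c a b hs (by simpa [hbN] using this) hab hbc
      · exact h3 c a b ((List.sublist_append_left [c, a] [d]).trans hs)
          (by simpa [hbN] using hs') hab hbc
      · exact h1.1 ⟨a, b, c, d, hab, hbc, hcd, hs⟩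
    · rintro ⟨a, b, c, d, hab, hbc, hcd, α, β, he, hb, hc⟩
      rcases adjacent_append he with ⟨γ, rfl, rfl⟩ | ⟨rfl, he'⟩ | ⟨γ, rfl, he'⟩
      · simp only [List.mem_append, List.mem_cons] at hc
        rcases hc with hc | rfl | hc
        · exact h1.2 ⟨a, b, c, d, hab, hbc, hcd, α, γ, rfl, hb, hc⟩
        · have := hu d (by simp); omega
        · refine h3 d a c ?_ hc (by omega) hcd
          have : [d, a] ++ γ = d :: a :: γ := rfl
          rw [← this]
          exact (List.sublist_append_left _ _).trans (List.sublist_append_right _ _)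
      · simp only [List.cons.injEq] at he'
        have := hu b (by simp [hb]); omega
      · rcases γ with _ | ⟨x, γ⟩
        · simp only [List.nil_append, List.cons.injEq] at he'
          obtain ⟨rfl, rfl⟩ := he'
          have := (h4 b (by simpa using hb)).head a β rfl hab.le c hc
          omega
        · simp only [List.cons_append, List.cons.injEq] at he'
          obtain ⟨rfl, rfl⟩ := he'
          simp only [List.mem_append, List.mem_cons] at hb
          rcases hb with hb | rfl | hb
          · exact (h4 b hb).no312 γ d a β c rfl hc hab.le hbc hcd
          · have := hv d (by simp); omega
          · exact h2.2 ⟨a, b, c, d, hab, hbc, hcd, γ, β, rfl, hb, hc⟩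

theorem avoids_cons_top {v : List ℕ} {N : ℕ} (hv : ∀ x ∈ v, x < N) :
    Avoids (N :: v) ↔ Avoids v := by
  rw [← List.nil_append (N :: v), avoids_append_top (by simp) hv (by simp)]
  simp [avoids_nil]

/-- Inserting a new largest letter immediately before a left-to-right maximum. -/
theorem avoids_insert_top {u v : List ℕ} {N M : ℕ} (hu : ∀ x ∈ u, x < M) (hM : M < N)
    (hv : ∀ x ∈ v, x < N) : Avoids (u ++ N :: M :: v) ↔ Avoids (u ++ M :: v) := by
  constructor
  · intro hh
    constructor
    · rintro ⟨a, b, c, d, h1, h2, h3, hs⟩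
      exact hh.1 ⟨a, b, c, d, h1, h2, h3,
        hs.trans ((List.Sublist.refl u).append (List.sublist_cons_self N _))⟩
    · rintro ⟨a, b, c, d, h1, h2, h3, α, β, he, hb, hc⟩
      rcases adjacent_append he with ⟨γ, rfl, rfl⟩ | ⟨rfl, he'⟩ | ⟨γ, rfl, he'⟩
      · refine hh.2 ⟨a, b, c, d, h1, h2, h3, α, γ ++ N :: M :: v, by simp, hb, ?_⟩
        simp only [List.mem_append, List.mem_cons] at hc ⊢
        tauto
      · simp only [List.cons.injEq] at he'
        have := hu d (by simp); omega
      · refine hh.2 ⟨a, b, c, d, h1, h2, h3, u ++ N :: γ, β, by simp [he'], ?_, hc⟩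
        simp only [List.mem_append, List.mem_cons] at hb ⊢
        tauto
  · intro hh
    have hmax : ∀ x ∈ u ++ N :: M :: v, x ≤ N := by
      intro x hx
      simp only [List.mem_append, List.mem_cons] at hx
      rcases hx with hx | rfl | rfl | hx
      · have := hu x hx; omega
      · exact le_rfl
      · exact hM.le
      · exact (hv x hx).le
    have hNv : ∀ l : List ℕ, l.Sublist (N :: M :: v) →
        l.Sublist (M :: v) ∨ ∃ r, l = N :: r ∧ r.Sublist (M :: v) := by
      intro l hl
      rcases List.sublist_cons_iff.1 hl with h | h
      · exact Or.inl h
      · exact Or.inr h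
    constructor
    · rintro ⟨a, b, c, d, h1, h2, h3, hs⟩
      have hd := hmax d (hs.subset (by simp))
      by_cases hdN : d = N
      · subst hdN
        -- If N plays the 4, the letters playing 3 and 1 precede it and so lie in u. Hence b < c < M
        -- forces b into v, and M can take over the role of N.
        have hkey : [c, a].Sublist u ∧ b ∈ v := by
          rcases sublist_four_append hs with hs | ⟨hs, hs'⟩ | ⟨hs, hs'⟩ | ⟨hs, hs'⟩ | hs
          · rcases hNv _ hs with hs | ⟨r, he, hs⟩
            · have : d ∈ M :: v := hs.subset (by simp)
              simp only [List.mem_cons] at this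
              rcases this with h | h
              · omega
              · have := hv d h; omega
            · simp only [List.cons.injEq] at he; omega
          · rcases hNv _ hs' with hs' | ⟨r, he, hs'⟩
            · have : d ∈ M :: v := hs'.subset (by simp)
              simp only [List.mem_cons] at this
              rcases this with h | h
              · omega
              · have := hv d h; omega
            · simp only [List.cons.injEq] at he; omega
          · refine ⟨hs, ?_⟩
            have hc := hu c (hs.subset (by simp))
            have : b ∈ d :: M :: v := hs'.subset (by simp)
            simp only [List.mem_cons] at this
            rcases this with h | h | h
            · omega
            · omega
            · exact h
          · have := hu d (hs.subset (by simp)); omega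
          · have := hu d (hs.subset (by simp)); omega
        refine hh.1 ⟨a, b, c, M, h1, h2, hu c (hkey.1.subset (by simp)), ?_⟩
        exact hkey.1.append ((List.singleton_sublist.2 hkey.2).cons_cons M)
      · refine hh.1 ⟨a, b, c, d, h1, h2, h3, ?_⟩
        have hf := hs.filter (fun x => decide (x ≠ N))
        have huN : ∀ x ∈ u, x ≠ N := fun x hx => ((hu x hx).trans hM).ne
        have hvN : ∀ x ∈ M :: v, x ≠ N := by
          intro x hx
          rcases List.mem_cons.1 hx with rfl | hx
          · exact hM.ne
          · exact (hv x hx).ne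
        have hcN : ∀ x ∈ [c, a, d, b], x ≠ N := by
          intro x hx
          simp only [List.mem_cons, List.not_mem_nil, or_false] at hx
          omega
        rw [List.filter_append, List.filter_eq_self.2 (by simpa using hcN),
          List.filter_eq_self.2 (by simpa using huN), List.filter_cons_of_neg (by simp),
          List.filter_eq_self.2 (by simpa using hvN)] at hf
        exact hf
    · rintro ⟨a, b, c, d, h1, h2, h3, α, β, he, hb, hc⟩
      have hd := hmax d (by rw [he]; simp)
      rcases adjacent_append he with ⟨γ, rfl, rfl⟩ | ⟨rfl, he'⟩ | ⟨γ, rfl, he'⟩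
      · refine hh.2 ⟨a, b, c, d, h1, h2, h3, α, γ ++ M :: v, by simp, hb, ?_⟩
        simp only [List.mem_append, List.mem_cons] at hc ⊢
        rcases hc with hc | hc | hc
        · exact Or.inl hc
        · omega
        · exact Or.inr hc
      · simp only [List.cons.injEq] at he'
        have := hu d (by simp); omega
      · rcases γ with _ | ⟨x, γ⟩
        · simp only [List.nil_append, List.cons.injEq] at he'
          have := hu b (by simpa using hb); omega
        · simp only [List.cons_append, List.cons.injEq] at he'
          obtain ⟨rfl, he'⟩ := he'
          refine hh.2 ⟨a, b, c, d, h1, h2, h3, u ++ γ, β, by simp [he'], ?_, hc⟩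
          simp only [List.mem_append, List.mem_cons] at hb ⊢
          rcases hb with hb | hb | hb
          · exact Or.inl hb
          · omega
          · exact Or.inr hb

end Avoider

namespace Avoider

/-! ### Consecutive heights -/

/-- A discrete intermediate value argument, which supplies the adjacent letters 41 of a dashed
pattern. -/
theorem exists_descent_across {h : ℕ} (p : List ℕ) {x z : ℕ} (hx : h < x) (hz : z ≤ h) :
    ∃ p' d a q, x :: p ++ [z] = p' ++ d :: a :: q ∧ h < d ∧ a ≤ h := by
  induction p generalizing x with
  | nil => exact ⟨[], x, z, [], rfl, hx, hz⟩
  | cons y p ih =>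
    by_cases hy : y ≤ h
    · exact ⟨[], x, y, p ++ [z], rfl, hx, hy⟩
    · obtain ⟨p', d, a, q, he, h1, h2⟩ := ih (not_le.1 hy)
      refine ⟨x :: p', d, a, q, ?_, h1, h2⟩
      rw [List.cons_append (a := x) (as := p'), ← he]; rfl

theorem height_zero {q : ℕ} {t : List ℕ} (ht : IsPermWord q t) : Height t 0 := by
  constructor
  · intro a d b _ h1 h2 _; omega
  · rintro p d a q c rfl hc h1 h2 h3
    have := (ht.mem_iff (x := a)).1 (by simp); omega
  · rintro a q rfl h1 c hc
    have := (ht.mem_iff (x := a)).1 (by simp); omega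

theorem height_length {q : ℕ} {t : List ℕ} (ht : IsPermWord q t) : Height t q := by
  constructor
  · intro a d b hs h1 h2 h3
    have := ht.mem_iff.1 (hs.subset (show d ∈ [a, d, b] by simp)); omega
  · rintro p d a q c rfl hc h1 h2 h3
    have := (ht.mem_iff (x := c)).1 (by simp [hc]); omega
  · rintro a q rfl h1 c hc
    exact ((ht.mem_iff (x := c)).1 (by simp [hc])).2

/-- Suppose a letter x ≤ h precedes h + 1. The first letter of t exceeds h by the `head` condition,
so a descent crosses the level h before h + 1 is reached, and h + 1 completes a configuration
excluded by `no312`. -/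
theorem Height.lt_of_mem_left {t p q : List ℕ} {h : ℕ} (hh : Height t h)
    (he : t = p ++ (h + 1) :: q) (hn : t.Nodup) : ∀ x ∈ p, h + 1 < x := by
  subst he
  have hne : ∀ x ∈ p, x ≠ h + 1 := by
    rintro x hx rfl
    exact (List.disjoint_of_nodup_append hn) hx (by simp)
  intro x hx
  by_contra hlt
  have hxh : x ≤ h := by have := hne x hx; omega
  obtain ⟨p1, p2, rfl⟩ := List.append_of_mem hx
  rcases p1 with _ | ⟨f, p1⟩
  · have := hh.head x (p2 ++ (h + 1) :: q) (by simp) hxh (h + 1) (by simp)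
    omega
  · have hf : h < f := by
      by_contra hf
      have := hh.head f (p1 ++ x :: p2 ++ (h + 1) :: q) (by simp) (by omega) (h + 1) (by simp)
      omega
    obtain ⟨p', d, a, r, he, h1, h2⟩ := exists_descent_across p1 hf hxh
    have hd : d ∈ f :: p1 ++ [x] := by rw [he]; simp
    have hd' : d ≠ h + 1 := hne d (by simp at hd ⊢; tauto)
    refine hh.no312 p' d a (r ++ p2 ++ (h + 1) :: q) (h + 1) ?_ (by simp) h2 (by omega) (by omega)
    have : f :: p1 ++ x :: p2 ++ (h + 1) :: q = (f :: p1 ++ [x]) ++ p2 ++ (h + 1) :: q := by simp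
    rw [this, he]; simp

theorem mStat_append {u v : List ℕ} {a : ℕ} (hu : ∀ x ∈ u, a < x) (hv : ∀ x ∈ v, a < x) :
    mStat (u ++ a :: v) = (v.filter (fun x => Prec [x] u)).length := by
  have hmin : (u ++ a :: v).min? = some a := by
    rw [List.min?_eq_some_iff]
    refine ⟨by simp, fun x hx => ?_⟩
    simp only [List.mem_append, List.mem_cons] at hx
    rcases hx with hx | hx | hx
    · exact (hu x hx).le
    · exact hx.ge
    · exact (hv x hx).le
  have hu' : ∀ x ∈ u, (decide (x ≠ a)) = true := fun x hx => by simpa using (hu x hx).ne'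
  rw [mStat, hmin, Option.getD_some, List.dropWhile_append_of_pos hu',
    List.takeWhile_append_of_pos hu', List.dropWhile_cons_of_neg (by simp),
    List.takeWhile_cons_of_neg (by simp), List.tail_cons, List.append_nil]

theorem length_filter_Ioc {n a b : ℕ} {t : List ℕ} (ht : IsPermWord n t) (hab : a ≤ b)
    (hb : b ≤ n) : (t.filter (fun y => a < y ∧ y ≤ b)).length = b - a := by
  have h1 := ht.countP_le hb
  have h2 := ht.countP_le (hab.trans hb)
  rw [List.countP_eq_length_filter] at h1 h2
  have h3 := List.length_eq_length_filter_add (l := t.filter (· ≤ b)) (fun y => decide (a < y))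
  rw [List.filter_filter, List.filter_filter, h1] at h3
  have h4 : t.filter (fun y => decide (a < y) && decide (y ≤ b)) =
      t.filter (fun y => a < y ∧ y ≤ b) := by
    apply List.filter_congr; simp
  have h5 : t.filter (fun y => !decide (a < y) && decide (y ≤ b)) = t.filter (· ≤ a) := by
    apply List.filter_congr
    intro x _
    simp only [← decide_not, ← Bool.decide_and, decide_eq_decide]
    omega
  rw [h4, h5, h2] at h3
  omega

/-- The smallest height exceeding `h`. -/
noncomputable def nextHeight (t : List ℕ) (h : ℕ) : ℕ := sInf {g | Height t g ∧ h < g}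

/-- With t = p (h+1) q, the next height g is one less than the smallest letter of p, or h' if p has
no letter that small. Here h' is any known height above h; in ψ it is the height of the next
interval. -/
theorem nextHeight_aux {n h h' : ℕ} {t : List ℕ} (ht : IsPermWord n t) (hav : Avoids t)
    (hh : Height t h) (hh' : Height t h') (hlt : h < h') (hle : h' ≤ n) :
    ∃ g p q, t = p ++ (h + 1) :: q ∧ h < g ∧ g ≤ h' ∧ (∀ x ∈ p, g < x) ∧
      (g < h' → g + 1 ∈ p) ∧ Height t g ∧ ∀ g', Height t g' → h < g' → g ≤ g' := by
  obtain ⟨p, q, he⟩ := List.append_of_mem (ht.mem_iff.2 ⟨by omega, by omega⟩ : h + 1 ∈ t)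
  have hp := hh.lt_of_mem_left he ht.nodup
  set g := Nat.findGreatest (fun g => ∀ x ∈ p, g < x) h' with hg
  have hg1 : h + 1 ≤ g := Nat.le_findGreatest (by omega) hp
  have hg2 : ∀ x ∈ p, g < x :=
    Nat.findGreatest_spec (P := fun g => ∀ x ∈ p, g < x) (by omega : h + 1 ≤ h') hp
  have hg3 : g ≤ h' := Nat.findGreatest_le _
  have hg4 : g < h' → g + 1 ∈ p := by
    intro hlt'
    have := Nat.findGreatest_is_greatest (P := fun g => ∀ x ∈ p, g < x) (n := h')
      (show _ < g + 1 by omega) (by omega)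
    push Not at this
    obtain ⟨x, hx, hxg⟩ := this
    have := hg2 x hx
    have : x = g + 1 := by omega
    rwa [← this]
  refine ⟨g, p, q, he, by omega, hg3, hg2, hg4, ?_, ?_⟩
  · rcases hg3.eq_or_lt with heq | hlt'
    · rwa [heq]
    have hμ := hg4 hlt'
    have hnd := ht.nodup
    rw [he] at hnd
    have hdisj := List.disjoint_of_nodup_append hnd
    constructor
    · intro a d b hs h1 h2 h3
      have ha : a ∉ p := fun hap => by have := hg2 a hap; omega
      have hs' : [a, d, b].Sublist ((h + 1) :: q) := by
        rw [he, List.sublist_append_iff] at hs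
        obtain ⟨l1, l2, hl, hl1, hl2⟩ := hs
        rcases l1 with _ | ⟨x, l1⟩
        · rw [hl]; exact hl2
        · simp only [List.cons_append, List.cons.injEq] at hl
          rw [← hl.1] at hl1
          exact absurd (hl1.subset (by simp)) ha
      have hd : d ≠ g + 1 := by
        rintro rfl
        exact hdisj hμ (hs'.subset (by simp))
      -- The letter μ plays the 3 of 3-1-4-2.
      refine hav.1 ⟨a, b, g + 1, d, h1, by omega, by omega, ?_⟩
      rw [he]
      exact (List.singleton_sublist.2 hμ).append hs'
    · intro p' d a r c he' hc h1 h2 h3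
      have ha : a ∉ p := fun hap => by have := hg2 a hap; omega
      rw [he] at he'
      rcases adjacent_append he' with ⟨γ, rfl, rfl⟩ | ⟨rfl, heq⟩ | ⟨γ, rfl, heq⟩
      · simp at ha
      · simp only [List.cons.injEq] at heq
        have hcne : c ≠ g + 1 := by
          rintro rfl
          exact hdisj hμ (by simp [heq.2, hc])
        have hμ' : g + 1 ∈ p' := by
          rcases List.mem_append.1 hμ with h | h
          · exact h
          · simp at h; omega
        -- The letter μ plays the 2 of 2-41-3. It differs from d, because c lies strictly between g
        -- and d.
        exact hav.2 ⟨a, g + 1, c, d, by omega, by omega, h3, p', r, by rw [he]; simp [heq], hμ', hc⟩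
      · have hcne : c ≠ g + 1 := by
          rintro rfl
          exact hdisj hμ (by simp [heq, hc])
        exact hav.2 ⟨a, g + 1, c, d, by omega, by omega, h3, p ++ γ, r, by rw [he]; simp [heq],
          by simp [hμ], hc⟩
    · intro a r he' h1 c hc
      exfalso
      rw [he'] at he
      rcases p with _ | ⟨f, p⟩
      · simp at hμ
      · simp only [List.cons_append, List.cons.injEq] at he
        have := hg2 f (by simp)
        omega
  · intro g' hg' hlt'
    by_contra hgg
    -- For h < g' < g the letter g' + 1 comes after h + 1. It violates `head` if p is empty, and
    -- otherwise violates `no312` together with a descent across g' on the way from the first letter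
    -- to h + 1.
    have hmem : g' + 1 ∈ t := ht.mem_iff.2 ⟨by omega, by omega⟩
    have hq : g' + 1 ∈ q := by
      rw [he] at hmem
      simp only [List.mem_append, List.mem_cons] at hmem
      rcases hmem with h | h | h
      · have := hg2 _ h; omega
      · omega
      · exact h
    rcases p with _ | ⟨f, p⟩
    · have := hg'.head (h + 1) q (by simpa using he) (by omega) _ hq
      omega
    · have hf := hg2 f (by simp)
      obtain ⟨p', d, a, r, he', h1, h2⟩ := exists_descent_across p (show g' < f by omega)
        (show h + 1 ≤ g' by omega)
      have hd : d ∈ f :: p ++ [h + 1] := by rw [he']; simp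
      have hdg : g < d := by
        simp only [List.cons_append, List.mem_cons, List.mem_append, List.not_mem_nil,
          or_false] at hd
        rcases hd with h | h | h
        · exact hg2 d (by simp [h])
        · exact hg2 d (by simp [h])
        · omega
      refine hg'.no312 p' d a (r ++ q) (g' + 1) ?_ (by simp [hq]) h2 (by omega) (by omega)
      have : t = (f :: p ++ [h + 1]) ++ q := by rw [he]; simp
      rw [this, he']; simp

theorem nextHeight_eq {t : List ℕ} {g h : ℕ} (hg : Height t g) (hlt : h < g)
    (hmin : ∀ g', Height t g' → h < g' → g ≤ g') : nextHeight t h = g :=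
  IsLeast.csInf_eq ⟨⟨hg, hlt⟩, fun _ hx => hmin _ hx.1 hx.2⟩

theorem nextHeight_spec {t : List ℕ} {h h' : ℕ} (hh' : Height t h') (hlt : h < h') :
    Height t (nextHeight t h) ∧ h < nextHeight t h ∧ nextHeight t h ≤ h' :=
  have := Nat.sInf_mem (s := {g | Height t g ∧ h < g}) ⟨h', hh', hlt⟩
  ⟨this.1, this.2, Nat.sInf_le ⟨hh', hlt⟩⟩

theorem exists_nextHeight_eq {n g : ℕ} {t : List ℕ} (ht : IsPermWord n t) (hg : Height t g)
    (hpos : 0 < g) : ∃ h, Height t h ∧ h < g ∧ nextHeight t h = g := by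
  classical
  set h := Nat.findGreatest (fun x => Height t x) (g - 1) with hh
  have h1 : Height t h :=
    Nat.findGreatest_spec (P := fun x => Height t x) (Nat.zero_le _) (height_zero ht)
  have h2 : h ≤ g - 1 := Nat.findGreatest_le _
  refine ⟨h, h1, by omega, nextHeight_eq hg (by omega) ?_⟩
  intro g' hg' hlt
  by_contra hgg
  exact Nat.findGreatest_is_greatest (P := fun x => Height t x) (n := g - 1) hlt (by omega) hg'

/-- The word w has the letters of ranks h + 1, …, h', and its minimum has rank h + 1. The letters
after the minimum that are below all those before it are the ones of ranks h + 2, …, g with g the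
next height, whence m + h + 1 = g. -/
theorem mStat_eq_nextHeight {n h h' : ℕ} {t : List ℕ} {F : ℕ → ℕ} (ht : IsPermWord n t)
    (hav : Avoids t) (hF : StrictMonoOn F {x | x ∈ t}) (hh : Height t h) (hh' : Height t h')
    (hlt : h < h') (hle : h' ≤ n) :
    mStat ((t.filter (fun y => h < y ∧ y ≤ h')).map F) + h + 1 = nextHeight t h := by
  obtain ⟨g, p, q, he, h1, h2, h3, h4, h5, h6⟩ := nextHeight_aux ht hav hh hh' hlt hle
  rw [nextHeight_eq h5 h1 h6]
  have hlen := length_filter_Ioc ht (show h + 1 ≤ g by omega) (by omega)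
  have hnd := ht.nodup
  rw [he] at hnd
  have hp0 : p.filter (fun y => h + 1 < y ∧ y ≤ g) = [] := by
    rw [List.filter_eq_nil_iff]
    intro x hx
    have := h3 x hx
    simp; omega
  have hpt : ∀ x ∈ p, x ∈ t := fun x hx => by rw [he]; simp [hx]
  have hqt : ∀ x ∈ q, x ∈ t := fun x hx => by rw [he]; simp [hx]
  have hat : h + 1 ∈ t := by rw [he]; simp
  have hqne : ∀ x ∈ q, x ≠ h + 1 := by
    rintro x hx rfl
    exact (List.nodup_cons.1 (hnd.of_append_right)).1 hx
  rw [he, List.filter_append, hp0, List.nil_append, List.filter_cons_of_neg (by simp)] at hlen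
  rw [he, List.filter_append, List.filter_cons_of_pos (by simpa using hlt), List.map_append,
    List.map_cons, mStat_append, List.filter_map, List.length_map, List.filter_filter]
  · rw [show q.filter _ = q.filter (fun y => h + 1 < y ∧ y ≤ g) from ?_]
    · omega
    apply List.filter_congr
    intro x hx
    rw [Bool.eq_iff_iff]
    simp only [Prec, Function.comp, List.mem_singleton, forall_eq, List.mem_map, List.mem_filter,
      decide_eq_true_eq, Bool.and_eq_true, forall_exists_index, and_imp]
    constructor
    · rintro ⟨hx1, hx2, hx3⟩
      refine ⟨by have := hqne x hx; omega, ?_⟩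
      -- A letter x with g < x ≤ h' shows g < h', so g + 1 lies in p, hence in the part of w before
      -- the minimum, and x is not below it.
      by_contra hxg
      have hμ := h4 (by omega)
      have := of_decide_eq_true hx1 (F x) (by simp) (F (g + 1)) (List.mem_map_of_mem
        (List.mem_filter.2 ⟨hμ, by simp; omega⟩))
      rw [hF.lt_iff_lt (hqt x hx) (hpt _ hμ)] at this
      omega
    · rintro ⟨hx1, hx2⟩
      refine ⟨decide_eq_true ?_, by omega, by omega⟩
      intro a ha b hb
      rw [List.mem_singleton] at ha
      obtain ⟨y, hy, rfl⟩ := List.mem_map.1 hb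
      replace hy := (List.mem_filter.1 hy).1
      subst ha
      rw [hF.lt_iff_lt (hqt x hx) (hpt _ hy)]
      have := h3 y hy
      omega
  · intro x hx
    obtain ⟨y, hy, rfl⟩ := List.mem_map.1 hx
    simp only [List.mem_filter, decide_eq_true_eq] at hy
    rw [hF.lt_iff_lt hat (hpt y hy.1)]
    have := h3 y hy.1
    omega
  · intro x hx
    obtain ⟨y, hy, rfl⟩ := List.mem_map.1 hx
    simp only [List.mem_filter, decide_eq_true_eq] at hy
    rw [hF.lt_iff_lt hat (hqt y hy.1)]
    have := hqne y hy.1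
    omega

/-- Exactly one left-to-right minimum lies between two consecutive heights. -/
theorem lmin_filter_nextHeight {n h : ℕ} {t : List ℕ} (ht : IsPermWord n t)
    (hav : Avoids t) (hh : Height t h) (hlt : h < n) :
    lmin (t.filter (· ≤ nextHeight t h)) = lmin (t.filter (· ≤ h)) + 1 := by
  obtain ⟨g, p, q, he, h1, h2, h3, h4, h5, h6⟩ :=
    nextHeight_aux ht hav hh (height_length ht) hlt le_rfl
  rw [nextHeight_eq h5 h1 h6]
  have hp : ∀ k ≤ g, p.filter (· ≤ k) = [] := by
    intro k hk
    rw [List.filter_eq_nil_iff]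
    intro x hx
    have := h3 x hx
    simp; omega
  rw [he, List.filter_append, List.filter_append, hp g le_rfl, hp h h1.le, List.nil_append,
    List.nil_append, List.filter_cons_of_pos (by simpa using h1), List.filter_cons_of_neg (by simp),
    ← List.singleton_append, lmin_append, lmin_singleton, List.filter_filter, Nat.add_comm]
  congr 2
  apply List.filter_congr
  intro x _
  rw [Bool.eq_iff_iff]
  simp [Prec]
  omega

end Avoider

namespace Avoider

/-! ### Permutations `σ n τ` in terms of heights -/

/-- Heights of `p` letters above `q` letters: `e j` is the number of letters of `τ` below the `j`th
smallest letter of `σ`. -/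
structure IsHeightFun (p q : ℕ) (e : ℕ → ℕ) : Prop where
  mono : ∀ i j, 1 ≤ i → i ≤ j → j ≤ p → e i ≤ e j
  le : ∀ j, 1 ≤ j → j ≤ p → e j ≤ q

/-- The value of the `j`th smallest letter of `σ`. -/
def leftVal (e : ℕ → ℕ) (j : ℕ) : ℕ := j + e j

/-- The value of the `y`th smallest letter of `τ`. -/
def rightVal (p : ℕ) (e : ℕ → ℕ) (y : ℕ) : ℕ := y + ((Finset.Icc 1 p).filter (fun j => e j < y)).card

/-- The permutation `σ n τ` such that `σ` and `τ` are order-isomorphic to `s` and `t`, with the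
heights `e`. -/
def merge (e : ℕ → ℕ) (s t : List ℕ) : List ℕ :=
  s.map (leftVal e) ++ (s.length + t.length + 1) :: t.map (rightVal s.length e)

namespace IsHeightFun

variable {p q : ℕ} {e : ℕ → ℕ}

theorem leftVal_lt_leftVal (h : IsHeightFun p q e) {i j : ℕ} (hi : 1 ≤ i) (hij : i < j)
    (hj : j ≤ p) : leftVal e i < leftVal e j := by
  have := h.mono i j hi hij.le hj
  simp only [leftVal]; omega

theorem leftVal_lt_rightVal (h : IsHeightFun p q e) {j y : ℕ} (hj : 1 ≤ j) (hjp : j ≤ p)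
    (hy : e j < y) : leftVal e j < rightVal p e y := by
  have : (Finset.Icc 1 j).card ≤ ((Finset.Icc 1 p).filter (fun j => e j < y)).card := by
    apply Finset.card_le_card
    intro i hi
    simp only [Finset.mem_Icc, Finset.mem_filter] at hi ⊢
    have := h.mono i j hi.1 hi.2 hjp
    omega
  simp only [Nat.card_Icc] at this
  simp only [leftVal, rightVal]; omega

theorem rightVal_lt_leftVal (h : IsHeightFun p q e) {j y : ℕ} (hj : 1 ≤ j)
    (hy : y ≤ e j) : rightVal p e y < leftVal e j := by
  have : ((Finset.Icc 1 p).filter (fun j => e j < y)).card ≤ (Finset.Icc 1 (j - 1)).card := by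
    apply Finset.card_le_card
    intro i hi
    simp only [Finset.mem_Icc, Finset.mem_filter] at hi ⊢
    by_contra hc
    have := h.mono j i hj (by omega) hi.1.2
    omega
  simp only [Nat.card_Icc] at this
  simp only [leftVal, rightVal]; omega

theorem leftVal_lt_rightVal_iff (h : IsHeightFun p q e) {j y : ℕ} (hj : 1 ≤ j) (hjp : j ≤ p) :
    leftVal e j < rightVal p e y ↔ e j < y := by
  refine ⟨fun hlt => ?_, h.leftVal_lt_rightVal hj hjp⟩
  by_contra hy
  have := h.rightVal_lt_leftVal hj (not_lt.1 hy)
  omega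

theorem rightVal_lt_leftVal_iff (h : IsHeightFun p q e) {j y : ℕ} (hj : 1 ≤ j) (hjp : j ≤ p) :
    rightVal p e y < leftVal e j ↔ y ≤ e j := by
  refine ⟨fun hlt => ?_, h.rightVal_lt_leftVal hj⟩
  by_contra hy
  have := h.leftVal_lt_rightVal hj hjp (not_le.1 hy)
  omega

end IsHeightFun

theorem rightVal_strictMono (p : ℕ) (e : ℕ → ℕ) : StrictMono (rightVal p e) := by
  intro x y hxy
  have : ((Finset.Icc 1 p).filter (fun j => e j < x)).card ≤
      ((Finset.Icc 1 p).filter (fun j => e j < y)).card := by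
    apply Finset.card_le_card
    intro i hi
    simp only [Finset.mem_filter] at hi ⊢
    exact ⟨hi.1, by omega⟩
  simp only [rightVal]; omega

theorem le_rightVal_le (p : ℕ) (e : ℕ → ℕ) (y : ℕ) : y ≤ rightVal p e y ∧ rightVal p e y ≤ y + p := by
  have := Finset.card_filter_le (Finset.Icc 1 p) (fun j => e j < y)
  simp only [Nat.card_Icc] at this
  simp only [rightVal]; omega

/-- `s`, `t` are permutations and `e` gives possible heights of the letters of `s`. -/
structure IsMergeData (e : ℕ → ℕ) (s t : List ℕ) : Prop where
  left : IsPermWord s.length s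
  right : IsPermWord t.length t
  heights : IsHeightFun s.length t.length e

namespace IsMergeData

variable {e : ℕ → ℕ} {s t : List ℕ}

theorem strictMonoOn (h : IsMergeData e s t) : StrictMonoOn (leftVal e) {x | x ∈ s} :=
  fun _ hx _ hy hxy => h.heights.leftVal_lt_leftVal (h.left.mem_iff.1 hx).1 hxy (h.left.mem_iff.1 hy).2

theorem leftVal_lt_iff (h : IsMergeData e s t) {j y : ℕ} (hj : j ∈ s) :
    leftVal e j < rightVal s.length e y ↔ e j < y :=
  have := h.left.mem_iff.1 hj
  h.heights.leftVal_lt_rightVal_iff this.1 this.2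

theorem rightVal_lt_iff (h : IsMergeData e s t) {j y : ℕ} (hj : j ∈ s) :
    rightVal s.length e y < leftVal e j ↔ y ≤ e j :=
  have := h.left.mem_iff.1 hj
  h.heights.rightVal_lt_leftVal_iff this.1 this.2

theorem height_le (h : IsMergeData e s t) {j : ℕ} (hj : j ∈ s) : e j ≤ t.length :=
  have := h.left.mem_iff.1 hj
  h.heights.le j this.1 this.2

theorem left_lt (h : IsMergeData e s t) :
    ∀ x ∈ s.map (leftVal e), x < s.length + t.length + 1 := by
  intro x hx
  obtain ⟨j, hj, rfl⟩ := List.mem_map.1 hx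
  have := h.left.mem_iff.1 hj
  have := h.height_le hj
  simp only [leftVal]; omega

theorem right_lt (h : IsMergeData e s t) :
    ∀ x ∈ t.map (rightVal s.length e), x < s.length + t.length + 1 := by
  intro x hx
  obtain ⟨y, hy, rfl⟩ := List.mem_map.1 hx
  have := h.right.mem_iff.1 hy
  have := le_rightVal_le s.length e y
  omega

theorem disjoint (h : IsMergeData e s t) :
    ∀ x ∈ s.map (leftVal e), x ∉ t.map (rightVal s.length e) := by
  intro x hx hx'
  obtain ⟨j, hj, rfl⟩ := List.mem_map.1 hx
  obtain ⟨y, hy, he⟩ := List.mem_map.1 hx'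
  have h1 := h.leftVal_lt_iff (y := y) hj
  have h2 := h.rightVal_lt_iff (y := y) hj
  omega

theorem isPermWord (h : IsMergeData e s t) :
    IsPermWord (s.length + t.length + 1) (merge e s t) := by
  rw [isPermWord_iff]
  refine ⟨?_, by simp [merge]; omega, ?_⟩
  · rw [merge, List.nodup_append', List.nodup_cons]
    refine ⟨h.left.nodup.map_on (fun x hx y hy he => h.strictMonoOn.injOn hx hy he),
      ⟨fun hm => ?_, h.right.nodup.map (rightVal_strictMono _ _).injective⟩, ?_⟩
    · have := h.right_lt _ hm; omega
    · intro x hx hx'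
      rcases List.mem_cons.1 hx' with rfl | hx'
      · have := h.left_lt _ hx; omega
      · exact h.disjoint x hx hx'
  · intro x hx
    simp only [merge, List.mem_append, List.mem_cons] at hx
    rcases hx with hx | rfl | hx
    · have := h.left_lt x hx
      obtain ⟨j, hj, rfl⟩ := List.mem_map.1 hx
      have := h.left.mem_iff.1 hj
      simp only [leftVal] at *; omega
    · omega
    · have := h.right_lt x hx
      obtain ⟨y, hy, rfl⟩ := List.mem_map.1 hx
      have := h.right.mem_iff.1 hy
      have := le_rightVal_le s.length e y
      omega

theorem mem_left_or_right (h : IsMergeData e s t) {x : ℕ} (h1 : 1 ≤ x)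
    (h2 : x ≤ s.length + t.length) :
    x ∈ s.map (leftVal e) ∨ x ∈ t.map (rightVal s.length e) := by
  have := h.isPermWord.mem_iff.2 ⟨h1, by omega⟩
  simp only [merge, List.mem_append, List.mem_cons] at this
  rcases this with h | h | h
  · exact Or.inl h
  · omega
  · exact Or.inr h

theorem sdiff_left (h : IsMergeData e s t) :
    Finset.Icc 1 (s.length + t.length) \ (s.map (leftVal e)).toFinset =
      (t.map (rightVal s.length e)).toFinset := by
  ext x
  rw [Finset.mem_sdiff, Finset.mem_Icc, List.mem_toFinset, List.mem_toFinset]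
  constructor
  · rintro ⟨⟨h1, h2⟩, h3⟩
    exact (h.mem_left_or_right h1 h2).resolve_left h3
  · intro hx
    have := h.right_lt x hx
    have := h.isPermWord.mem_iff (x := x) |>.1 (by rw [merge]; simp only [List.mem_append, List.mem_cons]; tauto)
    exact ⟨by omega, fun hx' => h.disjoint x hx' hx⟩

end IsMergeData

/-- Strictly increasing integers grow by at least one per step, so F(j) − j increases weakly. -/
theorem IsHeightFun.of_strictMonoOn {p q : ℕ} {F : ℕ → ℕ}
    (hF : ∀ i j, 1 ≤ i → i < j → j ≤ p → F i < F j) (h1 : ∀ j, 1 ≤ j → j ≤ p → 1 ≤ F j)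
    (h2 : ∀ j, 1 ≤ j → j ≤ p → F j ≤ p + q) :
    IsHeightFun p q (fun j => F j - j) ∧ ∀ j, 1 ≤ j → j ≤ p → leftVal (fun j => F j - j) j = F j := by
  have key : ∀ i j, 1 ≤ i → i ≤ j → j ≤ p → F i + (j - i) ≤ F j := by
    intro i j hi hij
    induction j, hij using Nat.le_induction with
    | base => simp
    | succ j hij ih =>
      intro hj
      have := ih (by omega)
      have := hF j (j + 1) (by omega) (by omega) hj
      omega
  have hge : ∀ j, 1 ≤ j → j ≤ p → j ≤ F j := by
    intro j hj hjp
    have := key 1 j le_rfl hj hjp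
    have := h1 1 le_rfl (by omega)
    omega
  refine ⟨⟨?_, ?_⟩, ?_⟩
  · intro i j hi hij hj
    have := key i j hi hij hj
    omega
  · intro j hj hjp
    have := key j p hj hjp le_rfl
    have := h2 p (by omega) le_rfl
    omega
  · intro j hj hjp
    have := hge j hj hjp
    simp only [leftVal]; omega

theorem exists_merge {n : ℕ} {σ τ : List ℕ} (h : IsPermWord n (σ ++ n :: τ)) :
    ∃ e s t, IsMergeData e s t ∧ s.length + t.length + 1 = n ∧ σ = s.map (leftVal e) ∧
      τ = t.map (rightVal s.length e) := by
  have hn := h.nodup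
  have hlen := h.length
  rw [List.nodup_append', List.nodup_cons] at hn
  obtain ⟨hσ, ⟨hnτ, hτ⟩, hd⟩ := hn
  obtain ⟨F, hs, hF, hσF⟩ := exists_eq_map_st hσ
  obtain ⟨G, ht, hG, hτG⟩ := exists_eq_map_st hτ
  set s := st σ with hs_def
  set t := st τ with ht_def
  have hsl : s.length = σ.length := hs.length
  have htl : t.length = τ.length := ht.length
  have hln : s.length + t.length + 1 = n := by
    simp only [List.length_append, List.length_cons] at hlen; omega
  have hs' : ∀ j, 1 ≤ j → j ≤ s.length → j ∈ s := fun j h1 h2 => hs.mem_iff.2 ⟨h1, by omega⟩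
  have hmem : ∀ j, 1 ≤ j → j ≤ s.length → F j ∈ σ := fun j h1 h2 => by
    rw [hσF]; exact List.mem_map_of_mem (hs' j h1 h2)
  obtain ⟨hf, hv⟩ := IsHeightFun.of_strictMonoOn (p := s.length) (q := t.length) (F := F)
    (fun i j hi hij hj => hF (hs' i hi (by omega)) (hs' j (by omega) hj) hij)
    (fun j h1 h2 => (h.mem_iff.1 (List.mem_append_left _ (hmem j h1 h2))).1)
    (fun j h1 h2 => by
      have h3 := (h.mem_iff.1 (List.mem_append_left _ (hmem j h1 h2))).2
      have h4 : F j ≠ n := fun heq => hd (hmem j h1 h2) (by simp [heq])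
      omega)
  set e : ℕ → ℕ := fun j => F j - j with he
  have hD : IsMergeData e s t := ⟨by rwa [hsl], by rwa [htl], hf⟩
  have hσ' : σ = s.map (leftVal e) := by
    conv_lhs => rw [hσF]
    apply List.map_congr_left
    intro j hj
    have := hs.mem_iff.1 hj
    rw [hv j this.1 (by omega)]
  refine ⟨e, s, t, hD, hln, hσ', ?_⟩
  -- The heights are read off from σ alone. That τ is the predicted word follows because both words
  -- complete σ n to a permutation and have the pattern t.
  have hperm : (σ ++ n :: τ).Perm (σ ++ n :: t.map (rightVal s.length e)) := by
    refine List.Perm.trans h (List.Perm.symm ?_)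
    have := hD.isPermWord
    rwa [merge, hln, ← hσ'] at this
  rw [List.perm_append_left_iff, List.perm_cons] at hperm
  have h1 := unst_map ht hG
  have h2 := unst_map ht (F := rightVal s.length e) ((rightVal_strictMono _ _).strictMonoOn _)
  rw [← hτG, List.toFinset_eq_of_perm _ _ hperm] at h1
  exact h1.symm.trans h2

theorem merge_inj {e e' : ℕ → ℕ} {s s' t t' : List ℕ} (h : IsMergeData e s t)
    (h' : IsMergeData e' s' t') (heq : merge e s t = merge e' s' t') :
    s = s' ∧ t = t' ∧ ∀ j ∈ s, e j = e' j := by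
  have hN : s.length + t.length + 1 = s'.length + t'.length + 1 := by
    have := congrArg List.length heq
    simp only [merge, List.length_append, List.length_cons, List.length_map] at this
    omega
  rw [merge, merge, ← hN] at heq
  have hl := h.left_lt
  have hl' := h'.left_lt
  rw [← hN] at hl'
  have htw : ∀ (u v : List ℕ) (N : ℕ), (∀ x ∈ u, x < N) →
      (u ++ N :: v).takeWhile (· ≠ N) = u := by
    intro u v N hu
    rw [List.takeWhile_append_of_pos, List.takeWhile_cons_of_neg (by simp), List.append_nil]
    intro x hx
    simpa using (hu x hx).ne
  have h1 : s.map (leftVal e) = s'.map (leftVal e') := by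
    rw [← htw _ (t.map (rightVal s.length e)) _ hl, heq, htw _ _ _ hl']
  have h2 : t.map (rightVal s.length e) = t'.map (rightVal s'.length e') := by
    rw [h1] at heq
    simpa using heq
  have hs : s = s' := by
    rw [← st_map h.left h.strictMonoOn, h1, st_map h'.left h'.strictMonoOn]
  have ht : t = t' := by
    rw [← st_map h.right ((rightVal_strictMono s.length e).strictMonoOn _), h2,
      st_map h'.right ((rightVal_strictMono _ _).strictMonoOn _)]
  refine ⟨hs, ht, ?_⟩
  subst hs
  intro j hj
  rw [List.map_inj_left] at h1
  have := h1 j hj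
  simp only [leftVal] at this
  omega

/-- The conditions for `merge e s t` to be an avoider. -/
structure IsAvoiderData (e : ℕ → ℕ) (s t : List ℕ) : Prop extends IsMergeData e s t where
  avoids_left : Avoids s
  avoids_right : Avoids t
  eq_of_inversion : ∀ c a, [c, a].Sublist s → a < c → e a = e c
  height : ∀ j ∈ s, Height t (e j)

theorem IsMergeData.height_iff {e : ℕ → ℕ} {s t : List ℕ} (h : IsMergeData e s t) {j : ℕ}
    (hj : j ∈ s) : Height (t.map (rightVal s.length e)) (leftVal e j) ↔ Height t (e j) := by
  apply height_map ((rightVal_strictMono _ _).strictMonoOn _)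
  intro z _
  rw [← not_lt, h.leftVal_lt_iff hj, not_lt]

theorem IsMergeData.avoids_iff {e : ℕ → ℕ} {s t : List ℕ} (h : IsMergeData e s t) :
    Avoids (merge e s t) ↔ IsAvoiderData e s t := by
  rw [merge, avoids_append_top h.left_lt h.right_lt h.disjoint, avoids_map h.strictMonoOn,
    avoids_map ((rightVal_strictMono _ _).strictMonoOn _)]
  constructor
  · rintro ⟨h1, h2, h3, h4⟩
    refine ⟨h, h1, h2, ?_, fun j hj => (h.height_iff hj).1 (h4 _ (List.mem_map_of_mem hj))⟩
    intro c a hs hac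
    have hc : c ∈ s := hs.subset (by simp)
    have ha : a ∈ s := hs.subset (by simp)
    have hle := h.heights.mono a c (h.left.mem_iff.1 ha).1 hac.le (h.left.mem_iff.1 hc).2
    by_contra hne
    -- The letter of rank e(c) in τ is the largest one below the letter of σ of rank c. If e(a) <
    -- e(c), it separates the two letters of the inversion, and n completes 3-1-4-2.
    have hy : e c ∈ t := h.right.mem_iff.2 ⟨by omega, h.height_le hc⟩
    exact h3 (leftVal e c) (leftVal e a) (rightVal s.length e (e c)) (hs.map (leftVal e))
      (List.mem_map_of_mem hy) ((h.leftVal_lt_iff ha).2 (by omega))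
      ((h.rightVal_lt_iff hc).2 le_rfl)
  · rintro ⟨-, h1, h2, h3, h4⟩
    refine ⟨h1, h2, ?_, ?_⟩
    · intro c a b hs hb hab hbc
      rw [List.sublist_map_iff] at hs
      obtain ⟨l, hl, he⟩ := hs
      obtain ⟨c, l, rfl, rfl, he1⟩ := List.map_eq_cons_iff.1 he.symm
      obtain ⟨a, l, rfl, rfl, he2⟩ := List.map_eq_cons_iff.1 he1
      obtain rfl := List.map_eq_nil_iff.1 he2
      obtain ⟨y, hy, rfl⟩ := List.mem_map.1 hb
      have hc : c ∈ s := hl.subset (by simp)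
      have ha : a ∈ s := hl.subset (by simp)
      have h5 := (h.strictMonoOn.lt_iff_lt ha hc).1 (hab.trans hbc)
      have h6 := h3 c a hl h5
      rw [h.leftVal_lt_iff ha] at hab
      rw [h.rightVal_lt_iff hc] at hbc
      omega
    · intro x hx
      obtain ⟨j, hj, rfl⟩ := List.mem_map.1 hx
      exact (h.height_iff hj).2 (h4 j hj)

namespace IsAvoiderData

variable {e : ℕ → ℕ} {s t : List ℕ}

theorem mem_avoiders (h : IsAvoiderData e s t) :
    merge e s t ∈ avoiders (s.length + t.length + 1) :=
  ⟨h.isPermWord, h.toIsMergeData.avoids_iff.2 h⟩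

/-- The heights increase weakly along the word `s`. -/
theorem pairwise_le (h : IsAvoiderData e s t) : s.Pairwise (fun a b => e a ≤ e b) := by
  rw [List.pairwise_iff_forall_sublist]
  intro a b hs
  have ha := h.left.mem_iff.1 (hs.subset (show a ∈ [a, b] by simp))
  have hb := h.left.mem_iff.1 (hs.subset (show b ∈ [a, b] by simp))
  by_cases hab : a ≤ b
  · exact h.heights.mono a b ha.1 hab hb.2
  · exact (h.eq_of_inversion a b hs (by omega)).ge

/-- Replacing the heights by a monotone function of them. -/
theorem comp_heights (h : IsAvoiderData e s t) {e' : ℕ → ℕ}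
    (h1 : ∀ i ∈ s, ∀ j ∈ s, e i = e j → e' i = e' j) (h2 : ∀ i ∈ s, ∀ j ∈ s, e i < e j → e' i ≤ e' j)
    (h3 : ∀ j ∈ s, e' j ≤ t.length) (h4 : ∀ j ∈ s, Height t (e' j)) : IsAvoiderData e' s t := by
  refine ⟨⟨h.left, h.right, ⟨?_, ?_⟩⟩, h.avoids_left, h.avoids_right, ?_, h4⟩
  · intro i j hi hij hj
    have hi' : i ∈ s := h.left.mem_iff.2 ⟨hi, by omega⟩
    have hj' : j ∈ s := h.left.mem_iff.2 ⟨by omega, hj⟩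
    rcases (h.heights.mono i j hi hij hj).eq_or_lt with he | he
    · exact (h1 i hi' j hj' he).le
    · exact h2 i hi' j hj' he
  · intro j hj hj'
    exact h3 j (h.left.mem_iff.2 ⟨hj, hj'⟩)
  · intro c a hs hac
    exact h1 a (hs.subset (by simp)) c (hs.subset (by simp)) (h.eq_of_inversion c a hs hac)

theorem next (h : IsAvoiderData e s t) (hlt : ∀ j ∈ s, e j < t.length) :
    IsAvoiderData (fun j => nextHeight t (e j)) s t := by
  have hsp : ∀ j ∈ s, _ := fun j hj => nextHeight_spec (height_length h.right) (hlt j hj)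
  refine h.comp_heights (fun i _ j _ he => by simp only [he]) ?_ (fun j hj => (hsp j hj).2.2)
    (fun j hj => (hsp j hj).1)
  intro i hi j hj he
  exact (nextHeight_spec (h.height j hj) he).2.2.trans (hsp j hj).2.1.le

end IsAvoiderData

theorem exists_avoiderData {n : ℕ} {σ τ : List ℕ} (h : σ ++ n :: τ ∈ avoiders n) :
    ∃ e s t, IsAvoiderData e s t ∧ s.length + t.length + 1 = n ∧ σ = s.map (leftVal e) ∧
      τ = t.map (rightVal s.length e) := by
  obtain ⟨e, s, t, hD, hn, h1, h2⟩ := exists_merge h.1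
  refine ⟨e, s, t, hD.avoids_iff.1 ?_, hn, h1, h2⟩
  rw [merge, ← h1, ← h2, hn]
  exact h.2

end Avoider

namespace Avoider

/-! ### The map `ψ` -/

/-- Stated for arbitrary blocks of constant, strictly increasing heights η, so that induction on the
list of blocks applies. The term x − η(x) is the rank of x in σ, and only the height part of x is
moved. -/
theorem leftLetters_eq {n : ℕ} {t : List ℕ} {T η : ℕ → ℕ} (ht : IsPermWord n t) (hav : Avoids t)
    (hT : StrictMonoOn T {x | x ∈ t}) (bs : List (List ℕ)) (hne : ∀ b ∈ bs, b ≠ [])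
    (hconst : ∀ b ∈ bs, ∀ x ∈ b, ∀ y ∈ b, η x = η y)
    (hchain : bs.IsChain (fun b b' => ∀ x ∈ b, ∀ y ∈ b', η x < η y))
    (hbs : ∀ b ∈ bs, ∀ x ∈ b, η x ≤ x ∧ η x < n ∧ Height t (η x) ∧
      ∀ y ∈ t, (x < T y ↔ η x < y) ∧ (T y < x ↔ y ≤ η x)) :
    leftLetters (t.map T) bs = bs.flatten.map (fun x => x - η x + nextHeight t (η x)) := by
  induction bs with
  | nil => rfl
  | cons b bs ih =>
    rw [leftLetters, List.flatten_cons, List.map_append,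
      ih (fun b hb => hne b (by simp [hb])) (fun b hb => hconst b (by simp [hb]))
        hchain.tail (fun b hb => hbs b (by simp [hb]))]
    congr 1
    obtain ⟨x₀, hx₀⟩ := List.exists_mem_of_ne_nil b (hne b (by simp))
    obtain ⟨-, hlt, hh, hy⟩ := hbs b (by simp) x₀ hx₀
    -- The upper limit of the letters of wᵢ: the height of the next block or, for the last block, n,
    -- since an empty block imposes no bound.
    obtain ⟨h', hh', hlt', hle, hd⟩ : ∃ h', Height t h' ∧ η x₀ < h' ∧ h' ≤ n ∧
        ∀ y ∈ t, Prec [T y] (bs.headD []) ↔ y ≤ h' := by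
      rcases bs with _ | ⟨b', bs⟩
      · refine ⟨n, height_length ht, hlt, le_rfl, fun y hy => ?_⟩
        simp [Prec, (ht.mem_iff.1 hy).2]
      · obtain ⟨x₁, hx₁⟩ := List.exists_mem_of_ne_nil b' (hne b' (by simp))
        have h1 := hbs b' (by simp) x₁ hx₁
        rw [List.isChain_cons_cons] at hchain
        refine ⟨η x₁, h1.2.2.1, hchain.1 x₀ hx₀ x₁ hx₁, h1.2.1.le, fun y hy => ?_⟩
        simp only [Prec, List.mem_singleton, forall_eq, List.headD_cons]
        constructor
        · exact fun hp => (h1.2.2.2 y hy).2.1 (hp x₁ hx₁)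
        · intro hle x hx
          rw [hconst b' (by simp) x₁ hx₁ x hx] at hle
          exact ((hbs b' (by simp) x hx).2.2.2 y hy).2.2 hle
    have hfil : (t.map T).filter (fun y => Prec b [y] ∧ Prec [y] (bs.headD [])) =
        (t.filter (fun y => η x₀ < y ∧ y ≤ h')).map T := by
      rw [List.filter_map]
      congr 1
      apply List.filter_congr
      intro y hyt
      simp only [Function.comp, decide_eq_decide]
      rw [hd y hyt]
      refine and_congr_left fun _ => ?_
      simp only [Prec, List.mem_singleton, forall_eq]
      constructor
      · exact fun hp => (hy y hyt).1.1 (hp x₀ hx₀)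
      · intro hle x hx
        rw [hconst b (by simp) x₀ hx₀ x hx] at hle
        exact ((hbs b (by simp) x hx).2.2.2 y hyt).1.2 hle
    have hm := mStat_eq_nextHeight ht hav hT hh hh' hlt' hle
    rw [hfil]
    apply List.map_congr_left
    intro x hx
    have := (hbs b (by simp) x hx).1
    rw [hconst b (by simp) x hx x₀ hx₀] at this ⊢
    omega

theorem isChain_lt_of_getLast_head {η : ℕ → ℕ} (bs : List (List ℕ))
    (hchain : bs.IsChain (fun a b => ∃ (ha : a ≠ []) (hb : b ≠ []), η (a.getLast ha) ≠ η (b.head hb)))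
    (hconst : ∀ b ∈ bs, ∀ x ∈ b, ∀ y ∈ b, η x = η y)
    (hp : bs.flatten.Pairwise (fun x y => η x ≤ η y)) :
    bs.IsChain (fun b b' => ∀ x ∈ b, ∀ y ∈ b', η x < η y) := by
  induction bs with
  | nil => simp
  | cons b bs ih =>
    rw [List.flatten_cons, List.pairwise_append] at hp
    have ih' := ih hchain.tail (fun b hb => hconst b (by simp [hb])) hp.2.1
    rcases bs with _ | ⟨b', bs⟩
    · simp
    · rw [List.isChain_cons_cons] at hchain ⊢
      refine ⟨?_, ih'⟩
      obtain ⟨ha, hb, hne⟩ := hchain.1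
      intro x hx y hy
      rw [hconst b (by simp) x hx _ (List.getLast_mem ha),
        hconst b' (by simp) y hy _ (List.head_mem hb)]
      refine lt_of_le_of_ne ?_ hne
      exact hp.2.2 _ (List.getLast_mem ha) _ (by simp)

theorem eq_of_isChain_eq {η : ℕ → ℕ} {b : List ℕ} (h : b.IsChain (fun x y => η x = η y)) :
    ∀ x ∈ b, ∀ y ∈ b, η x = η y := by
  induction b with
  | nil => simp
  | cons a b ih =>
    have ih' := ih h.tail
    have ha : ∀ x ∈ b, η a = η x := by
      rcases b with _ | ⟨c, b⟩
      · simp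
      · rw [List.isChain_cons_cons] at h
        exact fun x hx => h.1.trans (ih' c (by simp) x hx)
    intro x hx y hy
    rcases List.mem_cons.1 hx with rfl | hx' <;> rcases List.mem_cons.1 hy with rfl | hy'
    · rfl
    · exact ha y hy'
    · exact (ha x hx').symm
    · exact ih' x hx' y hy'

namespace IsAvoiderData

variable {e : ℕ → ℕ} {s t : List ℕ}

theorem countP_lt_leftVal (h : IsMergeData e s t) {j : ℕ} (hj : j ∈ s) :
    (t.map (rightVal s.length e)).countP (· < leftVal e j) = e j := by
  rw [List.countP_map]
  conv_rhs => rw [← h.right.countP_le (h.height_le hj)]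
  apply List.countP_congr
  intro y _
  simpa using h.rightVal_lt_iff hj

/-- No letter of τ separates two letters of σ exactly when they have the same height. So the
intervals of σ are its maximal runs of constant height, and their heights increase by `pairwise_le`.
-/
theorem leftLetters_intervals (h : IsAvoiderData e s t) (hlt : ∀ j ∈ s, e j < t.length) :
    leftLetters (t.map (rightVal s.length e)) (intervals (s.map (leftVal e))) =
      s.map (leftVal fun j => nextHeight t (e j)) := by
  -- The intervals are formed from the values of the letters, so heights are needed as a function of
  -- values instead of ranks.
  obtain ⟨η, hηj⟩ : ∃ η : ℕ → ℕ, ∀ j ∈ s, η (leftVal e j) = e j :=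
    ⟨fun x => (t.map (rightVal s.length e)).countP (· < x), fun _ hj =>
      countP_lt_leftVal h.toIsMergeData hj⟩
  have hη_iff : ∀ a ∈ s.map (leftVal e), ∀ b ∈ s.map (leftVal e), a ≤ b →
      ((∀ v ∈ Finset.Icc a b, v ∈ s.map (leftVal e)) ↔ η a = η b) := by
    intro a ha b hb hab
    have hb1 := h.left_lt b hb
    have ha1 := (h.isPermWord.mem_iff (x := a)).1 (by rw [merge]; exact List.mem_append_left _ ha)
    obtain ⟨i, hi, rfl⟩ := List.mem_map.1 ha
    obtain ⟨j, hj, rfl⟩ := List.mem_map.1 hb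
    have hij : i ≤ j := (h.strictMonoOn.le_iff_le hi hj).1 hab
    rw [hηj i hi, hηj j hj]
    have hmono := h.heights.mono i j (h.left.mem_iff.1 hi).1 hij (h.left.mem_iff.1 hj).2
    constructor
    · intro hall
      by_contra hne
      have hy : e j ∈ t := h.right.mem_iff.2 ⟨by omega, h.height_le hj⟩
      have h1 := (h.leftVal_lt_iff hi).2 (show e i < e j by omega)
      have h2 := (h.rightVal_lt_iff hj).2 (le_refl (e j))
      exact h.disjoint _ (hall (rightVal s.length e (e j)) (Finset.mem_Icc.2 ⟨h1.le, h2.le⟩))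
        (List.mem_map_of_mem hy)
    · intro heq v hv
      rw [Finset.mem_Icc] at hv
      refine (h.mem_left_or_right (by omega) (by omega)).resolve_right fun hv' => ?_
      have hva : leftVal e i ≠ v := by rintro rfl; exact h.disjoint _ ha hv'
      have hvb : leftVal e j ≠ v := by rintro rfl; exact h.disjoint _ hb hv'
      obtain ⟨y, hy, rfl⟩ := List.mem_map.1 hv'
      have h1 := (h.leftVal_lt_iff hi).1 (show leftVal e i < rightVal s.length e y by omega)
      have h2 := (h.rightVal_lt_iff hj).1 (show rightVal s.length e y < leftVal e j by omega)
      omega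
  have hR : ∀ a ∈ s.map (leftVal e), ∀ b ∈ s.map (leftVal e),
      ((∀ v ∈ Finset.Icc (min a b) (max a b), v ∈ s.map (leftVal e)) ↔ η a = η b) := by
    intro a ha b hb
    rcases le_total a b with hab | hab
    · rw [min_eq_left hab, max_eq_right hab]; exact hη_iff a ha b hb hab
    · rw [min_eq_right hab, max_eq_left hab, eq_comm]; exact hη_iff b hb a ha hab
  have hfl : (intervals (s.map (leftVal e))).flatten = s.map (leftVal e) :=
    List.flatten_splitBy _ _
  have hmem : ∀ b ∈ intervals (s.map (leftVal e)), ∀ x ∈ b, x ∈ s.map (leftVal e) := by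
    intro b hb x hx
    rw [← hfl, List.mem_flatten]
    exact ⟨b, hb, hx⟩
  have hconst : ∀ b ∈ intervals (s.map (leftVal e)), ∀ x ∈ b, ∀ y ∈ b, η x = η y := by
    intro b hb
    apply eq_of_isChain_eq
    have h1 := List.isChain_of_mem_splitBy hb
    refine List.IsChain.imp_of_mem_imp ?_ h1
    intro x y hx hy hxy
    exact (hR x (hmem b hb x hx) y (hmem b hb y hy)).1 (of_decide_eq_true hxy)
  have hchain := List.isChain_getLast_head_splitBy
    (fun a b : ℕ => decide (∀ v ∈ Finset.Icc (min a b) (max a b), v ∈ s.map (leftVal e)))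
    (s.map (leftVal e))
  have hpw : (intervals (s.map (leftVal e))).flatten.Pairwise (fun x y => η x ≤ η y) := by
    rw [hfl, List.pairwise_map]
    refine List.Pairwise.imp_of_mem ?_ h.pairwise_le
    intro a b ha hb hab
    rwa [hηj a ha, hηj b hb]
  have key := leftLetters_eq (η := η) h.right h.avoids_right
    ((rightVal_strictMono s.length e).strictMonoOn _) (intervals (s.map (leftVal e)))
    (fun b hb => List.ne_nil_of_mem_splitBy hb) hconst
    (isChain_lt_of_getLast_head _ ?_ hconst hpw) ?_
  · rw [key, hfl, List.map_map]
    apply List.map_congr_left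
    intro j hj
    simp only [Function.comp, hηj j hj]
    simp only [leftVal]; omega
  · refine List.IsChain.imp_of_mem_imp ?_ hchain
    rintro a b ha hb ⟨hane, hbne, hab⟩
    refine ⟨hane, hbne, fun heq => ?_⟩
    refine of_decide_eq_false hab ?_
    exact (hR _ (hmem a ha _ (List.getLast_mem hane)) _ (hmem b hb _ (List.head_mem hbne))).2 heq
  · intro b hb x hx
    obtain ⟨j, hj, rfl⟩ := List.mem_map.1 (hmem b hb x hx)
    rw [hηj j hj]
    exact ⟨by simp [leftVal], hlt j hj, h.height j hj, fun y _ =>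
      ⟨h.leftVal_lt_iff hj, h.rightVal_lt_iff hj⟩⟩

theorem psi_merge (h : IsAvoiderData e s t) (hlt : ∀ j ∈ s, e j < t.length) :
    psi (merge e s t) = merge (fun j => nextHeight t (e j)) s t := by
  have hlen : (merge e s t).length = s.length + t.length + 1 := h.isPermWord.length
  have hl : ∀ x ∈ s.map (leftVal e), decide (x ≠ s.length + t.length + 1) = true := by
    intro x hx
    simpa using (h.left_lt x hx).ne
  have h1 : (merge e s t).takeWhile (· ≠ s.length + t.length + 1) = s.map (leftVal e) := by
    rw [merge, List.takeWhile_append_of_pos hl, List.takeWhile_cons_of_neg (by simp),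
      List.append_nil]
  have h2 : (merge e s t).dropWhile (· ≠ s.length + t.length + 1) =
      (s.length + t.length + 1) :: t.map (rightVal s.length e) := by
    rw [merge, List.dropWhile_append_of_pos hl, List.dropWhile_cons_of_neg (by simp)]
  have hnx := (h.next hlt).toIsMergeData
  rw [psi, hlen, h1, h2, List.tail_cons, psiParts, h.leftLetters_intervals hlt]
  simp only [Nat.add_sub_cancel]
  rw [hnx.sdiff_left, st_map h.left h.strictMonoOn,
    st_map h.right ((rightVal_strictMono _ _).strictMonoOn _), unst_map h.left hnx.strictMonoOn,
    unst_map h.right ((rightVal_strictMono _ _).strictMonoOn _), merge]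

/-- The inverse of `ψ`. -/
theorem exists_prev (h : IsAvoiderData e s t) (hpos : ∀ j ∈ s, 0 < e j) :
    ∃ e', IsAvoiderData e' s t ∧ (∀ j ∈ s, e' j < t.length) ∧
      psi (merge e' s t) = merge e s t := by
  -- The hypotheses stand inside the existential so that the choice gives a total function; 0 is a
  -- dummy value. A function of the height alone respects equality of heights.
  have hex : ∀ g, ∃ k, Height t g → 0 < g → Height t k ∧ k < g ∧ nextHeight t k = g := by
    intro g
    by_cases hg : Height t g ∧ 0 < g
    · obtain ⟨k, hk⟩ := exists_nextHeight_eq h.right hg.1 hg.2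
      exact ⟨k, fun _ _ => hk⟩
    · exact ⟨0, fun h1 h2 => absurd ⟨h1, h2⟩ hg⟩
  choose prev hprev using hex
  have hpr : ∀ j ∈ s, _ := fun j hj => hprev (e j) (h.height j hj) (hpos j hj)
  have hlt : ∀ j ∈ s, prev (e j) < t.length := fun j hj =>
    (hpr j hj).2.1.trans_le (h.height_le hj)
  have hD : IsAvoiderData (fun j => prev (e j)) s t := by
    refine h.comp_heights (fun i _ j _ he => by simp only [he]) ?_ (fun j hj => (hlt j hj).le)
      (fun j hj => (hpr j hj).1)
    intro i hi j hj he
    by_contra hc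
    have := (nextHeight_spec (hpr i hi).1 (not_le.1 hc)).2.2
    rw [(hpr j hj).2.2] at this
    have := (hpr i hi).2.1
    omega
  refine ⟨_, hD, hlt, ?_⟩
  rw [hD.psi_merge hlt, merge, merge]
  have hnx := (hD.next hlt).toIsMergeData
  have heq : s.map (leftVal fun j => nextHeight t (prev (e j))) = s.map (leftVal e) := by
    apply List.map_congr_left
    intro j hj
    simp only [leftVal, (hpr j hj).2.2]
  -- The right-hand words have the same pattern t and, as complements of equal sets of left letters,
  -- the same letters.
  have h1 := unst_map h.right (F := rightVal s.length e) ((rightVal_strictMono _ _).strictMonoOn _)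
  have h2 := unst_map h.right (F := rightVal s.length fun j => nextHeight t (prev (e j)))
    ((rightVal_strictMono _ _).strictMonoOn _)
  rw [← hnx.sdiff_left, heq, h.sdiff_left, h1] at h2
  rw [heq, h2]

/-- Patterns and heights can be recovered from the image, and `nextHeight` is injective on heights
less than |t|: if h < k are heights, then the next height after h is at most k. -/
theorem psi_injective {e' : ℕ → ℕ} {s' t' : List ℕ} (h : IsAvoiderData e s t)
    (hlt : ∀ j ∈ s, e j < t.length) (h' : IsAvoiderData e' s' t')
    (hlt' : ∀ j ∈ s', e' j < t'.length) (heq : psi (merge e s t) = psi (merge e' s' t')) :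
    merge e s t = merge e' s' t' := by
  rw [h.psi_merge hlt, h'.psi_merge hlt'] at heq
  obtain ⟨rfl, rfl, hj⟩ := merge_inj (h.next hlt).toIsMergeData (h'.next hlt').toIsMergeData heq
  have hee : ∀ j ∈ s, e j = e' j := by
    intro j hjs
    have hn := hj j hjs
    by_contra hne
    rcases Nat.lt_or_gt_of_ne hne with hc | hc
    · have h1 := nextHeight_spec (h'.height j hjs) hc
      have h2 := nextHeight_spec (height_length h.right) (hlt' j hjs)
      omega
    · have h1 := nextHeight_spec (h.height j hjs) hc
      have h2 := nextHeight_spec (height_length h.right) (hlt j hjs)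
      omega
  have h3 : s.map (leftVal e) = s.map (leftVal e') := by
    apply List.map_congr_left
    intro j hj
    simp only [leftVal, hee j hj]
  have h1 := unst_map h.right (F := rightVal s.length e) ((rightVal_strictMono _ _).strictMonoOn _)
  have h2 := unst_map h.right (F := rightVal s.length e') ((rightVal_strictMono _ _).strictMonoOn _)
  rw [← h.sdiff_left, h3, h'.sdiff_left, h2] at h1
  rw [merge, merge, h3, h1]

/-! ### Indecomposability and statistics -/

/-- Heights increase weakly along s, so the letters of height 0 form a prefix of σ; if nonempty, it
splits off. Conversely, a letter of positive height has a smaller letter of τ to its right, so no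
cut is possible within or just after σ, and a cut after n fails because n is the largest letter. -/
theorem indecomposable_iff (h : IsAvoiderData e s t) (hs : s ≠ []) :
    Indecomposable (merge e s t) ↔ ∀ j ∈ s, 0 < e j := by
  constructor
  · intro hi
    by_contra hc
    push Not at hc
    obtain ⟨j, hj, hj0⟩ := hc
    set s₀ := s.takeWhile (fun j => e j = 0) with hs₀
    set s₁ := s.dropWhile (fun j => e j = 0) with hs₁
    have hss : s = s₀ ++ s₁ := (List.takeWhile_append_dropWhile).symm
    have hz : ∀ a ∈ s₀, e a = 0 := fun a ha => by
      have := List.mem_takeWhile_imp ha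
      simpa using this
    have hpos : ∀ b ∈ s₁, 0 < e b := by
      intro b hb
      have hpw := h.pairwise_le
      rw [hss, List.pairwise_append] at hpw
      cases hc : s₁ with
      | nil => rw [hc] at hb; simp at hb
      | cons c r =>
        have hc0 : ¬ e c = 0 := by
          have := List.head_dropWhile_not (fun j => decide (e j = 0)) (l := s) (by
            rw [← hs₁, hc]; simp)
          simp only [← hs₁, hc] at this
          exact of_decide_eq_false this
        rw [hc] at hpw hb
        rcases List.mem_cons.1 hb with rfl | hb
        · omega
        · have := (List.pairwise_cons.1 hpw.2.1).1 b hb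
          omega
    have hne : s₀ ≠ [] := by
      rintro h0
      rw [h0, List.nil_append] at hss
      rw [hss] at hj
      have := hpos j hj
      omega
    have := hi (s₀.map (leftVal e))
      (s₁.map (leftVal e) ++ (s.length + t.length + 1) :: t.map (rightVal s.length e)) (by
        rw [merge, ← List.append_assoc, ← List.map_append, ← hss]) ?_
    · simp [hne] at this
    intro x hx y hy
    obtain ⟨a, ha, rfl⟩ := List.mem_map.1 hx
    have has : a ∈ s := by rw [hss]; simp [ha]
    have ha' := h.left.mem_iff.1 has
    simp only [List.mem_append, List.mem_cons] at hy
    rcases hy with hy | rfl | hy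
    · obtain ⟨b, hb, rfl⟩ := List.mem_map.1 hy
      have hbs : b ∈ s := by rw [hss]; simp [hb]
      have hb' := h.left.mem_iff.1 hbs
      rw [h.strictMonoOn.lt_iff_lt has hbs]
      by_contra hba
      have := h.heights.mono b a hb'.1 (by omega) ha'.2
      have := hz a ha
      have := hpos b hb
      omega
    · exact h.left_lt _ (List.mem_map_of_mem has)
    · obtain ⟨z, hzt, rfl⟩ := List.mem_map.1 hy
      rw [h.leftVal_lt_iff has, hz a ha]
      exact (h.right.mem_iff.1 hzt).1
  · intro hpos α β he hp
    by_contra hc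
    push Not at hc
    rw [merge, List.append_eq_append_iff] at he
    obtain ⟨j₀, hj₀⟩ := List.exists_mem_of_ne_nil s hs
    rcases he with ⟨γ, rfl, hγ⟩ | ⟨γ, hγ, rfl⟩
    · rcases γ with _ | ⟨x, γ⟩
      · rw [List.nil_append] at hγ
        have hy : e j₀ ∈ t := h.right.mem_iff.2 ⟨hpos _ hj₀, h.height_le hj₀⟩
        have h1 := hp (leftVal e j₀) (by simpa using ⟨j₀, hj₀, rfl⟩) (rightVal s.length e (e j₀)) (by
          rw [← hγ]; exact List.mem_cons_of_mem _ (List.mem_map_of_mem hy))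
        have h2 := (h.rightVal_lt_iff hj₀).2 (le_refl (e j₀))
        omega
      · rw [List.cons_append, List.cons.injEq] at hγ
        obtain ⟨y, hy⟩ := List.exists_mem_of_ne_nil β hc.2
        have h1 := hp x (by simp) y hy
        have h2 := h.right_lt y (by rw [hγ.2]; simp [hy])
        omega
    · obtain ⟨x, hx⟩ := List.exists_mem_of_ne_nil α hc.1
      have hxs : x ∈ s.map (leftVal e) := by rw [hγ]; simp [hx]
      obtain ⟨j, hj, rfl⟩ := List.mem_map.1 hxs
      have hy : e j ∈ t := h.right.mem_iff.2 ⟨hpos _ hj, h.height_le hj⟩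
      have h1 := hp (leftVal e j) hx (rightVal s.length e (e j)) (by
        simp only [List.mem_append, List.mem_cons]
        exact Or.inr (Or.inr (List.mem_map_of_mem hy)))
      have h2 := (h.rightVal_lt_iff hj).2 (le_refl (e j))
      omega

end IsAvoiderData

theorem asc_append_top {u v : List ℕ} {N : ℕ} (hu : ∀ x ∈ u, x < N) (hv : ∀ x ∈ v, x < N)
    (hne : u ≠ []) : asc (u ++ N :: v) = asc u + asc v + 1 := by
  rcases List.eq_nil_or_concat' u with rfl | ⟨u, y, rfl⟩
  · exact absurd rfl hne
  rw [List.append_assoc, List.singleton_append, asc_append, if_pos (hu y (by simp))]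
  rcases v with _ | ⟨x, v⟩
  · simp
  · have := hv x (by simp)
    rw [asc_cons_cons, if_neg (by omega)]; omega

theorem des_cons_top {v : List ℕ} {N : ℕ} (hv : ∀ x ∈ v, x < N) :
    des (N :: v) = des v + if v = [] then 0 else 1 := by
  rcases v with _ | ⟨x, v⟩
  · simp
  · rw [des_cons_cons, if_pos (hv x (by simp))]; simp; omega

theorem asc_cons_top {v : List ℕ} {N : ℕ} (hv : ∀ x ∈ v, x < N) : asc (N :: v) = asc v := by
  rcases v with _ | ⟨x, v⟩
  · simp
  · have := hv x (by simp)
    rw [asc_cons_cons, if_neg (by omega), Nat.zero_add]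

theorem des_append_top {u v : List ℕ} {N : ℕ} (hu : ∀ x ∈ u, x < N) (hv : ∀ x ∈ v, x < N) :
    des (u ++ N :: v) = des u + des v + if v = [] then 0 else 1 := by
  rcases List.eq_nil_or_concat' u with rfl | ⟨u, y, rfl⟩
  · rw [List.nil_append, des_cons_top hv]; simp
  have := hu y (by simp)
  rw [List.append_assoc, List.singleton_append, des_append, if_neg (by omega), des_cons_top hv]
  omega

theorem ldr_append_top {u v : List ℕ} {N : ℕ} (hu : ∀ x ∈ u, x < N) (hne : u ≠ []) :
    ldr (u ++ N :: v) = ldr u := by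
  rcases List.eq_nil_or_concat' u with rfl | ⟨u, y, rfl⟩
  · exact absurd rfl hne
  rw [List.append_assoc, List.singleton_append, ldr_append_of_lt (hu y (by simp))]

namespace IsMergeData

variable {e : ℕ → ℕ} {s t : List ℕ}

theorem sameOrder_left (h : IsMergeData e s t) : SameOrder s (s.map (leftVal e)) :=
  sameOrder_map h.strictMonoOn

theorem sameOrder_right : SameOrder t (t.map (rightVal s.length e)) :=
  sameOrder_map ((rightVal_strictMono _ _).strictMonoOn _)

theorem lmax_merge (h : IsMergeData e s t) : lmax (merge e s t) = lmax s + 1 := by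
  rw [merge, lmax_append_top h.left_lt h.right_lt, ← h.sameOrder_left.lmax_eq]

theorem asc_merge (h : IsMergeData e s t) (hs : s ≠ []) :
    asc (merge e s t) = asc s + asc t + 1 := by
  rw [merge, asc_append_top h.left_lt h.right_lt (by simpa using hs), ← h.sameOrder_left.asc_eq,
    ← sameOrder_right.asc_eq]

theorem des_merge (h : IsMergeData e s t) :
    des (merge e s t) = des s + des t + if t = [] then 0 else 1 := by
  rw [merge, des_append_top h.left_lt h.right_lt, ← h.sameOrder_left.des_eq,
    ← sameOrder_right.des_eq]
  simp

theorem ldr_merge (h : IsMergeData e s t) (hs : s ≠ []) : ldr (merge e s t) = ldr s := by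
  rw [merge, ldr_append_top h.left_lt (by simpa using hs), ← h.sameOrder_left.ldr_eq]

/-- A left-to-right minimum to the right of n must be smaller than all of σ, that is, have rank at
most e(1), the smallest height. -/
theorem lmin_merge (h : IsMergeData e s t) (hs : s ≠ []) :
    lmin (merge e s t) = lmin s + lmin (t.filter (· ≤ e 1)) := by
  rw [merge, lmin_append_top h.left_lt (by simpa using hs), lmin_append,
    ← h.sameOrder_left.lmin_eq, List.filter_map]
  congr 1
  have hpos := List.length_pos_of_ne_nil hs
  have h1 : 1 ∈ s := h.left.mem_iff.2 ⟨le_rfl, hpos⟩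
  have hf : t.filter ((fun x => decide (Prec [x] (s.map (leftVal e)))) ∘ rightVal s.length e) =
      t.filter (· ≤ e 1) := by
    apply List.filter_congr
    intro y _
    simp only [Function.comp, decide_eq_decide, Prec, List.mem_singleton, forall_eq]
    constructor
    · exact fun hall => (h.rightVal_lt_iff h1).1 (hall _ (List.mem_map_of_mem h1))
    · intro hy x hx
      obtain ⟨j, hj, rfl⟩ := List.mem_map.1 hx
      have hj' := h.left.mem_iff.1 hj
      have := h.heights.mono 1 j le_rfl hj'.1 hj'.2
      exact (h.rightVal_lt_iff hj).2 (by omega)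
  rw [hf]
  exact (sameOrder_map ((rightVal_strictMono _ _).strictMonoOn _)).lmin_eq.symm

end IsMergeData

end Avoider

namespace Avoider

/-! ### The maps `φ` -/

/-- The number of left-to-right maxima exceeding `M`. -/
def lmaxAbove : ℕ → List ℕ → ℕ
  | _, [] => 0
  | M, a :: w => if M < a then lmaxAbove a w + 1 else lmaxAbove M w

theorem lmaxAbove_concat (M : ℕ) (w : List ℕ) (a : ℕ) :
    lmaxAbove M (w ++ [a]) = lmaxAbove M w + if M < a ∧ ∀ x ∈ w, x < a then 1 else 0 := by
  induction w generalizing M with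
  | nil => simp [lmaxAbove]
  | cons b w ih =>
    simp only [List.cons_append, lmaxAbove, ih]
    by_cases hb : M < b
    · rw [if_pos hb, if_pos hb]
      have : (b < a ∧ ∀ x ∈ w, x < a) ↔ (M < a ∧ ∀ x ∈ b :: w, x < a) := by
        simp only [List.mem_cons, forall_eq_or_imp]
        exact ⟨fun h => ⟨by omega, h⟩, fun h => h.2⟩
      rw [if_congr this rfl rfl]; omega
    · rw [if_neg hb, if_neg hb]
      have : (M < a ∧ ∀ x ∈ w, x < a) ↔ (M < a ∧ ∀ x ∈ b :: w, x < a) := by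
        simp only [List.mem_cons, forall_eq_or_imp]
        exact ⟨fun h => ⟨h.1, by omega, h.2⟩, fun h => ⟨h.1, h.2.2⟩⟩
      rw [if_congr this rfl rfl]

theorem lmax_eq_lmaxAbove {w : List ℕ} (hw : ∀ x ∈ w, 0 < x) : lmax w = lmaxAbove 0 w := by
  induction w using List.reverseRecOn with
  | nil => rfl
  | append_singleton w a ih =>
    rw [lmax_concat, lmaxAbove_concat, ih (fun x hx => hw x (by simp [hx]))]
    have : (∀ x ∈ w, x < a) ↔ (0 < a ∧ ∀ x ∈ w, x < a) :=
      ⟨fun h => ⟨hw a (by simp), h⟩, fun h => h.2⟩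
    rw [if_congr this rfl rfl]

/-- The index drops by one at each left-to-right maximum of u, so it equals 1 exactly when x is
reached. -/
theorem insertBefore_append {M x N : ℕ} {u : List ℕ} (v : List ℕ) (hM : M < x)
    (hu : ∀ y ∈ u, y < x) :
    insertBefore N (lmaxAbove M u + 1) M (u ++ x :: v) = u ++ N :: x :: v := by
  induction u generalizing M with
  | nil => simp [insertBefore, hM, lmaxAbove]
  | cons a u ih =>
    have ha := hu a (by simp)
    have hu' : ∀ y ∈ u, y < x := fun y hy => hu y (by simp [hy])
    rw [List.cons_append, insertBefore, lmaxAbove]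
    by_cases hMa : M < a
    · rw [if_pos hMa, if_pos hMa, if_neg (by omega), Nat.add_sub_cancel, ih ha hu',
        List.cons_append]
    · rw [if_neg hMa, if_neg hMa, ih hM hu', List.cons_append]

theorem exists_eq_append_of_lt_lmaxAbove {M i : ℕ} {w : List ℕ} (hi : i < lmaxAbove M w) :
    ∃ u x v, w = u ++ x :: v ∧ M < x ∧ (∀ y ∈ u, y < x) ∧ lmaxAbove M u = i := by
  induction w generalizing M i with
  | nil => simp [lmaxAbove] at hi
  | cons a w ih =>
    rw [lmaxAbove] at hi
    by_cases hMa : M < a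
    · rw [if_pos hMa] at hi
      rcases i with _ | i
      · exact ⟨[], a, w, rfl, hMa, by simp, rfl⟩
      · obtain ⟨u, x, v, rfl, h1, h2, h3⟩ := ih (show i < lmaxAbove a w by omega)
        refine ⟨a :: u, x, v, rfl, by omega, ?_, by rw [lmaxAbove, if_pos hMa, h3]⟩
        simpa [h1] using h2
    · rw [if_neg hMa] at hi
      obtain ⟨u, x, v, rfl, h1, h2, h3⟩ := ih hi
      refine ⟨a :: u, x, v, rfl, h1, ?_, by rw [lmaxAbove, if_neg hMa, h3]⟩
      simp only [List.mem_cons, forall_eq_or_imp]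
      exact ⟨by omega, h2⟩

theorem IsPermWord.pos {n x : ℕ} {w : List ℕ} (h : IsPermWord n w) (hx : x ∈ w) : 0 < x :=
  (h.mem_iff.1 hx).1

theorem IsPermWord.lt_succ {n x : ℕ} {w : List ℕ} (h : IsPermWord n w) (hx : x ∈ w) : x < n + 1 :=
  Nat.lt_succ_of_le (h.mem_iff.1 hx).2

theorem hat_append {n x : ℕ} {u v : List ℕ} (h : IsPermWord n (u ++ x :: v))
    (hu : ∀ y ∈ u, y < x) : hat (lmax u + 1) (u ++ x :: v) = u ++ (n + 1) :: x :: v := by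
  rw [hat, h.length, lmax_eq_lmaxAbove (fun y hy => h.pos (by simp [hy])),
    insertBefore_append _ (h.pos (by simp)) hu]

theorem lmax_le_append (u v : List ℕ) : lmax u ≤ lmax (u ++ v) := by
  induction v using List.reverseRecOn with
  | nil => simp
  | append_singleton v a ih =>
    rw [← List.append_assoc, lmax_concat]; omega

theorem lmax_pos {w : List ℕ} (hw : w ≠ []) : 0 < lmax w := by
  rcases w with _ | ⟨a, w⟩
  · exact absurd rfl hw
  · have h1 := lmax_le_append [a] w
    have h2 : lmax [a] = 1 := by rw [← List.nil_append [a], lmax_concat]; simp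
    rw [List.singleton_append] at h1
    omega

theorem hat_one {n : ℕ} {w : List ℕ} (h : IsPermWord n w) : hat 1 w = (n + 1) :: w := by
  rcases w with _ | ⟨a, w⟩
  · rw [hat, h.length]; rfl
  · exact hat_append (u := []) h (by simp)

theorem exists_hat_eq {n i : ℕ} {w : List ℕ} (h : IsPermWord n w) (hi : 1 ≤ i)
    (hi' : i ≤ lmax w) : ∃ u x v, w = u ++ x :: v ∧ (∀ y ∈ u, y < x) ∧ lmax u + 1 = i ∧
      hat i w = u ++ (n + 1) :: x :: v := by
  rw [lmax_eq_lmaxAbove (fun _ => h.pos)] at hi'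
  obtain ⟨u, x, v, rfl, -, hu, hl⟩ :=
    exists_eq_append_of_lt_lmaxAbove (show i - 1 < lmaxAbove 0 w by omega)
  rw [← lmax_eq_lmaxAbove (fun y hy => h.pos (by simp [hy]))] at hl
  have hi1 : lmax u + 1 = i := by omega
  exact ⟨u, x, v, rfl, hu, hi1, by rw [← hi1, hat_append h hu]⟩

theorem isPermWord_insert_top {n : ℕ} {u v : List ℕ} :
    IsPermWord (n + 1) (u ++ (n + 1) :: v) ↔ IsPermWord n (u ++ v) := by
  have h1 : (u ++ (n + 1) :: v).Perm ((n + 1) :: (u ++ v)) := List.perm_middle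
  have h2 : (List.range' 1 (n + 1)).Perm ((n + 1) :: List.range' 1 n) := by
    rw [List.range'_concat, Nat.one_mul, Nat.add_comm 1 n]
    exact List.perm_append_singleton _ _
  constructor
  · intro h
    exact (h1.symm.trans (List.Perm.trans h h2)).cons_inv
  · intro h
    exact h1.trans ((List.Perm.cons _ h).trans h2.symm)

theorem asc_append_lt {u v : List ℕ} {x : ℕ} (hu : ∀ y ∈ u, y < x) (hne : u ≠ []) :
    asc (u ++ x :: v) = asc u + asc (x :: v) + 1 := by
  rcases List.eq_nil_or_concat' u with rfl | ⟨u, y, rfl⟩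
  · exact absurd rfl hne
  rw [List.append_assoc, List.singleton_append, asc_append, if_pos (hu y (by simp))]

theorem des_append_lt {u v : List ℕ} {x : ℕ} (hu : ∀ y ∈ u, y < x) :
    des (u ++ x :: v) = des u + des (x :: v) := by
  rcases List.eq_nil_or_concat' u with rfl | ⟨u, y, rfl⟩
  · simp
  have := hu y (by simp)
  rw [List.append_assoc, List.singleton_append, des_append, if_neg (by omega), Nat.add_zero]

/-- `φ(i, π)` is defined. -/
def PhiValid (i : ℕ) (π : List ℕ) : Prop := π = [] ∧ i = 1 ∨ 1 ≤ i ∧ i ≤ lmax π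

theorem PhiValid.one_le {i : ℕ} {π : List ℕ} (h : PhiValid i π) : 1 ≤ i := by
  rcases h with h | h <;> omega

theorem phi_one {n : ℕ} {π : List ℕ} (h : IsPermWord n π) : phi 1 π = (n + 1) :: π := by
  rw [phi, if_pos le_rfl, hat_one h]

/-- `φ(i, π)` for `i > 1` in terms of heights. -/
theorem exists_phi_eq {n i : ℕ} {π : List ℕ} (h : π ∈ avoiders n) (hi : 2 ≤ i)
    (hi' : i ≤ lmax π) : ∃ e s t u x v, IsAvoiderData e s t ∧ s ≠ [] ∧
      (∀ j ∈ s, e j < t.length) ∧ s.length + t.length = n ∧ π = u ++ x :: v ∧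
      (∀ y ∈ u, y < x) ∧ u = s.map (leftVal e) ∧ x :: v = t.map (rightVal s.length e) ∧
      lmax s + 1 = i ∧ phi i π = psi (merge e s t) := by
  obtain ⟨u, x, v, rfl, hu, hl, hh⟩ := exists_hat_eq h.1 (by omega) hi'
  have hav : u ++ (n + 1) :: x :: v ∈ avoiders (n + 1) :=
    ⟨isPermWord_insert_top.2 h.1, (avoids_insert_top hu (h.1.lt_succ (by simp))
      (fun y hy => h.1.lt_succ (by simp [hy]))).2 h.2⟩
  obtain ⟨e, s, t, hD, hn, h1, h2⟩ := exists_avoiderData hav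
  have hls : lmax s = lmax u := by rw [h1]; exact hD.sameOrder_left.lmax_eq
  refine ⟨e, s, t, u, x, v, hD, ?_, ?_, by omega, rfl, hu, h1, h2, by rw [hls, hl], ?_⟩
  · rintro rfl
    rw [lmax_nil] at hls
    omega
  · intro j hj
    obtain ⟨y, t', rfl, hxy, -⟩ := List.map_eq_cons_iff.1 h2.symm
    have := hu (leftVal e j) (by rw [h1]; exact List.mem_map_of_mem hj)
    rw [← hxy, hD.leftVal_lt_iff hj] at this
    have := (hD.right.mem_iff (x := y)).1 (by simp)
    omega
  · rw [phi, if_neg (by omega), hh, merge, hn, ← h1, ← h2]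

theorem indecomposable_cons_top {w : List ℕ} {N : ℕ} (hw : ∀ x ∈ w, x < N) :
    Indecomposable (N :: w) := by
  intro α β he hp
  rcases α with _ | ⟨a, α⟩
  · exact Or.inl rfl
  · right
    rw [List.cons_append, List.cons.injEq] at he
    by_contra hne
    obtain ⟨y, hy⟩ := List.exists_mem_of_ne_nil β hne
    have h1 := hp a (by simp) y hy
    have h2 := hw y (by rw [he.2]; simp [hy])
    omega

/-- For i > 1 all statistics except lmin are determined by s and t. For lmin, inserting n changes
nothing as n is not first, and ψ raises the smallest height to the next one, which admits one more
left-to-right minimum. -/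
theorem phi_properties {n i : ℕ} {π : List ℕ} (h : π ∈ avoiders n) (hi : PhiValid i π) :
    phi i π ∈ avoiders (n + 1) ∧ Indecomposable (phi i π) ∧ lmax (phi i π) = i ∧
      lmin (phi i π) = lmin π + 1 ∧ ldr (phi i π) = (ldr π + if i = 1 then 1 else 0) ∧
      asc (phi i π) = asc π ∧ des (phi i π) = des π + if π = [] then 0 else 1 := by
  have hlt : ∀ x ∈ π, x < n + 1 := fun x hx => h.1.lt_succ hx
  by_cases hi1 : i = 1
  · subst hi1
    rw [phi_one h.1, if_pos rfl]
    refine ⟨⟨isPermWord_insert_top (u := []).2 h.1, (avoids_cons_top hlt).2 h.2⟩,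
      indecomposable_cons_top hlt, ?_, lmin_cons_top hlt, ldr_cons_top hlt, asc_cons_top hlt,
      des_cons_top hlt⟩
    exact (lmax_append_top (u := []) (by simp) hlt).trans (by simp)
  · have hi' : i ≤ lmax π := by
      rcases hi with hi | hi
      · exact absurd hi.2 hi1
      · exact hi.2
    have hone := hi.one_le
    obtain ⟨e, s, t, u, x, v, hD, hs, hlt', hn, hπ, hu, h1, h2, hl, hphi⟩ :=
      exists_phi_eq h (by omega) hi'
    have hnx := hD.next hlt'
    have hune : u ≠ [] := by rw [h1]; simpa using hs
    have htne : t ≠ [] := by rintro rfl; simp at h2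
    have hπne : π ≠ [] := by rw [hπ]; simp
    have hu' := hD.sameOrder_left
    rw [← h1] at hu'
    have hv' := IsMergeData.sameOrder_right (e := e) (s := s) (t := t)
    rw [← h2] at hv'
    rw [hphi, hD.psi_merge hlt', if_neg hi1, if_neg hπne]
    refine ⟨?_, ?_, ?_, ?_, ?_, ?_, ?_⟩
    · rw [← hn]; exact hnx.mem_avoiders
    · rw [hnx.indecomposable_iff hs]
      intro j hj
      have := (nextHeight_spec (height_length hD.right) (hlt' j hj)).2.1
      omega
    · rw [hnx.toIsMergeData.lmax_merge, hl]
    · have h1s : 1 ∈ s := hD.left.mem_iff.2 ⟨le_rfl, List.length_pos_of_ne_nil hs⟩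
      have hm : lmin (merge e s t) = lmin π := by
        rw [merge, ← h1, ← h2, lmin_append_top (fun y hy => hD.left_lt y (by rwa [← h1])) hune, hπ]
      rw [← hm, hnx.toIsMergeData.lmin_merge hs, hD.toIsMergeData.lmin_merge hs,
        lmin_filter_nextHeight hD.right hD.avoids_right (hD.height 1 h1s) (hlt' 1 h1s)]
      omega
    · rw [hnx.toIsMergeData.ldr_merge hs, hπ, ldr_append_top hu hune, hu'.ldr_eq, Nat.add_zero]
    · rw [hnx.toIsMergeData.asc_merge hs, hπ, asc_append_lt hu hune, hu'.asc_eq, hv'.asc_eq]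
    · rw [hnx.toIsMergeData.des_merge, hπ, des_append_lt hu, hu'.des_eq, hv'.des_eq, if_neg htne]

/-- The index is recovered as lmax of the image; then ψ is undone and the largest letter deleted. -/
theorem phi_injective {n i i' : ℕ} {π π' : List ℕ} (h : π ∈ avoiders n) (hi : PhiValid i π)
    (h' : π' ∈ avoiders n) (hi' : PhiValid i' π') (heq : phi i π = phi i' π') :
    i = i' ∧ π = π' := by
  have hii : i = i' := by
    rw [← (phi_properties h hi).2.2.1, heq, (phi_properties h' hi').2.2.1]
  subst hii
  refine ⟨rfl, ?_⟩
  by_cases hi1 : i = 1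
  · subst hi1
    rw [phi_one h.1, phi_one h'.1] at heq
    exact (List.cons.inj heq).2
  · have hl : i ≤ lmax π := by
      rcases hi with hi | hi
      · exact absurd hi.2 hi1
      · exact hi.2
    have hl' : i ≤ lmax π' := by
      rcases hi' with hi | hi
      · exact absurd hi.2 hi1
      · exact hi.2
    have hone := hi.one_le
    obtain ⟨e, s, t, u, x, v, hD, -, hlt, hn, hπ, -, h1, h2, -, hphi⟩ :=
      exists_phi_eq h (by omega) hl
    obtain ⟨e', s', t', u', x', v', hD', -, hlt', hn', hπ', -, h1', h2', -, hphi'⟩ :=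
      exists_phi_eq h' (by omega) hl'
    rw [hphi, hphi'] at heq
    have hm := hD.psi_injective hlt hD' hlt' heq
    have key : ∀ a b : List ℕ, (∀ y ∈ a, y < n + 1) → (∀ y ∈ b, y < n + 1) →
        (a ++ (n + 1) :: b).filter (· ≠ n + 1) = a ++ b := by
      intro a b ha hb
      rw [List.filter_append, List.filter_cons_of_neg (by simp), List.filter_eq_self.2,
        List.filter_eq_self.2]
      · intro y hy; simpa using (hb y hy).ne
      · intro y hy; simpa using (ha y hy).ne
    have hl1 := hD.left_lt
    have hl2 := hD.right_lt
    have hl3 := hD'.left_lt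
    have hl4 := hD'.right_lt
    rw [hn] at hl1 hl2
    rw [hn'] at hl3 hl4
    rw [hπ, hπ', h1, h2, h1', h2', ← key _ _ hl1 hl2, ← key _ _ hl3 hl4]
    rw [merge, merge, hn, hn'] at hm
    rw [hm]

theorem phi_surjective {n : ℕ} {ρ : List ℕ} (h : ρ ∈ avoiders (n + 1)) (hi : Indecomposable ρ) :
    ∃ i π, π ∈ avoiders n ∧ PhiValid i π ∧ phi i π = ρ := by
  obtain ⟨σ, τ, rfl⟩ := List.append_of_mem (h.1.mem_iff.2 ⟨by omega, le_rfl⟩ : n + 1 ∈ ρ)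
  by_cases hσ : σ = []
  · subst hσ
    have hp : IsPermWord n τ := isPermWord_insert_top (u := []).1 h.1
    refine ⟨1, τ, ⟨hp, (avoids_cons_top fun x hx => hp.lt_succ hx).1 h.2⟩, ?_, phi_one hp⟩
    by_cases hτ : τ = []
    · exact Or.inl ⟨hτ, rfl⟩
    · exact Or.inr ⟨le_rfl, lmax_pos hτ⟩
  · obtain ⟨e, s, t, hD, hn, h1, h2⟩ := exists_avoiderData h
    have hs : s ≠ [] := by rintro rfl; exact hσ (by simpa using h1)
    have hρ : σ ++ (n + 1) :: τ = merge e s t := by rw [merge, ← h1, ← h2, hn]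
    rw [hρ] at hi ⊢
    obtain ⟨e', hD', hlt, hpsi⟩ := hD.exists_prev ((hD.indecomposable_iff hs).1 hi)
    obtain ⟨j₀, hj₀⟩ := List.exists_mem_of_ne_nil s hs
    rcases t with _ | ⟨y, t⟩
    · have := hlt j₀ hj₀; simp at this
    set u := s.map (leftVal e') with hu_def
    set x := rightVal s.length e' y with hx_def
    set v := t.map (rightVal s.length e') with hv_def
    have hm : merge e' s (y :: t) = u ++ (n + 1) :: x :: v := by rw [merge, hn, List.map_cons]
    have hune : u ≠ [] := by simpa [hu_def] using hs
    have hu : ∀ z ∈ u, z < x := by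
      intro z hz
      obtain ⟨j, hj, rfl⟩ := List.mem_map.1 hz
      rw [hx_def, hD'.leftVal_lt_iff hj]
      by_contra hc
      -- If the first letter of t were at most the height, `head` would force all of t to be at most
      -- the height, contrary to the height being less than |t|. So the letter after n is a
      -- left-to-right maximum once n is removed.
      have hall := (hD'.height j hj).head y t rfl (by omega)
      have hmem : (y :: t).length ∈ y :: t := hD'.right.mem_iff.2 ⟨by simp, le_rfl⟩
      have := hlt j hj
      rcases List.mem_cons.1 hmem with hq | hq
      · omega
      · have := hall _ hq; omega
    have hav := hD'.mem_avoiders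
    rw [hm, hn] at hav
    have hp : IsPermWord n (u ++ x :: v) := isPermWord_insert_top.1 hav.1
    have hmem : u ++ x :: v ∈ avoiders n :=
      ⟨hp, (avoids_insert_top hu (hp.lt_succ (by simp)) (fun z hz => hp.lt_succ (by simp [hz]))).1
        hav.2⟩
    refine ⟨lmax u + 1, _, hmem, Or.inr ⟨by omega, ?_⟩, ?_⟩
    · have h3 := lmax_le_append (u ++ [x]) v
      rw [lmax_concat, if_pos hu, List.append_assoc, List.singleton_append] at h3
      exact h3
    · have := lmax_pos hune
      rw [phi, if_neg (by omega), hat_append hp hu, ← hm, hpsi]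

end Avoider

namespace Avoider

/-! ### Sums of permutations -/

theorem strictMono_add_right (k : ℕ) : StrictMono (· + k) := fun _ _ h => Nat.add_lt_add_right h k

theorem prec_oplus {p q : ℕ} {a b : List ℕ} (ha : IsPermWord p a) (hb : IsPermWord q b) :
    Prec a (b.map (· + a.length)) := by
  intro x hx y hy
  obtain ⟨z, hz, rfl⟩ := List.mem_map.1 hy
  have := (ha.mem_iff.1 hx).2
  have := hb.pos hz
  have := ha.length
  omega

theorem oplus_mem_avoiders {p q : ℕ} {a b : List ℕ} (ha : a ∈ avoiders p) (hb : b ∈ avoiders q) :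
    oplus a b ∈ avoiders (p + q) := by
  have hprec := prec_oplus ha.1 hb.1
  refine ⟨?_, (avoids_append_prec hprec).2
    ⟨ha.2, (avoids_map ((strictMono_add_right _).strictMonoOn _)).2 hb.2⟩⟩
  have hl := ha.1.length
  have hl' := hb.1.length
  rw [isPermWord_iff]
  refine ⟨?_, by simp [oplus]; omega, ?_⟩
  · rw [oplus, List.nodup_append']
    refine ⟨ha.1.nodup, hb.1.nodup.map (strictMono_add_right _).injective, ?_⟩
    intro x hx hx'
    have := hprec x hx x hx'
    omega
  · intro x hx
    rcases List.mem_append.1 hx with hx | hx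
    · have := ha.1.mem_iff.1 hx; omega
    · obtain ⟨z, hz, rfl⟩ := List.mem_map.1 hx
      have := hb.1.mem_iff.1 hz; omega

theorem isPermWord_of_prec {n : ℕ} {u v : List ℕ} (h : IsPermWord n (u ++ v)) (hp : Prec u v) :
    IsPermWord u.length u ∧ ∃ w, IsPermWord v.length w ∧ v = w.map (· + u.length) := by
  have hn := h.nodup
  rw [List.nodup_append'] at hn
  have hln : u.length + v.length = n := by simpa using h.length
  have hcard : ∀ x ∈ u, x ≤ u.length := by
    intro x hx
    by_contra hc
    -- If x > |u|, the |v| letters of v would have to fit into n − x < |v| places.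
    have hsub : v.toFinset ⊆ Finset.Icc (x + 1) n := by
      intro y hy
      rw [List.mem_toFinset] at hy
      have := hp x hx y hy
      have := (h.mem_iff (x := y)).1 (by simp [hy])
      rw [Finset.mem_Icc]; omega
    have h1 := Finset.card_le_card hsub
    have h2 := (h.mem_iff (x := x)).1 (by simp [hx])
    rw [List.toFinset_card_of_nodup hn.2.1, Nat.card_Icc] at h1
    omega
  have hu : IsPermWord u.length u := by
    rw [isPermWord_iff]
    exact ⟨hn.1, rfl, fun x hx => ⟨h.pos (by simp [hx]), hcard x hx⟩⟩
  have hv : ∀ y ∈ v, u.length < y := by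
    intro y hy
    by_contra hc
    have hyu : y ∈ u := hu.mem_iff.2 ⟨h.pos (by simp [hy]), by omega⟩
    exact hn.2.2 hyu hy
  refine ⟨hu, v.map (· - u.length), ?_, ?_⟩
  · rw [isPermWord_iff]
    refine ⟨hn.2.1.map_on (fun x hx y hy he => ?_), by simp, ?_⟩
    · have := hv x hx
      have := hv y hy
      omega
    · intro x hx
      obtain ⟨y, hy, rfl⟩ := List.mem_map.1 hx
      have := hv y hy
      have := (h.mem_iff (x := y)).1 (by simp [hy])
      omega
  · rw [List.map_map]
    conv_lhs => rw [← List.map_id v]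
    apply List.map_congr_left
    intro y hy
    have := hv y hy
    simp only [Function.comp, id]
    omega

/-- The first summand is the shortest nonempty prefix lying below the rest; minimality makes it
indecomposable. -/
theorem exists_oplus_eq {n : ℕ} {π : List ℕ} (h : π ∈ avoiders n) (hne : π ≠ []) :
    ∃ p q a b, p + q = n ∧ a ∈ avoiders p ∧ b ∈ avoiders q ∧ a ≠ [] ∧ Indecomposable a ∧
      π = oplus a b := by
  classical
  have hex : ∃ k, ∃ u v, π = u ++ v ∧ Prec u v ∧ u ≠ [] ∧ u.length = k :=
    ⟨_, π, [], by simp, by simp [Prec], hne, rfl⟩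
  obtain ⟨u, v, rfl, hp, hu, hk⟩ := Nat.find_spec hex
  have hmin := fun m => Nat.find_min (m := m) hex
  obtain ⟨hpu, w, hw, hvw⟩ := isPermWord_of_prec h.1 hp
  have hln : u.length + v.length = n := by simpa using h.1.length
  have hav := (avoids_append_prec hp).1 h.2
  refine ⟨u.length, v.length, u, w, hln, ⟨hpu, hav.1⟩, ⟨hw, ?_⟩, hu, ?_, by rw [oplus, ← hvw]⟩
  · have := hav.2
    rwa [hvw, avoids_map ((strictMono_add_right _).strictMonoOn _)] at this
  · rintro α β rfl hαβ
    by_contra hc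
    push Not at hc
    refine hmin α.length ?_ ⟨α, β ++ v, by simp, ?_, hc.1, rfl⟩
    · have := List.length_pos_of_ne_nil hc.2
      rw [← hk, List.length_append]; omega
    · intro x hx y hy
      rcases List.mem_append.1 hy with hy | hy
      · exact hαβ x hx y hy
      · exact hp x (by simp [hx]) y hy

/-- One of the two first summands is a prefix of the other and would split it if it were proper. -/
theorem oplus_injective {p q p' q' : ℕ} {a b a' b' : List ℕ} (ha : IsPermWord p a)
    (hb : IsPermWord q b) (ha' : IsPermWord p' a') (hb' : IsPermWord q' b') (hne : a ≠ [])
    (hne' : a' ≠ []) (hi : Indecomposable a) (hi' : Indecomposable a')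
    (heq : oplus a b = oplus a' b') : a = a' ∧ b = b' := by
  have hp := prec_oplus ha hb
  have hp' := prec_oplus ha' hb'
  have haa : a = a' := by
    rw [oplus, oplus, List.append_eq_append_iff] at heq
    rcases heq with ⟨γ, rfl, hγ⟩ | ⟨γ, rfl, hγ⟩
    · rcases hi' a γ rfl (fun x hx y hy => hp x hx y (by rw [hγ]; simp [hy])) with h | rfl
      · exact absurd h hne
      · simp
    · rcases hi a' γ rfl (fun x hx y hy => hp' x hx y (by rw [hγ]; simp [hy])) with h | rfl
      · exact absurd h hne'
      · simp
  subst haa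
  refine ⟨rfl, ?_⟩
  rw [oplus, oplus, List.append_cancel_left_eq] at heq
  exact List.map_injective_iff.2 (strictMono_add_right _).injective heq

/-! ### The map `f` -/

open PTree

theorem fL_cons (j : ℕ) (ws cs : List PTree) :
    fL (node j ws :: cs) = oplus (phi j (fL ws)) (fL cs) := by
  simp [fL, f]

theorem nodesL_eq_zero {cs : List PTree} : nodesL cs = 0 ↔ cs = [] := by
  rcases cs with _ | ⟨⟨j, ws⟩, cs⟩
  · simp [nodesL]
  · simp [nodesL, nodes]

theorem eq_nil_iff_of_mem_avoiders {cs : List PTree} {π : List ℕ} (h : π ∈ avoiders (nodesL cs)) :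
    π = [] ↔ cs = [] := by
  rw [← nodesL_eq_zero, ← h.1.length, List.length_eq_zero_iff]

theorem phiValid_of_isProper {j : ℕ} {ws : List PTree} (hc : IsProper (node j ws)) {π : List ℕ}
    (h : π ∈ avoiders (nodesL ws)) (hl : lmax π = lsum ws) : PhiValid j π := by
  rw [isProper_node] at hc
  by_cases hws : ws = []
  · exact Or.inl ⟨(eq_nil_iff_of_mem_avoiders h).2 hws, hc.1 hws⟩
  · rw [← hl] at hc
    exact Or.inr (hc.2.1 hws)

/-- The properties are proved together: φ may be applied with index j only because lmax of the inner
word is the sum of the labels that bounds j. The correction to asc is there because the empty word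
and the one-letter word both have no ascents, while `leavesL` gives 0 and 1. -/
theorem fL_properties {cs : List PTree} (hcs : AllProper cs) :
    fL cs ∈ avoiders (nodesL cs) ∧ lmax (fL cs) = lsum cs ∧ comp (fL cs) = cs.length ∧
      lmin (fL cs) = lpathL cs ∧ ldr (fL cs) = lonesL cs ∧
      (asc (fL cs) + if cs = [] then 0 else 1) = leavesL cs ∧ des (fL cs) = internalsL cs := by
  induction cs using forest_cons_induction with
  | nil =>
    simp only [fL, nodesL, lmax_nil, lmin_nil, ldr_nil, comp_nil, asc_nil, des_nil]
    exact ⟨⟨List.Perm.refl _, avoids_nil⟩, by simp [lpathL, lonesL, leavesL, internalsL]⟩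
  | cons j ws cs ih1 ih2 =>
    have hc := hcs.1
    rw [isProper_node] at hc
    obtain ⟨a1, a2, a3, a4, a5, a6, a7⟩ := ih1 hc.2.2
    obtain ⟨b1, b2, b3, b4, b5, b6, b7⟩ := ih2 hcs.2
    have hv := phiValid_of_isProper hcs.1 a1 a2
    obtain ⟨c1, c2, c3, c4, c5, c6, c7⟩ := phi_properties a1 hv
    have hprec := prec_oplus c1.1 b1.1
    have hne : phi j (fL ws) ≠ [] := by
      intro h0
      have := c1.1.length
      rw [h0] at this
      simp at this
    have hso : SameOrder (fL cs) ((fL cs).map (· + (phi j (fL ws)).length)) :=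
      sameOrder_map ((strictMono_add_right _).strictMonoOn _)
    have hwsnil := eq_nil_iff_of_mem_avoiders a1
    have hcsnil := eq_nil_iff_of_mem_avoiders b1
    rw [fL_cons]
    refine ⟨?_, ?_, ?_, ?_, ?_, ?_, ?_⟩
    · have := oplus_mem_avoiders c1 b1
      rwa [nodesL, nodes_node]
    · rw [oplus, lmax_append_prec hprec, ← hso.lmax_eq, c3, b2, lsum_cons, label_node]
    · rw [oplus, comp_append hprec hne c2, comp_map (strictMono_add_right _), b3, List.length_cons]
    · rw [oplus, lmin_append_prec hprec hne, c4, a4, lpathL, lpath]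
    · rw [oplus, ldr_append_prec hprec hne, c5, a5]
      by_cases hj : j = 1 <;> simp [lonesL, lones, hj]
    · have hphi : asc (phi j (fL ws)) + 1 = leaves (node j ws) := by
        rw [c6, leaves]
        by_cases hws : ws = []
        · subst hws; simp [fL]
        · simpa [hws] using a6
      rw [if_neg (by simp), leavesL, ← hphi, ← b6]
      by_cases hcs' : cs = []
      · subst hcs'; simp [oplus, fL]
      · rw [oplus, asc_append_prec hprec hne (by simpa [hcsnil] using hcs'), ← hso.asc_eq,
          if_neg hcs']
        omega
    · rw [oplus, des_append_prec hprec, ← hso.des_eq, c7, a7, b7, internalsL, internals]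
      by_cases hws : ws = []
      · subst hws; simp [fL, internalsL]
      · rw [if_neg (by rwa [hwsnil]), if_neg (by simpa using hws)]

theorem fL_injective {cs cs' : List PTree} (hcs : AllProper cs) (hcs' : AllProper cs')
    (heq : fL cs = fL cs') : cs = cs' := by
  induction cs using forest_cons_induction generalizing cs' with
  | nil =>
    have h1 := (fL_properties hcs').1
    rw [← heq] at h1
    exact ((eq_nil_iff_of_mem_avoiders h1).1 rfl).symm
  | cons j ws cs ih1 ih2 =>
    rcases cs' with _ | ⟨⟨j', ws'⟩, cs'⟩
    · have h1 := (fL_properties hcs).1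
      rw [heq] at h1
      exact (eq_nil_iff_of_mem_avoiders h1).1 rfl
    · have hc := hcs.1
      have hc' := hcs'.1
      rw [isProper_node] at hc hc'
      have A := fL_properties hc.2.2
      have A' := fL_properties hc'.2.2
      have hv := phiValid_of_isProper hcs.1 A.1 A.2.1
      have hv' := phiValid_of_isProper hcs'.1 A'.1 A'.2.1
      have P := phi_properties A.1 hv
      have P' := phi_properties A'.1 hv'
      have hne : ∀ {k : ℕ} {w : List ℕ}, w ∈ avoiders (k + 1) → w ≠ [] := by
        rintro k w hw rfl
        have := hw.1.length
        simp at this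
      rw [fL_cons, fL_cons] at heq
      obtain ⟨h1, h2⟩ := oplus_injective P.1.1 (fL_properties hcs.2).1.1 P'.1.1
        (fL_properties hcs'.2).1.1 (hne P.1) (hne P'.1) P.2.1 P'.2.1 heq
      have hlen : nodesL ws = nodesL ws' := by
        have e1 := P.1.1.length
        have e2 := P'.1.1.length
        rw [h1] at e1
        omega
      obtain ⟨rfl, h3⟩ := phi_injective A.1 hv (hlen ▸ A'.1) hv' h1
      rw [ih1 hc.2.2 hc'.2.2 h3, ih2 hcs.2 hcs'.2 h2]

theorem fL_surjective {n : ℕ} {π : List ℕ} (h : π ∈ avoiders n) :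
    ∃ cs, AllProper cs ∧ nodesL cs = n ∧ fL cs = π := by
  induction n using Nat.strong_induction_on generalizing π with
  | _ n ih =>
    by_cases hne : π = []
    · subst hne
      exact ⟨[], trivial, h.1.length, rfl⟩
    · obtain ⟨p, q, a, b, hpq, ha, hb, hane, hai, rfl⟩ := exists_oplus_eq h hne
      obtain ⟨m, rfl⟩ : ∃ m, p = m + 1 := by
        have := List.length_pos_of_ne_nil hane
        have := ha.1.length
        exact ⟨p - 1, by omega⟩
      obtain ⟨i, ρ, hρ, hv, rfl⟩ := phi_surjective ha hai
      obtain ⟨ws, hws, hwn, rfl⟩ := ih m (by omega) hρ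
      obtain ⟨cs, hcs, hcn, rfl⟩ := ih q (by omega) hb
      refine ⟨node i ws :: cs, ⟨?_, hcs⟩, by rw [nodesL, nodes_node]; omega, fL_cons _ _ _⟩
      have hp := fL_properties hws
      rw [isProper_node]
      refine ⟨?_, ?_, hws⟩
      · rintro rfl
        rcases hv with hv | hv
        · exact hv.2
        · simp [fL] at hv; omega
      · intro hne'
        rcases hv with hv | hv
        · exact absurd ((eq_nil_iff_of_mem_avoiders hp.1).1 hv.1) hne'
        · rwa [hp.2.1] at hv

theorem f_eq_fL (t : PTree) : f t = fL t.children := by cases t; simp [f]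

theorem nodes_eq (t : PTree) : t.nodes = nodesL t.children + 1 := by cases t; simp [nodes_node]

theorem bijOn_f (n : ℕ) : Set.BijOn f (betaTrees (n + 1)) (avoiders n) := by
  refine ⟨?_, ?_, ?_⟩
  · rintro t ⟨ht, hn⟩
    rw [nodes_eq] at hn
    have := (fL_properties ht.allProper).1
    rwa [← f_eq_fL, show nodesL t.children = n by omega] at this
  · rintro t ⟨ht, -⟩ t' ⟨ht', -⟩ heq
    rw [f_eq_fL, f_eq_fL] at heq
    rw [ht.eq_node, ht'.eq_node, fL_injective ht.allProper ht'.allProper heq]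
  · intro π hπ
    obtain ⟨cs, hcs, hn, rfl⟩ := fL_surjective hπ
    exact ⟨node (lsum cs) cs, ⟨⟨rfl, hcs⟩, by rw [nodes_node, hn]⟩, by simp [f]⟩

-- The map g seen on trees.

theorem fInv_f {t : PTree} (ht : t.IsBeta) : fInv (f t) = t := by
  have hinj : Set.InjOn f {t | t.IsBeta} := by
    intro t ht t' ht' heq
    rw [Set.mem_ofPred_eq] at ht ht'
    rw [f_eq_fL, f_eq_fL] at heq
    rw [ht.eq_node, ht'.eq_node, fL_injective ht.allProper ht'.allProper heq]
  exact hinj.leftInvOn_invFunOn ht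

theorem involution_f {t : PTree} (ht : t.IsBeta) : involution (f t) = f t.mirror.h.mirror := by
  rw [involution, fInv_f ht]

theorem isBeta_mirror_h_mirror {t : PTree} (ht : t.IsBeta) : t.mirror.h.mirror.IsBeta :=
  isBeta_mirror (isBeta_h (isBeta_mirror ht))

theorem mapsTo_mirror (N : ℕ) : Set.MapsTo mirror (betaTrees N) (betaTrees N) :=
  fun t ht => ⟨isBeta_mirror ht.1, by rw [nodes_mirror, ht.2]⟩

theorem mapsTo_h (N : ℕ) : Set.MapsTo PTree.h (betaTrees N) (betaTrees N) :=
  fun t ht => ⟨isBeta_h ht.1, by rw [nodes_h ht.1, ht.2]⟩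

theorem involution_involution_f {t : PTree} (ht : t.IsBeta) :
    involution (involution (f t)) = f t := by
  rw [involution_f ht, involution_f (isBeta_mirror_h_mirror ht), mirror_mirror,
    h_h (isBeta_mirror ht), mirror_mirror]

/-- Only half of the statement about statistics: each equality translates a statistic to t, through
the mirror map and `h`, and back. The other half needs no further computation since g is an
involution. -/
theorem involution_stats_f {t : PTree} (ht : t.IsBeta) :
    des (f t) = asc (involution (f t)) ∧ lmax (f t) = lmin (involution (f t)) ∧
      comp (f t) = ldr (involution (f t)) := by
  rw [involution_f ht]
  obtain ⟨-, h1, h2, -, -, -, h3⟩ := fL_properties ht.allProper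
  obtain ⟨-, -, -, k1, k2, k3, -⟩ := fL_properties (isBeta_mirror_h_mirror ht).allProper
  have hm := (allProper_mirrorL t.children).2 ht.allProper
  obtain ⟨-, g1, g2, -⟩ := hL_properties hm
  have hc : t.mirror.h.mirror.children = mirrorL (hL (mirrorL t.children)).children := by
    cases t with
    | node r cs =>
      simp only [mirror, h_node, children_node]
      cases hL (mirrorL cs)
      simp [mirror]
  rw [hc] at k1 k2 k3
  rw [f_eq_fL t, f_eq_fL t.mirror.h.mirror, hc]
  refine ⟨?_, ?_, ?_⟩
  · rw [h3]
    rw [leavesL_mirrorL] at k3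
    by_cases hcs : t.children = []
    · rw [hcs]; simp [mirrorL, hL, leaf, fL, internalsL]
    · have hcs' : mirrorL t.children ≠ [] := by rwa [Ne, mirrorL_eq_nil]
      rw [leavesL_internalsL_hL hm hcs', internalsL_mirrorL,
        if_neg (by rw [mirrorL_eq_nil]; exact children_hL_ne_nil hcs')] at k3
      omega
  · rw [h1, k1, ← lsum_mirrorL, ← g1]; rfl
  · rw [h2, k2, ← length_mirrorL, ← g2]; rfl

end Avoider

theorem corollary4 (n : ℕ) :
    Set.BijOn Avoider.f (PTree.betaTrees (n + 1)) (Avoider.avoiders n) ∧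
    Set.MapsTo PTree.mirror (PTree.betaTrees (n + 1)) (PTree.betaTrees (n + 1)) ∧
    Set.MapsTo PTree.h (PTree.betaTrees (n + 1)) (PTree.betaTrees (n + 1)) ∧
    Set.MapsTo Avoider.involution (Avoider.avoiders n) (Avoider.avoiders n) ∧
    ∀ π ∈ Avoider.avoiders n,
      Avoider.involution (Avoider.involution π) = π ∧
      Avoider.asc π = Avoider.des (Avoider.involution π) ∧
      Avoider.lmax π = Avoider.lmin (Avoider.involution π) ∧
      Avoider.lmin π = Avoider.lmax (Avoider.involution π) ∧
      Avoider.comp π = Avoider.ldr (Avoider.involution π) ∧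
      Avoider.ldr π = Avoider.comp (Avoider.involution π) := by
  have hbij := Avoider.bijOn_f n
  have hmirror := Avoider.mapsTo_mirror (n + 1)
  have hh := Avoider.mapsTo_h (n + 1)
  refine ⟨hbij, hmirror, hh, ?_, ?_⟩
  · intro π hπ
    obtain ⟨t, ht, rfl⟩ := hbij.surjOn hπ
    rw [Avoider.involution_f ht.1]
    exact hbij.mapsTo (hmirror (hh (hmirror ht)))
  · intro π hπ
    obtain ⟨t, ht, rfl⟩ := hbij.surjOn hπ
    have hinv := Avoider.involution_involution_f ht.1
    obtain ⟨-, h1, h2⟩ := Avoider.involution_stats_f ht.1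
    -- The same three equalities for the tree of the image word, whose own image is the original
    -- word, give the remaining ones.
    obtain ⟨k0, k1, k2⟩ := Avoider.involution_stats_f (hmirror (hh (hmirror ht))).1
    rw [← Avoider.involution_f ht.1, hinv] at k0 k1 k2
    exact ⟨hinv, k0.symm, h1, k1.symm, h2, k2.symm⟩
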